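/- Let $X$ be a smooth projective split toric variety over $\mathbf{Q}$ of dimension $n\ge 1$, given by a fan $\Sigma$ in $N=\mathbf{Z}^n$ with set of rays $\Sigma(1)$ and primitive generators $v_\rho$. Let $D_\rho$ be the torus-invariant divisor of the ray $\rho$, so that $\mathrm{Pic}(X)=\mathbf{Z}^{\Sigma(1)}/\mathrm{Hom}(N,\mathbf{Z})$ and $\omega_X^{-1}=\sum_\rho [D_\rho]$, let $t=\operatorname{rk}\mathrm{Pic}(X)$, and let $f$ be the smallest positive integer such that some $f$ rays of $\Sigma$ are not contained in a common cone of $\Sigma$. Let $\mathcal{T}\subset \mathbf{A}^{\Sigma(1)}_{\mathbf{Z}}$ be the universal torsor, i.e. the complement of the closed subscheme defined by the monomials $\prod_{\rho\notin\sigma}Y_\rho$ ($\sigma\in\Sigma$); thus $\mathcal{T}(\mathbf{Z})$ is the set of $y\in\mathbf{Z}^{\Sigma(1)}$ for which the integers $\prod_{\rho\notin\sigma}y_\rho$ ($\sigma\in\Sigma$) generate the unit ideal. Let $h_{\mathcal{T},\infty}:\mathcal{T}(\mathbf{R})\to\mathrm{Pic}(X)^\vee_{\mathbf{R}}$ be the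 map such that, for each base point free class $[D]$, $$\langle [D],h_{\mathcal{T},\infty}(y)\rangle=\log\max_{E}\prod_\rho|y_\rho|^{E_\rho},$$ where $E$ runs over the effective torus-invariant divisors linearly equivalent to $D$. Let $\omega_{\mathcal{T},p}$ be the restriction to $\mathcal{T}(\mathbf{Q}_p)$ of the Haar measure of $\mathbf{Q}_p^{\Sigma(1)}$ giving $\mathbf{Z}_p^{\Sigma(1)}$ measure $1$. Let $\mu_{X,\infty}$ be the measure on $X(\mathbf{R})=\mathcal{T}(\mathbf{R})/\mathrm{Hom}(\mathrm{Pic}(X),\mathbf{R}^\times)$ given on the chart $U_\sigma(\mathbf{R})=\mathbf{R}^n$ of each maximal cone $\sigma$ by $\|\partial/\partial x_1\wedge\dots\wedge\partial/\partial x_n\|_\infty\,dx_1\cdots dx_n$, where the norm on $\omega_X^{-1}$ is the toric one, so that the density at $x$ is $\exp(-\langle\omega_X^{-1},h_{\mathcal{T},\infty}(\tilde x)\rangle)$, $\tilde x\in\mathcal{T}(\mathbf{R})$ being the lift of $x$ with coordinates $1$ outside $\sigma$. Let $\nu(\mathrm{D})=\int_{\mathrm{D}}e^{\langle\omega_X^{-1},y\rangle}\,dy$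 for compact $\mathrm{D}\subset\mathrm{Pic}(X)^\vee_{\mathbf{R}}$, where $dy$ is the Haar measure for which the dual lattice of $\mathrm{Pic}(X)$ has covolume $1$. Let $\mathrm{D}_1\subset\mathrm{Pic}(X)^\vee_{\mathbf{R}}$ be a finite union of compact polyhedra, let $u$ be in the interior of the dual $C_{\mathrm{eff}}(X)^\vee$ of the effective cone, put $\mathrm{D}_B=\mathrm{D}_1+\log(B)\,u$ for $B\ge 1$, and let $0<\varepsilon<1-\frac1f$. Then the product $\prod_p\omega_{\mathcal{T},p}(\mathcal{T}(\mathbf{Z}_p))$ converges unconditionally, $\mu_{X,\infty}(X(\mathbf{R}))$ is finite, and there is a constant $C>0$, independent of $B$, such that for every real $B\ge1$ the set of $y\in\mathcal{T}(\mathbf{Z})$ with $h_{\mathcal{T},\infty}(y)\in\mathrm{D}_B$ is finite and $$\Bigl|\sharp\{y\in\mathcal{T}(\mathbf{Z})\mid h_{\mathcal{T},\infty}(y)\in\mathrm{D}_B\}-2^t\prod_p\omega_{\mathcal{T},p}(\mathcal{T}(\mathbf{Z}_p))\cdot\mu_{X,\infty}(X(\mathbf{R}))\cdot\nu(\mathrm{D}_1)\,B^{\langle\omega_X^{-1},u\rangle}\Bigr|\le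 C\,B^{\langle\omega_X^{-1},u\rangle-(1-\frac1f-\varepsilon)\min_{\rho\in\Sigma(1)}\langle[D_\rho],u\rangle}.$$ -/

import Mathlib

open MeasureTheory Set

noncomputable section

/-- The closed convex cone of `ℝⁿ` generated by the vectors `v ρ`, `ρ ∈ σ`. -/
def realCone {n : ℕ} {ι : Type*} [Fintype ι] (v : ι → Fin n → ℤ) (σ : Finset ι) :
    Set (Fin n → ℝ) :=
  {x | ∃ c : ι → ℝ, (∀ ρ, 0 ≤ c ρ) ∧ (∀ ρ, ρ ∉ σ → c ρ = 0) ∧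
    x = ∑ ρ, c ρ • (fun i => (v ρ i : ℝ))}

/-- The homomorphism `M = ℤⁿ → Div_T(X) = ℤ^{Σ(1)}`, `m ↦ div(χ^m) = ∑_ρ ⟨m, v_ρ⟩ D_ρ`. -/
def charDiv {n : ℕ} {ι : Type*} (v : ι → Fin n → ℤ) : (Fin n → ℤ) →ₗ[ℤ] (ι → ℤ) where
  toFun m ρ := ∑ i, m i * v ρ i
  map_add' a b := by
    funext ρ
    simp [add_mul, Finset.sum_add_distrib]
  map_smul' a b := by
    funext ρ
    simp [Finset.mul_sum, mul_assoc]

/-- A smooth projective fan in `N = ℤⁿ`, that is, a smooth projective split toric variety `X` of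
dimension `n` over `ℚ`. The finite type `ι` is the set `Σ(1)` of rays, `ray ρ` is the primitive
generator of the ray `ρ`, and a cone of the fan is given by the set of its rays. -/
structure SmoothProjectiveFan (n : ℕ) (ι : Type*) [Fintype ι] [DecidableEq ι] where
  ray : ι → Fin n → ℤ
  cones : Set (Finset ι)
  empty_mem : ∅ ∈ cones
  ray_mem : ∀ ρ, {ρ} ∈ cones
  face_mem : ∀ σ ∈ cones, ∀ τ, τ ⊆ σ → τ ∈ cones
  /-- smoothness: the generators of a cone are part of a `ℤ`-basis of `N` -/
  smooth : ∀ σ ∈ cones, ∃ (b : Module.Basis (Fin n) ℤ (Fin n → ℤ)) (e : σ ↪ Fin n),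
    ∀ ρ : σ, ray ρ = b (e ρ)
  /-- two cones meet along a common face -/
  inter_eq : ∀ σ ∈ cones, ∀ τ ∈ cones,
    realCone ray σ ∩ realCone ray τ = realCone ray (σ ∩ τ)
  /-- completeness: the cones cover `N_ℝ` -/
  complete : ∀ x : Fin n → ℝ, ∃ σ ∈ cones, x ∈ realCone ray σ
  /-- projectivity: some `T`-invariant divisor `A` is ample, i.e. its support function is strictly
  convex: for each maximal cone `σ`, the divisor linearly equivalent to `A` which is zero along
  the rays of `σ` is positive along all other rays -/
  projective : ∃ A : ι → ℤ, ∀ σ, Maximal (· ∈ cones) σ →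
    ∃ E : ι → ℤ, E - A ∈ LinearMap.range (charDiv ray) ∧
      (∀ ρ ∈ σ, E ρ = 0) ∧ (∀ ρ, ρ ∉ σ → 0 < E ρ)

namespace SmoothProjectiveFan

variable {n : ℕ} {ι : Type*} [Fintype ι] [DecidableEq ι] (X : SmoothProjectiveFan n ι)

/-- The subgroup of principal `T`-invariant divisors. -/
def principal : Submodule ℤ (ι → ℤ) := LinearMap.range (charDiv X.ray)

/-- `Pic(X) = ℤ^{Σ(1)} / M`. -/
abbrev Pic : Type _ := (ι → ℤ) ⧸ X.principal

/-- `t`, the rank of `Pic(X)`. -/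
def picRank : ℕ := Module.finrank ℤ X.Pic

/-- The real vector space `Pic(X)^∨_ℝ` of linear forms on `Pic(X)`: the form `a` is given by its
values `a ρ = ⟨[D_ρ], a⟩`, which are subject to the vanishing of `a` on principal divisors. -/
def picDual : Submodule ℝ (ι → ℝ) where
  carrier := {a | ∀ D ∈ X.principal, ∑ ρ, (D ρ : ℝ) * a ρ = 0}
  add_mem' := by
    intro a b ha hb D hD
    simp [mul_add, Finset.sum_add_distrib, ha D hD, hb D hD]
  zero_mem' := by
    intro D _
    simp
  smul_mem' := by
    intro c a ha D hD
    have h : ∑ ρ, (D ρ : ℝ) * (c • a) ρ = c * ∑ ρ, (D ρ : ℝ) * a ρ := by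
      rw [Finset.mul_sum]
      refine Finset.sum_congr rfl fun ρ _ => ?_
      simp only [Pi.smul_apply, smul_eq_mul]
      ring
    rw [h, ha D hD, mul_zero]

/-- The pairing `⟨[D], a⟩` of the class of a `T`-invariant divisor with `a ∈ Pic(X)^∨_ℝ`. -/
def pair (D : ι → ℤ) (a : X.picDual) : ℝ := ∑ ρ, (D ρ : ℝ) * (a : ι → ℝ) ρ

/-- The divisor `D_ρ`. -/
def rayDiv (ρ : ι) : ι → ℤ := Pi.single ρ 1

/-- The `T`-invariant anticanonical divisor `∑_ρ D_ρ`, of class `ω_X^{-1}`. -/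
def antiK : ι → ℤ := fun _ => 1

/-- The dual `C_eff(X)^∨` of the cone generated by the classes of effective divisors. -/
def effDual : Set X.picDual := {a | ∀ E : ι → ℤ, (∀ ρ, 0 ≤ E ρ) → 0 ≤ X.pair E a}

/-- The smallest `f` such that some `f` rays are not contained in a common cone of the fan. -/
def primitiveIndex : ℕ :=
  sInf {k | ∃ S : Finset ι, S.card = k ∧ ¬ ∃ σ ∈ X.cones, S ⊆ σ}

/-- The lattice in `Pic(X)^∨_ℝ` dual to `Pic(X)`: the forms with integral values on `Pic(X)`. -/
def dualLattice : Submodule ℤ X.picDual where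
  carrier := {a | ∀ D : ι → ℤ, ∃ k : ℤ, X.pair D a = k}
  add_mem' := by
    intro a b ha hb D
    obtain ⟨k, hk⟩ := ha D
    obtain ⟨l, hl⟩ := hb D
    refine ⟨k + l, ?_⟩
    have h : X.pair D (a + b) = X.pair D a + X.pair D b := by
      simp [pair, mul_add, Finset.sum_add_distrib]
    rw [h, hk, hl]
    push_cast
    ring
  zero_mem' := fun D => ⟨0, by simp [pair]⟩
  smul_mem' := by
    intro c a ha D
    obtain ⟨k, hk⟩ := ha D
    refine ⟨c * k, ?_⟩
    have h : X.pair D (c • a) = c * X.pair D a := by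
      rw [pair, pair, Finset.mul_sum]
      refine Finset.sum_congr rfl fun ρ _ => ?_
      rw [Submodule.coe_smul_of_tower, Pi.smul_apply, zsmul_eq_mul]
      ring
    rw [h, hk]
    push_cast
    ring

/-- The Haar measure on `Pic(X)^∨_ℝ` for which the dual lattice of `Pic(X)` has covolume one. -/
def picHaar : Measure X.picDual :=
  (ENNReal.ofReal (ZLattice.covolume X.dualLattice Measure.addHaar))⁻¹ • Measure.addHaar

/-- `ν(D) = ∫_D e^{⟨ω_X^{-1}, y⟩} dy`. -/
def nu (D : Set X.picDual) : ℝ := ∫ y in D, Real.exp (X.pair antiK y) ∂X.picHaar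

/-- The points `𝒯(A)` of the universal torsor over a commutative ring `A`: the torsor is the
open subscheme of `𝔸^{Σ(1)}` which is the complement of the closed subscheme cut out by the
monomials `∏_{ρ ∉ σ} Y_ρ`, `σ` a cone of the fan. -/
def torsor (A : Type*) [CommRing A] : Set (ι → A) :=
  {y | Ideal.span {z : A | ∃ σ ∈ X.cones, z = ∏ ρ ∈ σᶜ, y ρ} = ⊤}

/-- The class of `D` is base point free: at the points of the orbit of each cone `σ`, some
monomial section `Y^E` of `𝒪(D)` (`E ≥ 0` linearly equivalent to `D`) does not vanish. -/
def IsBasePointFree (D : ι → ℤ) : Prop :=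
  ∀ σ ∈ X.cones, ∃ E : ι → ℕ, (fun ρ => (E ρ : ℤ)) - D ∈ X.principal ∧ ∀ ρ ∈ σ, E ρ = 0

/-- `a` is the multi-height of `y ∈ 𝒯(ℝ)`: for each base point free class `[D]`,
`exp ⟨[D], a⟩` is the maximum of the `|y^E|` over all global monomial sections `Y^E` of `𝒪(D)`.
This determines `a`, as `Pic(X)` is generated by base point free classes. -/
def IsTorsorHeight (y : ι → ℝ) (a : X.picDual) : Prop :=
  ∀ D : ι → ℤ, X.IsBasePointFree D →
    IsGreatest {r : ℝ | ∃ E : ι → ℕ, (fun ρ => (E ρ : ℤ)) - D ∈ X.principal ∧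
      r = ∏ ρ, |y ρ| ^ E ρ} (Real.exp (X.pair D a))

/-- The local multi-height `h_{𝒯,∞} : 𝒯(ℝ) → Pic(X)^∨_ℝ`. -/
def torsorHeight (y : ι → ℝ) : X.picDual := Classical.epsilon (X.IsTorsorHeight y)

/-- `y ∼ y'` when `y' = s · y` for a real point `s` of the Néron–Severi torus
`T_NS(ℝ) = Hom(Pic(X), ℝˣ)`. -/
def nsSetoid : Setoid (X.torsor ℝ) where
  r y y' := ∃ s : ι → ℝˣ, (∀ D ∈ X.principal, ∏ ρ, s ρ ^ D ρ = 1) ∧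
    ∀ ρ, (y' : ι → ℝ) ρ = s ρ * (y : ι → ℝ) ρ
  iseqv :=
    { refl := fun y => ⟨1, by simp, by simp⟩
      symm := by
        rintro y y' ⟨s, hs, h⟩
        refine ⟨s⁻¹, fun D hD => ?_, fun ρ => ?_⟩
        · simp [Finset.prod_inv_distrib, hs D hD]
        · simp [h ρ]
      trans := by
        rintro y y' y'' ⟨s, hs, h⟩ ⟨s', hs', h'⟩
        refine ⟨s' * s, fun D hD => ?_, fun ρ => ?_⟩
        · simp [mul_zpow, Finset.prod_mul_distrib, hs D hD, hs' D hD]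
        · simp [h ρ, h' ρ, mul_assoc] }

/-- The real points `X(ℝ) = 𝒯(ℝ) / T_NS(ℝ)`, with the quotient `σ`-algebra. -/
abbrev RealPoints : Type _ := Quotient X.nsSetoid

/-- The section over the affine chart `U_σ(ℝ) = ℝ^σ` of `𝒯(ℝ) → X(ℝ)`: complete the coordinates
by `1` outside `σ`. -/
def chartLift (σ : Finset ι) (x : σ → ℝ) : ι → ℝ :=
  fun ρ => if h : ρ ∈ σ then x ⟨ρ, h⟩ else 1

lemma chartLift_mem {σ : Finset ι} (hσ : σ ∈ X.cones) (x : σ → ℝ) :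
    chartLift σ x ∈ X.torsor ℝ := by
  refine (Ideal.eq_top_iff_one _).2 (Ideal.subset_span ⟨σ, hσ, ?_⟩)
  refine (Finset.prod_eq_one fun ρ hρ => ?_).symm
  simp [chartLift, Finset.mem_compl.1 hρ]

/-- The chart `ℝ^σ = U_σ(ℝ) → X(ℝ)`. -/
def chart {σ : Finset ι} (hσ : σ ∈ X.cones) (x : σ → ℝ) : X.RealPoints :=
  Quotient.mk X.nsSetoid ⟨chartLift σ x, X.chartLift_mem hσ x⟩

/-- The local Tamagawa measure on the chart `U_σ`: the pushforward of
`‖∂/∂x_1 ∧ ⋯ ∧ ∂/∂x_n‖_∞ dx_1 ⋯ dx_n`. The section `∂/∂x_1 ∧ ⋯ ∧ ∂/∂x_n` of `ω_X^{-1}` is given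
by a monomial in the coordinates outside `σ`, equal to `1` on the lift of `x`, so that its norm
at `x` is `exp (- ⟨ω_X^{-1}, h(lift of x)⟩)`. -/
def chartMeasure {σ : Finset ι} (hσ : σ ∈ X.cones) : Measure X.RealPoints :=
  Measure.map (X.chart hσ) ((volume : Measure (σ → ℝ)).withDensity fun x =>
    ENNReal.ofReal (Real.exp (- X.pair antiK (X.torsorHeight (chartLift σ x)))))

/-- The measure `μ_{X,∞}` on `X(ℝ)` obtained by glueing the local measures on the charts of the
maximal cones (a measure is the supremum of its restrictions to the members of a finite cover). -/
def muInfty : Measure X.RealPoints :=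
  ⨆ (σ : Finset ι) (h : Maximal (· ∈ X.cones) σ), X.chartMeasure h.prop

/-- The compact open subset `ℤ_p^{Σ(1)}` of `ℚ_p^{Σ(1)}`. -/
def padicUnitBox (ι : Type*) [Fintype ι] (p : ℕ) [Fact p.Prime] :
    TopologicalSpace.PositiveCompacts (ι → ℚ_[p]) where
  carrier := Metric.closedBall 0 1
  isCompact' := isCompact_closedBall 0 1
  interior_nonempty' :=
    ⟨0, Metric.ball_subset_interior_closedBall (Metric.mem_ball_self one_pos)⟩

/-- `ω_{𝒯,p}(𝒯(ℤ_p))`, where `ω_{𝒯,p}` is the measure on `𝒯(ℚ_p) ⊆ ℚ_p^{Σ(1)}` given by the Haar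
measure of `ℚ_p^{Σ(1)}` for which `ℤ_p^{Σ(1)}` has measure one. -/
def padicDensity (p : ℕ) [Fact p.Prime] : ℝ :=
  letI : MeasurableSpace (ι → ℚ_[p]) := borel _
  haveI : BorelSpace (ι → ℚ_[p]) := ⟨rfl⟩
  (Measure.addHaarMeasure (padicUnitBox ι p)).real
    ((fun (y : ι → ℤ_[p]) ρ => (y ρ : ℚ_[p])) '' X.torsor ℤ_[p])

/-- `D_B = D₁ + log(B) u`. -/
def translate (D₁ : Set X.picDual) (u : X.picDual) (B : ℝ) : Set X.picDual :=
  (fun a => a + Real.log B • u) '' D₁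

/-- The set `𝒯(ℤ)_{h ∈ D}` of the `y ∈ 𝒯(ℤ)` whose height `h_{𝒯,∞}(y)` lies in `D`. -/
def integralPoints (D : Set X.picDual) : Set (ι → ℤ) :=
  {y | y ∈ X.torsor ℤ ∧ X.torsorHeight (fun ρ => (y ρ : ℝ)) ∈ D}

end SmoothProjectiveFan

/-- A polyhedron of a real vector space: a finite intersection of closed half-spaces. -/
def IsPolyhedron {V : Type*} [AddCommGroup V] [Module ℝ V] (P : Set V) : Prop :=
  ∃ (k : ℕ) (l : Fin k → V →ₗ[ℝ] ℝ) (c : Fin k → ℝ), P = {a | ∀ i, l i a ≤ c i}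

end

/-! The multi-height is made explicit by `Adapted`: `y` has height `h` when `|y ρ| ≤ exp (h ρ)` for
every ray and the rays with strict inequality form a cone. Completeness of the fan gives such an
`h`; projectivity makes it unique, because base point free classes generate `Pic(X)`. Multiplying
`y` by `s` translates `h` by `log |s|`. Hence the real points with height in `D₁ + log(B) u` form
the compact region of height `D₁` with the coordinate `ρ` stretched by `B ^ u_ρ`, where `u_ρ > 0`,
and the problem is to count integral points of the torsor in an anisotropic dilation.

Volume. Over the chart of a maximal cone the torsor is a product of `ℝ^σ` and of the Néron–Severi
torus. Fubini and the substitution `α = log |s|` on the torus give volume `2^t ν(D₁) μ_∞(X(ℝ))`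
(`volume_region_inter`, `volume_region`); the factor `2^t` counts the signs.

Lattice points. In logarithmic coordinates the region is a finite union of convex sets, so lines
parallel to the axes meet it, off the coordinate hyperplanes, in boundedly many intervals. Replacing
counting measure by Lebesgue measure one coordinate at a time gives an error bounded by products of
all but one of the side lengths (`abs_ncard_sub_volume_le`). This is weakened to `∏ l_j · ∑ l_j ^
(-θ)` with `θ = 1 - 1/f - ε`, uniformly in the scales `l` (`exists_abs_ncard_scaled_sub_le`).

Coprimality. Membership in `𝒯(ℤ)` means that for each prime the rays whose coordinate it divides
form a cone. It is detected by a Möbius function on sets of rays which vanishes on nonempty cones,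
hence on all nonempty sets with fewer than `f` rays. The main terms build the Euler product of the
local densities `∑ μ(e) p ^ (-|e|)`. The errors are bounded by the Euler product of `∑ |μ(e)| p ^
(-(1-θ)|e|)`, which converges because `(1-θ) f > 1` (`abs_ncard_torsor_sub_le`). Points with a zero
coordinate are left out of this argument and bounded trivially. -/

noncomputable section

/-! ### Points of the torsor, and uniqueness of the multi-height -/

namespace SmoothProjectiveFan

variable {n : ℕ} {ι : Type*} [Fintype ι] [DecidableEq ι] (X : SmoothProjectiveFan n ι)

open Classical in
/-- The coordinates of a point of the torsor which vanish at a maximal ideal are rays of a cone. -/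
theorem mem_torsor_iff {A : Type*} [CommRing A] (y : ι → A) :
    y ∈ X.torsor A ↔ ∀ m : Ideal A, m.IsMaximal →
      (Finset.univ.filter fun ρ => y ρ ∈ m) ∈ X.cones := by
  constructor
  · intro h m hm
    have h1 : ¬ ({z : A | ∃ σ ∈ X.cones, z = ∏ ρ ∈ σᶜ, y ρ} ⊆ m) := fun hs =>
      hm.ne_top (top_le_iff.1 ((Eq.symm h).le.trans (Ideal.span_le.2 hs)))
    obtain ⟨z, ⟨σ, hσ, rfl⟩, hz⟩ := Set.not_subset.1 h1
    refine X.face_mem σ hσ _ fun ρ hρ => ?_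
    by_contra hρσ
    exact hz (Ideal.mem_of_dvd _ (Finset.dvd_prod_of_mem y (Finset.mem_compl.2 hρσ))
      (Finset.mem_filter.1 hρ).2)
  · intro h
    by_contra hne
    obtain ⟨m, hm, hle⟩ := Ideal.exists_le_maximal _ hne
    have h1 := hle (Ideal.subset_span ⟨_, h m hm, rfl⟩)
    obtain ⟨ρ, hρ, hρm⟩ := (hm.isPrime.prod_mem_iff).1 h1
    simp [hρm] at hρ

theorem mem_torsor_field_iff {K : Type*} [Field K] [DecidableEq K] (y : ι → K) :
    y ∈ X.torsor K ↔ (Finset.univ.filter fun ρ => y ρ = 0) ∈ X.cones := by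
  rw [mem_torsor_iff]
  constructor
  · intro h
    convert h ⊥ Ideal.bot_isMaximal using 2
    simp
  · intro h m hm
    have hm' : m = ⊥ := (Ideal.eq_bot_or_top m).resolve_right hm.ne_top
    subst hm'
    convert h using 2
    simp

theorem mem_torsor_int_iff (y : ι → ℤ) :
    y ∈ X.torsor ℤ ↔ ∀ p : ℕ, p.Prime →
      (Finset.univ.filter fun ρ => (p : ℤ) ∣ y ρ) ∈ X.cones := by
  rw [mem_torsor_iff]
  constructor
  · intro h p hp
    have hm : (Ideal.span {(p : ℤ)}).IsMaximal :=
      PrincipalIdealRing.isMaximal_of_irreducible (Nat.prime_iff_prime_int.1 hp).irreducible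
    convert h _ hm using 2
    simp [Ideal.mem_span_singleton]
  · intro h m hm
    obtain ⟨a, rfl⟩ : ∃ a, m = Ideal.span {a} := (IsPrincipalIdealRing.principal m).principal
    by_cases ha : a = 0
    · exfalso
      subst ha
      have h2 : Ideal.span {(0 : ℤ)} ≤ Ideal.span {(2 : ℤ)} := by simp
      have h3 := hm.eq_of_le (by
        rw [Ne, Ideal.span_singleton_eq_top]; decide) h2
      have : (2 : ℤ) ∈ Ideal.span {(0 : ℤ)} := h3 ▸ Ideal.mem_span_singleton_self 2
      simp at this
    · have hp : Prime a := (Ideal.span_singleton_prime ha).1 hm.isPrime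
      convert h a.natAbs (Int.prime_iff_natAbs_prime.1 hp) using 2
      simp [Ideal.mem_span_singleton]

/-- `y` has multi-height `h`: it is the product of `exp h` and of a point of the unit polydisc whose
coordinates of absolute value less than one are rays of a cone. -/
def Adapted (y : ι → ℝ) (h : ι → ℝ) : Prop :=
  (∀ ρ, |y ρ| ≤ Real.exp (h ρ)) ∧
    (Finset.univ.filter fun ρ => |y ρ| < Real.exp (h ρ)) ∈ X.cones

/-- Faces of cones are cones, so the set of strict inequalities may be replaced by any cone
containing it. For fixed `σ` the conditions are closed in `(y, h)` and become convex in `(log |y|,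
h)`; compactness and the convex pieces of the region rest on this form. -/
theorem adapted_iff_exists (y h : ι → ℝ) :
    X.Adapted y h ↔ ∃ σ ∈ X.cones, (∀ ρ, |y ρ| ≤ Real.exp (h ρ)) ∧
      ∀ ρ, ρ ∉ σ → |y ρ| = Real.exp (h ρ) := by
  constructor
  · rintro ⟨h1, h2⟩
    refine ⟨_, h2, h1, fun ρ hρ => (h1 ρ).antisymm ?_⟩
    simpa using hρ
  · rintro ⟨σ, hσ, h1, h2⟩
    refine ⟨h1, X.face_mem σ hσ _ fun ρ hρ => ?_⟩
    by_contra hρσ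
    have := (Finset.mem_filter.1 hρ).2
    exact this.ne (h2 ρ hρσ)

variable {X}

theorem Adapted.mem_torsor {y h : ι → ℝ} (H : X.Adapted y h) : y ∈ X.torsor ℝ := by
  rw [mem_torsor_field_iff]
  refine X.face_mem _ H.2 _ fun ρ hρ => ?_
  simp only [Finset.mem_filter, Finset.mem_univ, true_and] at hρ ⊢
  rw [hρ, abs_zero]
  exact Real.exp_pos _

theorem pair_sub (D E : ι → ℤ) (a : X.picDual) : X.pair (D - E) a = X.pair D a - X.pair E a := by
  simp [pair, sub_mul, Finset.sum_sub_distrib]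

theorem pair_principal {D : ι → ℤ} (hD : D ∈ X.principal) (a : X.picDual) : X.pair D a = 0 :=
  a.2 D hD

theorem pair_congr {D E : ι → ℤ} (h : D - E ∈ X.principal) (a : X.picDual) :
    X.pair D a = X.pair E a := by
  have := pair_principal h a
  rw [pair_sub] at this
  linarith

@[simp] theorem pair_rayDiv (ρ : ι) (a : X.picDual) :
    X.pair (rayDiv ρ) a = (a : ι → ℝ) ρ := by
  simp [pair, rayDiv, Pi.single_apply]

theorem pair_antiK (a : X.picDual) : X.pair antiK a = ∑ ρ, (a : ι → ℝ) ρ := by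
  simp [pair, antiK]

theorem prod_exp_pow (E : ι → ℕ) (a : X.picDual) :
    ∏ ρ, Real.exp ((a : ι → ℝ) ρ) ^ E ρ = Real.exp (X.pair (fun ρ => (E ρ : ℤ)) a) := by
  rw [pair, Real.exp_sum]
  refine Finset.prod_congr rfl fun ρ _ => ?_
  rw [← Real.exp_nat_mul]
  simp

/-- Every monomial section is at most its value at `exp h`. Base point freeness at the cone of the
strict inequalities supplies a section not involving those coordinates, for which equality holds. -/
theorem Adapted.isTorsorHeight {y : ι → ℝ} {h : X.picDual} (H : X.Adapted y h) :
    X.IsTorsorHeight y h := by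
  intro D hD
  constructor
  · obtain ⟨E, hE, h0⟩ := hD _ H.2
    refine ⟨E, hE, ?_⟩
    rw [← pair_congr hE, ← prod_exp_pow]
    refine Finset.prod_congr rfl fun ρ _ => ?_
    by_cases hρ : |y ρ| < Real.exp ((h : ι → ℝ) ρ)
    · rw [h0 ρ (by simpa using hρ), pow_zero, pow_zero]
    · rw [(H.1 ρ).antisymm (not_lt.1 hρ)]
  · rintro r ⟨E, hE, rfl⟩
    rw [← pair_congr hE, ← prod_exp_pow]
    exact Finset.prod_le_prod (fun ρ _ => by positivity)
      fun ρ _ => pow_le_pow_left₀ (abs_nonneg _) (H.1 ρ) _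

theorem exists_dotProduct_eq {n : ℕ} (c : (Fin n → ℤ) →ₗ[ℤ] ℤ) :
    ∃ m : Fin n → ℤ, ∀ x : Fin n → ℤ, ∑ i, m i * x i = c x := by
  refine ⟨fun i => c (Pi.single i 1), fun x => ?_⟩
  conv_rhs => rw [← Finset.univ_sum_single x]
  rw [map_sum]
  refine Finset.sum_congr rfl fun i _ => ?_
  have : (Pi.single i (x i) : Fin n → ℤ) = x i • Pi.single i 1 := by
    rw [← Pi.single_smul, smul_eq_mul, mul_one]
  rw [this, map_smul, smul_eq_mul, mul_comm]

variable (X)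

/-- On each cone, every divisor is linearly equivalent to one which vanishes on the cone. -/
theorem exists_vanishing_on_cone {σ : Finset ι} (hσ : σ ∈ X.cones) (D : ι → ℤ) :
    ∃ E : ι → ℤ, E - D ∈ X.principal ∧ ∀ ρ ∈ σ, E ρ = 0 := by
  obtain ⟨b, e, he⟩ := X.smooth σ hσ
  let c : (Fin n → ℤ) →ₗ[ℤ] ℤ := ∑ ρ : σ, D ρ • b.coord (e ρ)
  obtain ⟨m, hm⟩ := exists_dotProduct_eq c
  refine ⟨D - charDiv X.ray m, ?_, fun ρ hρ => ?_⟩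
  · rw [sub_sub_cancel_left]
    exact neg_mem ⟨m, rfl⟩
  · have h1 : charDiv X.ray m ρ = c (X.ray ρ) := hm _
    have h2 : c (X.ray ρ) = D ρ := by
      have h3 := he ⟨ρ, hρ⟩
      simp only at h3
      rw [h3]
      simp [c, Finsupp.single_apply, e.injective.eq_iff]
    rw [Pi.sub_apply, h1, h2, sub_self]

theorem exists_maximal_cone {σ : Finset ι} (hσ : σ ∈ X.cones) :
    ∃ τ, Maximal (· ∈ X.cones) τ ∧ σ ⊆ τ := by
  obtain ⟨τ, h1, h2⟩ := (Set.toFinite X.cones).exists_le_maximal hσ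
  exact ⟨τ, h2, h1⟩

/-- The sum of any divisor and of a sufficiently large multiple of an ample one is base point
free. -/
theorem exists_ample : ∃ A : ι → ℤ, ∀ D : ι → ℤ, ∃ k₀ : ℕ, ∀ k : ℕ, k₀ ≤ k →
    X.IsBasePointFree (D + k • A) := by
  obtain ⟨A, hA⟩ := X.projective
  refine ⟨A, fun D => ?_⟩
  have key : ∀ σ : Finset ι, ∃ k₀ : ℕ, Maximal (· ∈ X.cones) σ → ∀ k : ℕ, k₀ ≤ k →
      ∃ E : ι → ℕ, (fun ρ => (E ρ : ℤ)) - (D + k • A) ∈ X.principal ∧ ∀ ρ ∈ σ, E ρ = 0 := by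
    intro σ
    by_cases hσ : Maximal (· ∈ X.cones) σ
    · obtain ⟨E, hE, hE0, hE1⟩ := hA σ hσ
      obtain ⟨F, hF, hF0⟩ := X.exists_vanishing_on_cone hσ.prop D
      -- Off `σ` the coefficients of `E` are at least one, so `k ≥ |F ρ|` for all `ρ` suffices to
      -- make `F + k E` effective; on `σ` it vanishes.
      refine ⟨∑ ρ, (F ρ).natAbs, fun _ k hk => ?_⟩
      have hpos : ∀ ρ, 0 ≤ (F + k • E) ρ := by
        intro ρ
        rw [Pi.add_apply, Pi.smul_apply, nsmul_eq_mul]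
        by_cases hρ : ρ ∈ σ
        · simp [hE0 ρ hρ, hF0 ρ hρ]
        · have h1 := hE1 ρ hρ
          have h2 : (F ρ).natAbs ≤ k :=
            (Finset.single_le_sum (f := fun ρ => (F ρ).natAbs) (fun _ _ => Nat.zero_le _)
              (Finset.mem_univ ρ)).trans hk
          have h3 : (k : ℤ) * 1 ≤ k * E ρ := by gcongr; omega
          omega
      refine ⟨fun ρ => ((F + k • E) ρ).toNat, ?_, fun ρ hρ => by simp [hE0 ρ hρ, hF0 ρ hρ]⟩
      have : (fun ρ => ((((F + k • E) ρ).toNat : ℕ) : ℤ)) = F + k • E :=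
        funext fun ρ => Int.toNat_of_nonneg (hpos ρ)
      rw [this, add_sub_add_comm, ← smul_sub]
      exact add_mem hF (nsmul_mem hE k)
    · exact ⟨0, fun h => (hσ h).elim⟩
  choose k₀ hk₀ using key
  refine ⟨∑ σ, k₀ σ, fun k hk τ hτ => ?_⟩
  obtain ⟨σ, hσ, hτσ⟩ := X.exists_maximal_cone hτ
  obtain ⟨E, hE, hE0⟩ := hk₀ σ hσ k ((Finset.single_le_sum (f := k₀) (fun _ _ => Nat.zero_le _)
    (Finset.mem_univ σ)).trans hk)
  exact ⟨E, hE, fun ρ hρ => hE0 ρ (hτσ hρ)⟩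

/-- Base point free classes generate `Pic(X)`: take `D + k A` and `k A` with `A` ample and `k`
large. This lets bounds and equalities on base point free classes pass to each `D_ρ`. -/
theorem exists_eq_sub_basePointFree (D : ι → ℤ) :
    ∃ D₁ D₂ : ι → ℤ, X.IsBasePointFree D₁ ∧ X.IsBasePointFree D₂ ∧ D = D₁ - D₂ := by
  obtain ⟨A, hA⟩ := X.exists_ample
  obtain ⟨k, hk⟩ := hA D
  obtain ⟨l, hl⟩ := hA 0
  exact ⟨_, _, hk (max k l) (le_max_left _ _), hl (max k l) (le_max_right _ _), by simp⟩

variable {X}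

theorem IsTorsorHeight.unique {y : ι → ℝ} {a b : X.picDual} (ha : X.IsTorsorHeight y a)
    (hb : X.IsTorsorHeight y b) : a = b := by
  ext ρ
  obtain ⟨D₁, D₂, h₁, h₂, h⟩ := X.exists_eq_sub_basePointFree (rayDiv ρ)
  rw [← pair_rayDiv, ← pair_rayDiv, h, pair_sub, pair_sub,
    Real.exp_injective ((ha D₁ h₁).unique (hb D₁ h₁)),
    Real.exp_injective ((ha D₂ h₂).unique (hb D₂ h₂))]

/-! ### Existence of the multi-height -/

variable (X)

theorem charDiv_sum (m : Fin n → ℤ) (c : ι → ℝ) :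
    ∑ ρ, (charDiv X.ray m ρ : ℝ) * c ρ = ∑ i, (m i : ℝ) * ∑ ρ, c ρ * (X.ray ρ i : ℝ) := by
  simp only [charDiv, LinearMap.coe_mk, AddHom.coe_mk, Int.cast_sum, Int.cast_mul, Finset.sum_mul,
    Finset.mul_sum]
  rw [Finset.sum_comm]
  exact Finset.sum_congr rfl fun i _ => Finset.sum_congr rfl fun ρ _ => by ring

/-- Testing on the characters of a basis of `M` identifies `Pic(X)^∨_ℝ` with the linear relations
between the ray generators. -/
theorem mem_picDual_iff (a : ι → ℝ) :
    a ∈ X.picDual ↔ ∀ i, ∑ ρ, a ρ * (X.ray ρ i : ℝ) = 0 := by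
  constructor
  · intro h i
    have := h _ ⟨Pi.single i 1, rfl⟩
    rw [charDiv_sum] at this
    simpa [Pi.single_apply] using this
  · rintro h D ⟨m, rfl⟩
    rw [charDiv_sum]
    simp [h]

/-- Every vector becomes an element of `Pic(X)^∨_ℝ` when a nonnegative vector supported on a cone
is added. -/
theorem exists_add_mem_picDual (l : ι → ℝ) : ∃ c : ι → ℝ, ∃ σ ∈ X.cones, (∀ ρ, 0 ≤ c ρ) ∧
    (∀ ρ, ρ ∉ σ → c ρ = 0) ∧ l + c ∈ X.picDual := by
  obtain ⟨σ, hσ, c, hc, hc0, h⟩ := X.complete fun i => -∑ ρ, l ρ * (X.ray ρ i : ℝ)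
  refine ⟨c, σ, hσ, hc, hc0, (X.mem_picDual_iff _).2 fun i => ?_⟩
  have := congrFun h i
  simp only [Finset.sum_apply, Pi.smul_apply, smul_eq_mul] at this
  simp only [Pi.add_apply, add_mul, Finset.sum_add_distrib, ← this]
  ring

/-- By completeness `-∑ log |y_ρ| v_ρ` lies in a cone `σ`. Adding its nonnegative coordinates there
to `log |y|` gives a relation between the rays, and this is the height. -/
theorem exists_adapted_of_ne_zero (y : ι → ℝ) (hy : ∀ ρ, y ρ ≠ 0) :
    ∃ h : X.picDual, X.Adapted y h := by
  obtain ⟨c, σ, hσ, hc, hc0, hm⟩ := X.exists_add_mem_picDual fun ρ => Real.log |y ρ|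
  refine ⟨⟨_, hm⟩, (X.adapted_iff_exists _ _).2 ⟨σ, hσ, fun ρ => ?_, fun ρ hρ => ?_⟩⟩ <;>
    simp only [Pi.add_apply, Real.exp_add, Real.exp_log (abs_pos.2 (hy ρ))]
  · exact le_mul_of_one_le_right (abs_nonneg _) (Real.one_le_exp (hc ρ))
  · simp [hc0 ρ hρ]

/-- Zero coordinates are replaced by a small `δ`. On a base point free class the height of the
perturbed point is bounded above by that for `δ = 1` and below by a monomial which avoids the
vanishing coordinates. These bounds do not depend on `δ`, so for small `δ` the perturbed coordinates
lie strictly below `exp h`, and replacing them by zero leaves `h` adapted. -/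
theorem exists_adapted (y : ι → ℝ) (hy : y ∈ X.torsor ℝ) : ∃ h : X.picDual, X.Adapted y h := by
  rw [mem_torsor_field_iff] at hy
  let z : ℝ → ι → ℝ := fun δ ρ => if y ρ = 0 then δ else y ρ
  -- the heights of the perturbed points are bounded on base point free classes
  have hb : ∀ D, X.IsBasePointFree D → ∃ M : ℝ, ∀ δ : ℝ, 0 < δ → δ ≤ 1 → ∀ h : X.picDual,
      X.Adapted (z δ) h → |X.pair D h| ≤ M := by
    intro D hD
    obtain ⟨E, hE, hE0⟩ := hD _ hy
    obtain ⟨h₁, H₁⟩ := X.exists_adapted_of_ne_zero (z 1) (fun ρ => by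
      simp only [z]; split_ifs with h <;> simp [h])
    refine ⟨max (X.pair D h₁) (-Real.log (∏ ρ, |z 1 ρ| ^ E ρ)), fun δ hδ hδ' h H => ?_⟩
    have hlow : ∏ ρ, |z δ ρ| ^ E ρ = ∏ ρ, |z 1 ρ| ^ E ρ := by
      refine Finset.prod_congr rfl fun ρ _ => ?_
      by_cases hρ : y ρ = 0
      · rw [hE0 ρ (by simpa using hρ), pow_zero, pow_zero]
      · simp [z, hρ]
    have hp : 0 < ∏ ρ, |z 1 ρ| ^ E ρ := Finset.prod_pos fun ρ _ => by
      have : z 1 ρ ≠ 0 := by simp only [z]; split_ifs with h <;> simp [h]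
      positivity
    have h1 := (H.isTorsorHeight D hD).2 ⟨E, hE, rfl⟩
    rw [hlow, ← Real.log_le_iff_le_exp hp] at h1
    obtain ⟨F, hF, hFe⟩ := (H.isTorsorHeight D hD).1
    have h2 : Real.exp (X.pair D h) ≤ Real.exp (X.pair D h₁) := by
      rw [hFe]
      refine le_trans ?_ ((H₁.isTorsorHeight D hD).2 ⟨F, hF, rfl⟩)
      refine Finset.prod_le_prod (fun ρ _ => by positivity)
        fun ρ _ => pow_le_pow_left₀ (abs_nonneg _) ?_ _
      simp only [z]
      split_ifs
      · rw [abs_of_pos hδ, abs_one]; exact hδ'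
      · exact le_rfl
    rw [Real.exp_le_exp] at h2
    exact abs_le'.2 ⟨h2.trans (le_max_left _ _), (neg_le_neg h1).trans (le_max_right _ _)⟩
  have hb' : ∀ ρ, ∃ M : ℝ, ∀ δ : ℝ, 0 < δ → δ ≤ 1 → ∀ h : X.picDual,
      X.Adapted (z δ) h → |(h : ι → ℝ) ρ| ≤ M := by
    intro ρ
    obtain ⟨D₁, D₂, h₁, h₂, h⟩ := X.exists_eq_sub_basePointFree (rayDiv ρ)
    obtain ⟨M₁, hM₁⟩ := hb D₁ h₁
    obtain ⟨M₂, hM₂⟩ := hb D₂ h₂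
    refine ⟨M₁ + M₂, fun δ hδ hδ' a H => ?_⟩
    rw [← pair_rayDiv, h, pair_sub]
    exact (abs_sub _ _).trans (add_le_add (hM₁ δ hδ hδ' a H) (hM₂ δ hδ hδ' a H))
  choose M hM using hb'
  let M' := ∑ ρ, |M ρ|
  have hM' : ∀ ρ, M ρ ≤ M' := fun ρ => (le_abs_self _).trans
    (Finset.single_le_sum (f := fun ρ => |M ρ|) (fun _ _ => abs_nonneg _) (Finset.mem_univ ρ))
  have hM0 : 0 ≤ M' := Finset.sum_nonneg fun _ _ => abs_nonneg _
  -- All coordinates of the height are at least `-M'`, so this `δ` is smaller than every `exp (h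
  -- ρ)`.
  let δ := Real.exp (-(M' + 1))
  have hδ : 0 < δ := Real.exp_pos _
  have hδ1 : δ ≤ 1 := Real.exp_le_one_iff.2 (by linarith)
  obtain ⟨h, H⟩ := X.exists_adapted_of_ne_zero (z δ) (fun ρ => by
    simp only [z]; split_ifs with h <;> simp [h, hδ.ne'])
  have hlt : ∀ ρ, δ < Real.exp ((h : ι → ℝ) ρ) := fun ρ => Real.exp_lt_exp.2 (by
    have := (abs_le.1 (hM ρ δ hδ hδ1 h H)).1
    linarith [hM' ρ])
  refine ⟨h, (X.adapted_iff_exists _ _).2 ⟨_, H.2, fun ρ => ?_, fun ρ hρ => ?_⟩⟩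
  · by_cases hρ : y ρ = 0
    · rw [hρ, abs_zero]; exact (Real.exp_pos _).le
    · simpa [z, hρ] using H.1 ρ
  · by_cases hρ0 : y ρ = 0
    · simp [z, hρ0, abs_of_pos hδ, hlt ρ] at hρ
    · simp only [Finset.mem_filter, Finset.mem_univ, true_and, not_lt, z, if_neg hρ0] at hρ
      refine le_antisymm ?_ hρ
      simpa [z, hρ0] using H.1 ρ

variable {X}

theorem Adapted.torsorHeight_eq {y : ι → ℝ} {h : X.picDual} (H : X.Adapted y h) :
    X.torsorHeight y = h :=
  (Classical.epsilon_spec (p := X.IsTorsorHeight y) ⟨h, H.isTorsorHeight⟩).unique H.isTorsorHeight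

theorem adapted_torsorHeight {y : ι → ℝ} (hy : y ∈ X.torsor ℝ) :
    X.Adapted y (X.torsorHeight y) := by
  obtain ⟨h, H⟩ := X.exists_adapted y hy
  rwa [H.torsorHeight_eq]

theorem Adapted.unique {y : ι → ℝ} {a b : X.picDual} (ha : X.Adapted y a) (hb : X.Adapted y b) :
    a = b := ha.isTorsorHeight.unique hb.isTorsorHeight

/-! ### Regions of prescribed multi-height -/

variable (X)

/-- The points of `𝒯(ℝ)` with multi-height in `D`. -/
def region (D : Set X.picDual) : Set (ι → ℝ) := {y | ∃ h ∈ D, X.Adapted y (h : X.picDual)}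

variable {X}

theorem mem_region_iff {D : Set X.picDual} {y : ι → ℝ} :
    y ∈ X.region D ↔ y ∈ X.torsor ℝ ∧ X.torsorHeight y ∈ D :=
  ⟨fun ⟨_, hD, H⟩ => ⟨H.mem_torsor, H.torsorHeight_eq.symm ▸ hD⟩,
    fun ⟨h1, h2⟩ => ⟨_, h2, adapted_torsorHeight h1⟩⟩

/-- Equivariance of the height: both the inequalities and the equalities are scaled by `exp (a ρ)`.
It serves for the fibres of the torsor and for the dilation by `B`. -/
theorem Adapted.mul {y h : ι → ℝ} (H : X.Adapted y h) {s a : ι → ℝ}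
    (hs : ∀ ρ, |s ρ| = Real.exp (a ρ)) : X.Adapted (fun ρ => s ρ * y ρ) (a + h) := by
  obtain ⟨σ, hσ, h1, h2⟩ := (X.adapted_iff_exists _ _).1 H
  refine (X.adapted_iff_exists _ _).2 ⟨σ, hσ, fun ρ => ?_, fun ρ hρ => ?_⟩ <;>
    rw [abs_mul, hs, Pi.add_apply, Real.exp_add]
  · exact mul_le_mul_of_nonneg_left (h1 ρ) (Real.exp_pos _).le
  · rw [h2 ρ hρ]

variable (X)

theorem continuous_picDual_apply (ρ : ι) : Continuous fun h : X.picDual => (h : ι → ℝ) ρ :=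
  (continuous_apply ρ).comp continuous_subtype_val

/-- For each cone the pairs `(h, y)` with `h ∈ D` form a closed and bounded set. The region is the
finite union of the projections of these sets. -/
theorem isCompact_region {D : Set X.picDual} (hD : IsCompact D) : IsCompact (X.region D) := by
  have h1 : X.region D = ⋃ σ ∈ X.cones, (Prod.snd '' {q : X.picDual × (ι → ℝ) | q.1 ∈ D ∧
      ∀ ρ, |q.2 ρ| ≤ Real.exp ((q.1 : ι → ℝ) ρ) ∧
        (ρ ∉ σ → |q.2 ρ| = Real.exp ((q.1 : ι → ℝ) ρ))}) := by
    ext y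
    simp only [region, adapted_iff_exists, Set.mem_ofPred_eq, Set.mem_iUnion, Set.mem_image,
      Prod.exists, exists_eq_right, exists_prop, forall_and]
    tauto
  rw [h1]
  refine (Set.toFinite X.cones).isCompact_biUnion fun σ _ => IsCompact.image ?_ continuous_snd
  obtain ⟨R, hR⟩ : ∃ R : ℝ, ∀ h ∈ D, ∀ ρ, Real.exp ((h : ι → ℝ) ρ) ≤ R := by
    have : ∀ ρ, ∃ R : ℝ, ∀ h ∈ D, Real.exp ((h : ι → ℝ) ρ) ≤ R := by
      intro ρ
      have hc : Continuous fun h : X.picDual => Real.exp ((h : ι → ℝ) ρ) :=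
        Real.continuous_exp.comp (X.continuous_picDual_apply ρ)
      obtain ⟨R, hR⟩ := (hD.image hc).bddAbove
      exact ⟨R, fun h hh => hR ⟨h, hh, rfl⟩⟩
    choose R hR using this
    refine ⟨∑ ρ, |R ρ|, fun h hh ρ => ((hR ρ h hh).trans (le_abs_self _)).trans
      (Finset.single_le_sum (f := fun ρ => |R ρ|) (fun _ _ => abs_nonneg _) (Finset.mem_univ ρ))⟩
  refine (hD.prod (isCompact_univ_pi fun _ : ι => isCompact_Icc (a := -R) (b := R))).of_isClosed_subset
    ?_ ?_
  · have : {q : X.picDual × (ι → ℝ) | q.1 ∈ D ∧ ∀ ρ, |q.2 ρ| ≤ Real.exp ((q.1 : ι → ℝ) ρ) ∧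
        (ρ ∉ σ → |q.2 ρ| = Real.exp ((q.1 : ι → ℝ) ρ))} = (Prod.fst ⁻¹' D) ∩
        ⋂ ρ, ({q : X.picDual × (ι → ℝ) | |q.2 ρ| ≤ Real.exp ((q.1 : ι → ℝ) ρ)} ∩
          ⋂ _ : ρ ∉ σ, {q : X.picDual × (ι → ℝ) | |q.2 ρ| = Real.exp ((q.1 : ι → ℝ) ρ)}) := by
      ext q; simp
    rw [this]
    have hc := fun ρ => Real.continuous_exp.comp ((X.continuous_picDual_apply ρ).comp
      (continuous_fst (X := X.picDual) (Y := ι → ℝ)))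
    refine (hD.isClosed.preimage continuous_fst).inter (isClosed_iInter fun ρ => IsClosed.inter ?_
      (isClosed_iInter fun _ => ?_))
    · exact isClosed_le (by fun_prop) (hc ρ)
    · exact isClosed_eq (by fun_prop) (hc ρ)
  · rintro ⟨h, y⟩ ⟨hh, H⟩
    exact ⟨hh, fun ρ _ => abs_le.1 ((H ρ).1.trans (hR h hh ρ))⟩

/-- There is `w` in `Pic(X)^∨_ℝ` with `w_ρ ≥ 1`, and `u - t w` remains in the dual of the effective
cone for some `t > 0`. -/
theorem pos_of_mem_interior_effDual {u : X.picDual} (hu : u ∈ interior X.effDual) (ρ : ι) :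
    0 < (u : ι → ℝ) ρ := by
  obtain ⟨c, σ, -, hc, -, hm⟩ := X.exists_add_mem_picDual (Pi.single ρ 1)
  let w : X.picDual := ⟨_, hm⟩
  have hc' : Continuous fun t : ℝ => u - t • w := by fun_prop
  have h0 : (fun t : ℝ => u - t • w) ⁻¹' interior X.effDual ∈ nhds (0 : ℝ) :=
    (isOpen_interior.preimage hc').mem_nhds (by simpa using hu)
  obtain ⟨δ, hδ, hball⟩ := Metric.mem_nhds_iff.1 h0
  have h1 : u - (δ / 2) • w ∈ X.effDual := interior_subset (hball (by
    rw [Metric.mem_ball, Real.dist_eq, sub_zero, abs_of_pos (by positivity)]; linarith))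
  have h2 := h1 (rayDiv ρ) (fun ρ' => by
    simp only [rayDiv, Pi.single_apply]; split_ifs <;> simp)
  rw [pair_rayDiv] at h2
  have h3 : ((u - (δ / 2) • w : X.picDual) : ι → ℝ) ρ = (u : ι → ℝ) ρ - δ / 2 * (1 + c ρ) := by
    simp [w]
    ring
  rw [h3] at h2
  have : 0 < δ / 2 * (1 + c ρ) := by have := hc ρ; positivity
  linarith

/-! ### Maximal cones and the relations between divisor classes on their charts -/

variable {X} in
/-- The coordinates of a vector in the cones of the fan are unique. -/
theorem cone_coord_unique {σ τ : Finset ι} (hσ : σ ∈ X.cones) (hτ : τ ∈ X.cones) {c d : ι → ℝ}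
    (hc : ∀ ρ, 0 ≤ c ρ) (hcσ : ∀ ρ, ρ ∉ σ → c ρ = 0) (hd : ∀ ρ, 0 ≤ d ρ)
    (hdτ : ∀ ρ, ρ ∉ τ → d ρ = 0)
    (h : ∀ i, ∑ ρ, c ρ * (X.ray ρ i : ℝ) = ∑ ρ, d ρ * (X.ray ρ i : ℝ)) : c = d := by
  have hm : d - c ∈ X.picDual := (X.mem_picDual_iff _).2 fun i => by
    simp [sub_mul, Finset.sum_sub_distrib, h i]
  -- The point `exp (-c)` has height `0` because of `σ`, and height `d - c` because of `τ`.
  -- Uniqueness of the height then forces `d = c`.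
  have h1 : X.Adapted (fun ρ => Real.exp (-c ρ)) ((0 : X.picDual) : ι → ℝ) :=
    (X.adapted_iff_exists _ _).2 ⟨σ, hσ, fun ρ => by simp [hc ρ], fun ρ hρ => by simp [hcσ ρ hρ]⟩
  have h2 : X.Adapted (fun ρ => Real.exp (-c ρ)) ((⟨_, hm⟩ : X.picDual) : ι → ℝ) :=
    (X.adapted_iff_exists _ _).2 ⟨τ, hτ, fun ρ => by simp [hd ρ], fun ρ hρ => by simp [hdτ ρ hρ]⟩
  have h3 := congrArg Subtype.val (h1.unique h2)
  exact (sub_eq_zero.1 h3.symm).symm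

/-- The rays of a maximal cone form a basis of `N`. -/
theorem exists_basis_of_maximal {σ : Finset ι} (hσ : Maximal (· ∈ X.cones) σ) :
    ∃ (b : Module.Basis (Fin n) ℤ (Fin n → ℤ)) (e : σ ≃ Fin n), ∀ ρ : σ, X.ray ρ = b (e ρ) := by
  obtain ⟨b, e, he⟩ := X.smooth σ hσ.prop
  suffices hs : Function.Surjective e from
    ⟨b, Equiv.ofBijective e ⟨e.injective, hs⟩, he⟩
  -- If the basis vector `b j` is not a ray of `σ`, the interior point `x` of `σ` is moved slightly
  -- in the direction `w = b j`. A single cone `T` contains infinitely many of the moved points,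
  -- hence also the limit `x`. As all coordinates of `x` on `σ` are positive, `σ ⊆ T`, so `T = σ` by
  -- maximality. Then `w` is a combination of the rays of `σ`, which the coordinate form of `b j`
  -- excludes.
  by_contra hs
  obtain ⟨j, hj⟩ := not_forall.1 hs
  let one : ι → ℝ := fun ρ => if ρ ∈ σ then 1 else 0
  let x : Fin n → ℝ := fun i => ∑ ρ, one ρ * (X.ray ρ i : ℝ)
  let w : Fin n → ℝ := fun i => (b j i : ℝ)
  let δ : ℕ → ℝ := fun k => 1 / ((k : ℝ) + 1)
  have hδ : Filter.Tendsto δ Filter.atTop (nhds 0) := tendsto_one_div_add_atTop_nhds_zero_nat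
  choose τ hτ c hc hcτ hx using fun k => X.complete (fun i => x i + δ k * w i)
  obtain ⟨T, hT⟩ : ∃ T, ∃ᶠ k in Filter.atTop, τ k = T := by
    by_contra h
    push Not at h
    obtain ⟨k, hk⟩ := (Filter.eventually_all.2 h).exists
    exact hk _ rfl
  have hTc : T ∈ X.cones := by
    obtain ⟨k, hk⟩ := hT.exists
    exact hk ▸ hτ k
  obtain ⟨b', e', he'⟩ := X.smooth T hTc
  choose m hm using fun ρ : T => exists_dotProduct_eq (b'.coord (e' ρ))
  have hmT : ∀ ρ ρ' : T, ∑ i, (m ρ i : ℝ) * (X.ray ρ' i : ℝ) = if ρ' = ρ then 1 else 0 := by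
    intro ρ ρ'
    have : ∑ i, m ρ i * X.ray ρ' i = if ρ' = ρ then 1 else 0 := by
      rw [hm, he']
      simp [Finsupp.single_apply, e'.injective.eq_iff]
    exact_mod_cast this
  -- the coordinates on the cone `T` are linear forms
  let f : (Fin n → ℝ) → ι → ℝ := fun z ρ => if h : ρ ∈ T then ∑ i, (m ⟨ρ, h⟩ i : ℝ) * z i else 0
  have hf : ∀ d : ι → ℝ, (∀ ρ, ρ ∉ T → d ρ = 0) →
      f (fun i => ∑ ρ, d ρ * (X.ray ρ i : ℝ)) = d := by
    intro d hd
    funext ρ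
    by_cases hρ : ρ ∈ T
    · simp only [f, dif_pos hρ, Finset.mul_sum]
      rw [Finset.sum_comm, Finset.sum_eq_single ρ]
      · have := hmT ⟨ρ, hρ⟩ ⟨ρ, hρ⟩
        rw [if_pos rfl] at this
        conv_rhs => rw [← mul_one (d ρ), ← this, Finset.mul_sum]
        exact Finset.sum_congr rfl fun i _ => by ring
      · intro ρ' _ hne
        by_cases hρ' : ρ' ∈ T
        · have := hmT ⟨ρ, hρ⟩ ⟨ρ', hρ'⟩
          rw [if_neg (by simpa using hne)] at this
          conv_rhs => rw [← mul_zero (d ρ'), ← this, Finset.mul_sum]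
          exact Finset.sum_congr rfl fun i _ => by ring
        · simp [hd ρ' hρ']
      · simp
    · simp [f, hρ, hd ρ hρ]
  have hfc : ∀ z z' : Fin n → ℝ, ∀ t : ℝ, f (fun i => z i + t * z' i) = fun ρ => f z ρ + t * f z' ρ := by
    intro z z' t
    funext ρ
    simp only [f]
    split_ifs with h
    · rw [Finset.mul_sum, ← Finset.sum_add_distrib]
      exact Finset.sum_congr rfl fun i _ => by ring
    · simp
  have hck : ∀ k, τ k = T → c k = (fun ρ => f x ρ + δ k * f w ρ) ∧
      ∀ i, x i + δ k * w i = ∑ ρ, c k ρ * (X.ray ρ i : ℝ) := by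
    intro k hk
    have h1 : ∀ i, x i + δ k * w i = ∑ ρ, c k ρ * (X.ray ρ i : ℝ) := fun i => by
      simpa [Finset.sum_apply] using congrFun (hx k) i
    refine ⟨?_, h1⟩
    rw [← hfc, funext h1, hf _ (hk ▸ hcτ k)]
  have hlin : ∀ u v : ℝ, Filter.Tendsto (fun k => u + δ k * v) Filter.atTop (nhds u) := by
    intro u v
    simpa using tendsto_const_nhds.add (hδ.mul_const v)
  have hfx : ∀ ρ, 0 ≤ f x ρ := fun ρ =>
    isClosed_Ici.mem_of_frequently_of_tendsto (hT.mono fun k hk => by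
      have := hc k ρ
      rwa [(hck k hk).1] at this) (hlin (f x ρ) (f w ρ))
  have hxe : ∀ i, x i = ∑ ρ, f x ρ * (X.ray ρ i : ℝ) := by
    intro i
    rw [← sub_eq_zero]
    refine isClosed_singleton.mem_of_frequently_of_tendsto (hT.mono fun k hk => ?_)
      (hlin _ (w i - ∑ ρ, f w ρ * (X.ray ρ i : ℝ)))
    have h1 := (hck k hk).2 i
    rw [(hck k hk).1] at h1
    simp only [add_mul, Finset.sum_add_distrib, mul_assoc, ← Finset.mul_sum] at h1
    rw [Set.mem_singleton_iff]
    linarith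
  have h1 : one = f x := cone_coord_unique hσ.prop hTc
    (fun ρ => by simp only [one]; split_ifs <;> simp) (fun ρ hρ => by simp [one, hρ]) hfx
    (fun ρ hρ => by simp [f, hρ]) hxe
  have hσT : σ ⊆ T := by
    intro ρ hρ
    by_contra hρT
    have := congrFun h1 ρ
    simp [one, f, hρ, hρT] at this
  have hTσ : T = σ := (hσ.eq_of_le hTc hσT).symm
  obtain ⟨k, hk⟩ := hT.exists
  have hδk : δ k ≠ 0 := by simp only [δ]; positivity
  have hw : ∀ i, w i = ∑ ρ, f w ρ * (X.ray ρ i : ℝ) := by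
    intro i
    have h1 := (hck k hk).2 i
    rw [(hck k hk).1] at h1
    simp only [add_mul, Finset.sum_add_distrib, mul_assoc, ← Finset.mul_sum, ← hxe] at h1
    exact mul_left_cancel₀ hδk (by linarith)
  obtain ⟨mj, hmj⟩ := exists_dotProduct_eq (b.coord j)
  have h2 : ∑ i, (mj i : ℝ) * w i = 1 := by
    have := hmj (b j)
    simp only [Module.Basis.coord_apply, Module.Basis.repr_self, Finsupp.single_eq_same] at this
    simp only [w]
    exact_mod_cast this
  have h3 : ∀ ρ, f w ρ * ∑ i, (mj i : ℝ) * (X.ray ρ i : ℝ) = 0 := by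
    intro ρ
    by_cases hρ : ρ ∈ σ
    · have := hmj (X.ray ρ)
      rw [show X.ray ρ = b (e ⟨ρ, hρ⟩) from he ⟨ρ, hρ⟩] at this
      simp only [Module.Basis.coord_apply, Module.Basis.repr_self,
        Finsupp.single_apply, if_neg (fun h => hj ⟨_, h⟩)] at this
      rw [← show X.ray ρ = b (e ⟨ρ, hρ⟩) from he ⟨ρ, hρ⟩] at this
      have h' : ∑ i, (mj i : ℝ) * (X.ray ρ i : ℝ) = 0 := by exact_mod_cast this
      rw [h', mul_zero]
    · simp [f, hTσ, hρ]
  have h4 : ∑ i, (mj i : ℝ) * w i = 0 := by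
    simp_rw [hw, Finset.mul_sum]
    rw [Finset.sum_comm]
    refine Finset.sum_eq_zero fun ρ _ => ?_
    rw [← h3 ρ, Finset.mul_sum]
    exact Finset.sum_congr rfl fun i _ => by ring
  linarith

/-- `a` expresses the classes of the divisors of the rays of `σ` in terms of those of the other
rays: `[D_ρ] = ∑ a ρ ρ' [D_ρ']`, and these relations generate the principal divisors. -/
def IsChartMatrix (σ : Finset ι) (a : σ → {ρ // ρ ∉ σ} → ℤ) : Prop :=
  (∀ D ∈ X.principal, ∀ ρ' : {ρ // ρ ∉ σ}, D ρ' = -∑ ρ : σ, D ρ * a ρ ρ') ∧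
  ∀ ρ : σ, (fun τ => if h : τ ∈ σ then (if (⟨τ, h⟩ : σ) = ρ then 1 else 0) else -a ρ ⟨τ, h⟩) ∈
    X.principal

/-- The rays of `σ` form a basis of `N`, and `-a ρ ρ'` is the coordinate of `v_ρ'` along `v_ρ`. The
displayed generators are the divisors of the dual basis of characters. -/
theorem exists_isChartMatrix {σ : Finset ι} (hσ : Maximal (· ∈ X.cones) σ) :
    ∃ a, X.IsChartMatrix σ a := by
  obtain ⟨b, e, he⟩ := X.exists_basis_of_maximal hσ
  choose m hm using fun ρ : σ => exists_dotProduct_eq (b.coord (e ρ))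
  refine ⟨fun ρ ρ' => -b.coord (e ρ) (X.ray ρ'), ?_, fun ρ => ⟨m ρ, ?_⟩⟩
  · rintro D ⟨k, rfl⟩ ρ'
    let c : (Fin n → ℤ) →ₗ[ℤ] ℤ := ∑ i, k i • LinearMap.proj i
    have hc : ∀ ρ, charDiv X.ray k ρ = c (X.ray ρ) := fun ρ => by
      simp [c, charDiv]
    have h1 : X.ray ρ' = ∑ ρ : σ, b.coord (e ρ) (X.ray ρ') • X.ray ρ := by
      simp_rw [he]
      rw [Equiv.sum_comp e fun j => b.coord j (X.ray ρ') • b j]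
      exact (b.sum_repr _).symm
    have h2 := congrArg c h1
    rw [map_sum] at h2
    rw [hc, h2, ← Finset.sum_neg_distrib]
    refine Finset.sum_congr rfl fun ρ _ => ?_
    rw [map_smul, smul_eq_mul, hc]
    ring
  · funext τ
    have h1 : charDiv X.ray (m ρ) τ = b.coord (e ρ) (X.ray τ) := hm _ _
    rw [h1]
    split_ifs with h h'
    · rw [show X.ray τ = b (e ⟨τ, h⟩) from he ⟨τ, h⟩, h']
      simp
    · rw [show X.ray τ = b (e ⟨τ, h⟩) from he ⟨τ, h⟩]
      simp [h']
    · simp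

theorem prod_eq_prod_mul_prod {M : Type*} [CommMonoid M] (σ : Finset ι) (f : ι → M) :
    ∏ ρ, f ρ = (∏ ρ : σ, f ρ) * ∏ ρ : {ρ // ρ ∉ σ}, f ρ := by
  rw [← Fintype.prod_subtype_mul_prod_subtype (· ∈ σ)]
  congr!

theorem sum_eq_sum_add_sum {M : Type*} [AddCommMonoid M] (σ : Finset ι) (f : ι → M) :
    ∑ ρ, f ρ = (∑ ρ : σ, f ρ) + ∑ ρ : {ρ // ρ ∉ σ}, f ρ := by
  rw [← Fintype.sum_subtype_add_sum_subtype (· ∈ σ)]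
  congr!

/-! ### Chart coordinates on `Pic(X)^∨_ℝ` and on the Néron–Severi torus; the Haar measure -/

variable {X} {σ : Finset ι} {a : σ → {ρ // ρ ∉ σ} → ℤ}

/-- Extension of a family of numbers outside `σ` to an element of `Pic(X)^∨_ℝ`. -/
def addExt (a : σ → {ρ // ρ ∉ σ} → ℤ) : ({ρ // ρ ∉ σ} → ℝ) →ₗ[ℝ] (ι → ℝ) where
  toFun α ρ := if h : ρ ∈ σ then ∑ ρ', (a ⟨ρ, h⟩ ρ' : ℝ) * α ρ' else α ⟨ρ, h⟩
  map_add' α β := by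
    funext ρ
    by_cases h : ρ ∈ σ <;> simp [h, mul_add, Finset.sum_add_distrib]
  map_smul' c α := by
    funext ρ
    by_cases h : ρ ∈ σ <;> simp [h, Finset.mul_sum, mul_left_comm]

/-- Extension of a family of nonzero numbers outside `σ` to a point of the Néron–Severi torus. -/
def mulExt (a : σ → {ρ // ρ ∉ σ} → ℤ) (s : {ρ // ρ ∉ σ} → ℝ) : ι → ℝ :=
  fun ρ => if h : ρ ∈ σ then ∏ ρ', s ρ' ^ a ⟨ρ, h⟩ ρ' else s ⟨ρ, h⟩

@[simp] theorem addExt_mem (α : {ρ // ρ ∉ σ} → ℝ) (ρ : σ) :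
    addExt a α ρ = ∑ ρ', (a ρ ρ' : ℝ) * α ρ' := by
  simp [addExt]

@[simp] theorem addExt_notMem (α : {ρ // ρ ∉ σ} → ℝ) (ρ : {ρ // ρ ∉ σ}) :
    addExt a α ρ = α ρ := by
  simp [addExt, ρ.2]

@[simp] theorem mulExt_mem (s : {ρ // ρ ∉ σ} → ℝ) (ρ : σ) :
    mulExt a s ρ = ∏ ρ', s ρ' ^ a ρ ρ' := by
  simp [mulExt]

@[simp] theorem mulExt_notMem (s : {ρ // ρ ∉ σ} → ℝ) (ρ : {ρ // ρ ∉ σ}) :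
    mulExt a s ρ = s ρ := by
  simp [mulExt, ρ.2]

theorem mulExt_ne_zero {s : {ρ // ρ ∉ σ} → ℝ} (hs : ∀ ρ, s ρ ≠ 0) (ρ : ι) :
    mulExt a s ρ ≠ 0 := by
  by_cases h : ρ ∈ σ
  · rw [mulExt, dif_pos h]
    exact Finset.prod_ne_zero_iff.2 fun ρ' _ => zpow_ne_zero _ (hs ρ')
  · rw [mulExt, dif_neg h]
    exact hs _

/-- The absolute value of the multiplicative extension is the exponential of the additive one: a
torus element `s` shifts heights by the element with coordinates `log |s|`. -/
theorem abs_mulExt {s : {ρ // ρ ∉ σ} → ℝ} (hs : ∀ ρ, s ρ ≠ 0) (ρ : ι) :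
    |mulExt a s ρ| = Real.exp (addExt a (fun ρ => Real.log |s ρ|) ρ) := by
  by_cases h : ρ ∈ σ
  · rw [mulExt, dif_pos h, addExt_mem _ ⟨ρ, h⟩, Finset.abs_prod, Real.exp_sum]
    refine Finset.prod_congr rfl fun ρ' _ => ?_
    rw [abs_zpow, ← Real.rpow_intCast, Real.rpow_def_of_pos (abs_pos.2 (hs ρ')), mul_comm]
  · rw [mulExt, dif_neg h, addExt_notMem _ ⟨ρ, h⟩, Real.exp_log (abs_pos.2 (hs _))]

theorem measurable_mulExt : Measurable (mulExt a) := by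
  refine measurable_pi_iff.2 fun ρ => ?_
  by_cases h : ρ ∈ σ
  · simp only [mulExt, dif_pos h]
    exact Finset.measurable_prod _ fun ρ' _ => (measurable_pi_apply ρ').pow_const _
  · simp only [mulExt, dif_neg h]
    exact measurable_pi_apply _

theorem IsChartMatrix.addExt_mem_picDual (ha : X.IsChartMatrix σ a) (α : {ρ // ρ ∉ σ} → ℝ) :
    addExt a α ∈ X.picDual := by
  intro D hD
  rw [sum_eq_sum_add_sum σ]
  have h1 : ∀ ρ' : {ρ // ρ ∉ σ}, (D ρ' : ℝ) = -∑ ρ : σ, (D ρ : ℝ) * a ρ ρ' := fun ρ' => by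
    exact_mod_cast ha.1 D hD ρ'
  simp only [addExt_mem, addExt_notMem, h1, Finset.mul_sum, neg_mul, Finset.sum_neg_distrib,
    Finset.sum_mul]
  rw [Finset.sum_comm, add_neg_eq_zero]
  exact Finset.sum_congr rfl fun _ _ => Finset.sum_congr rfl fun _ _ => by ring

theorem IsChartMatrix.eq_addExt (ha : X.IsChartMatrix σ a) (h : X.picDual) :
    (h : ι → ℝ) = addExt a (fun ρ => (h : ι → ℝ) ρ) := by
  funext ρ
  by_cases hρ : ρ ∈ σ
  · rw [addExt_mem _ ⟨ρ, hρ⟩]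
    have h1 := h.2 _ (ha.2 ⟨ρ, hρ⟩)
    rw [sum_eq_sum_add_sum σ, ← sub_neg_eq_add, sub_eq_zero,
      ← Finset.sum_neg_distrib] at h1
    convert h1 using 1
    · simp
    · exact Finset.sum_congr rfl fun ρ' _ => by simp [ρ'.2]
  · rw [addExt_notMem _ ⟨ρ, hρ⟩]

theorem IsChartMatrix.prod_mulExt (ha : X.IsChartMatrix σ a) {s : {ρ // ρ ∉ σ} → ℝ}
    (hs : ∀ ρ, s ρ ≠ 0) {D : ι → ℤ} (hD : D ∈ X.principal) : ∏ ρ, mulExt a s ρ ^ D ρ = 1 := by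
  rw [prod_eq_prod_mul_prod σ]
  simp only [mulExt_mem, mulExt_notMem, ha.1 D hD, ← Finset.prod_zpow]
  rw [Finset.prod_comm, ← Finset.prod_mul_distrib]
  refine Finset.prod_eq_one fun ρ' _ => ?_
  rw [zpow_neg, mul_inv_eq_one₀ (zpow_ne_zero _ (hs ρ'))]
  rw [show (s ρ' ^ ∑ ρ : σ, D ρ * a ρ ρ') = ∏ ρ : σ, s ρ' ^ (D ρ * a ρ ρ') from ?_]
  · exact Finset.prod_congr rfl fun ρ _ => by rw [← zpow_mul, mul_comm]
  · have := map_sum (zmultiplesHom (Additive ℝˣ) (Additive.ofMul (Units.mk0 _ (hs ρ'))))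
      (fun ρ : σ => D ρ * a ρ ρ') Finset.univ
    simp only [zmultiplesHom_apply, ← ofMul_zpow, ← ofMul_prod, EmbeddingLike.apply_eq_iff_eq,
      Units.ext_iff, Units.coe_prod, Units.val_zpow_eq_zpow_val, Units.val_mk0] at this
    exact this

/-- Eliminating the rays of `σ` by means of the relations maps divisors onto `ℤ^{ρ ∉ σ}` with the
principal divisors as kernel. -/
theorem IsChartMatrix.picRank_eq (ha : X.IsChartMatrix σ a) :
    X.picRank = Fintype.card {ρ // ρ ∉ σ} := by
  let f : (ι → ℤ) →ₗ[ℤ] ({ρ // ρ ∉ σ} → ℤ) :=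
    { toFun D ρ' := D ρ' + ∑ ρ : σ, D ρ * a ρ ρ'
      map_add' D E := by
        funext ρ'
        simp only [Pi.add_apply, add_mul, Finset.sum_add_distrib]
        ring
      map_smul' c D := by
        funext ρ'
        simp [Finset.mul_sum, mul_add, mul_assoc] }
  have hsurj : Function.Surjective f := fun z => by
    refine ⟨fun ρ => if h : ρ ∈ σ then 0 else z ⟨ρ, h⟩, ?_⟩
    funext ρ'
    simp [f, ρ'.2]
  have hker : LinearMap.ker f = X.principal := by
    ext D
    rw [LinearMap.mem_ker]
    constructor
    · intro h
      have h1 : D = ∑ ρ : σ, D ρ • (fun τ => if h : τ ∈ σ then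
          (if (⟨τ, h⟩ : σ) = ρ then 1 else 0) else -a ρ ⟨τ, h⟩) := by
        funext τ
        rw [Finset.sum_apply]
        by_cases hτ : τ ∈ σ
        · simp [hτ]
        · have := congrFun h ⟨τ, hτ⟩
          simp only [f, LinearMap.coe_mk, AddHom.coe_mk, Pi.zero_apply] at this
          simp only [Pi.smul_apply, dif_neg hτ, smul_eq_mul, mul_neg, Finset.sum_neg_distrib]
          linarith
      rw [h1]
      exact sum_mem fun ρ _ => X.principal.smul_mem _ (ha.2 ρ)
    · intro h
      funext ρ'
      simp [f, ha.1 D h ρ']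
  have e := (Submodule.quotEquivOfEq _ _ hker.symm).trans (f.quotKerEquivOfSurjective hsurj)
  rw [picRank, e.finrank_eq, Module.finrank_fintype_fun_eq_card]

/-- The coordinates on `Pic(X)^∨_ℝ` given by the divisors `D_ρ`, `ρ ∉ σ`. -/
def picEquiv (ha : X.IsChartMatrix σ a) : ({ρ // ρ ∉ σ} → ℝ) ≃L[ℝ] X.picDual :=
  LinearEquiv.toContinuousLinearEquiv
    { (addExt a).codRestrict X.picDual ha.addExt_mem_picDual with
      invFun := fun h ρ => (h : ι → ℝ) ρ
      left_inv := fun α => by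
        funext ρ
        simp
      right_inv := fun h => Subtype.ext (ha.eq_addExt h).symm }

@[simp] theorem coe_picEquiv (ha : X.IsChartMatrix σ a) (α : {ρ // ρ ∉ σ} → ℝ) :
    (picEquiv ha α : ι → ℝ) = addExt a α := rfl

/-- In the coordinates outside `σ` the dual lattice is the standard lattice, so Lebesgue measure has
the required covolume one. Any other Haar measure is a multiple `c` of it with covolume `c`, and the
normalisation divides by `c`. -/
theorem picHaar_eq (ha : X.IsChartMatrix σ a) :
    X.picHaar = Measure.map (picEquiv ha) volume := by
  let κ := {ρ // ρ ∉ σ}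
  let ν : Measure X.picDual := Measure.map (picEquiv ha) volume
  let L : Submodule ℤ (κ → ℝ) := Submodule.span ℤ (Set.range (Pi.basisFun ℝ κ))
  have hL : X.dualLattice = ZLattice.comap ℝ L (picEquiv ha).symm.toLinearMap := by
    ext h
    have h1 : h ∈ ZLattice.comap ℝ L (picEquiv ha).symm.toLinearMap ↔
        ∀ ρ : κ, ∃ k : ℤ, (k : ℝ) = (h : ι → ℝ) ρ := by
      change (picEquiv ha).symm h ∈ L ↔ _
      rw [Module.Basis.mem_span_iff_repr_mem]
      simp only [Set.mem_range, Pi.basisFun_repr]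
      rfl
    rw [h1]
    constructor
    · intro H ρ
      obtain ⟨k, hk⟩ := H (rayDiv ρ)
      exact ⟨k, by rw [← hk, pair_rayDiv]⟩
    · intro H D
      choose k hk using H
      refine ⟨∑ ρ : σ, D ρ * ∑ ρ' : κ, a ρ ρ' * k ρ' + ∑ ρ' : κ, D ρ' * k ρ', ?_⟩
      rw [pair, ha.eq_addExt h, sum_eq_sum_add_sum σ]
      simp only [addExt_mem, addExt_notMem]
      push_cast
      simp only [hk]
      rfl
  have : DiscreteTopology X.dualLattice := by rw [hL]; infer_instance
  have : IsZLattice ℝ X.dualLattice := by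
    have : IsZLattice ℝ (ZLattice.comap ℝ L (picEquiv ha).symm.toLinearMap) := inferInstance
    convert this
  have : ν.IsAddHaarMeasure := (picEquiv ha).isAddHaarMeasure_map volume
  have hν : ZLattice.covolume X.dualLattice ν = 1 := by
    have hmp : MeasurePreserving (picEquiv ha).symm ν volume := by
      refine ⟨(picEquiv ha).symm.continuous.measurable, ?_⟩
      rw [Measure.map_map (picEquiv ha).symm.continuous.measurable
        (picEquiv ha).continuous.measurable]
      simp
    simp only [hL]
    rw [ZLattice.covolume_comap L volume ν hmp,
      ZLattice.covolume_eq_measure_fundamentalDomain L volume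
        (ZSpan.isAddFundamentalDomain (Pi.basisFun ℝ κ) volume),
      ZSpan.volume_real_fundamentalDomain]
    have : Matrix.of (Pi.basisFun ℝ κ) = (1 : Matrix κ κ ℝ) := by
      ext i j
      simp [Matrix.one_apply, Pi.single_apply, eq_comm]
    simp [this]
  let c := Measure.addHaarScalarFactor (Measure.addHaar : Measure X.picDual) ν
  have hc : (Measure.addHaar : Measure X.picDual) = c • ν := Measure.isAddLeftInvariant_eq_smul _ _
  have hc0 : 0 < c := Measure.addHaarScalarFactor_pos_of_isAddHaarMeasure _ _
  have hcov : ZLattice.covolume X.dualLattice (Measure.addHaar : Measure X.picDual) = c := by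
    have F := ZLattice.isAddFundamentalDomain (Module.Free.chooseBasis ℤ X.dualLattice)
      (Measure.addHaar : Measure X.picDual)
    have F' := ZLattice.isAddFundamentalDomain (Module.Free.chooseBasis ℤ X.dualLattice) ν
    rw [ZLattice.covolume_eq_measure_fundamentalDomain _ _ F, hc, measureReal_nnreal_smul_apply,
      ← ZLattice.covolume_eq_measure_fundamentalDomain _ _ F', hν, mul_one]
  rw [picHaar, hcov, hc]
  change _ = ν
  rw [ENNReal.ofReal_coe_nnreal]
  change (c : ENNReal)⁻¹ • (c : ENNReal) • ν = ν
  rw [smul_smul, ENNReal.inv_mul_cancel (by simpa using hc0.ne') ENNReal.coe_ne_top, one_smul]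

end SmoothProjectiveFan

/-! ### Integrals over products, logarithmic substitution and scaling -/

theorem lintegral_pi_prod {κ : Type*} [Fintype κ] {E : κ → Type*} [∀ i, MeasurableSpace (E i)]
    (μ : ∀ i, Measure (E i)) [∀ i, SigmaFinite (μ i)] (f : ∀ i, E i → ENNReal)
    (hf : ∀ i, Measurable (f i)) :
    ∫⁻ x, ∏ i, f i (x i) ∂Measure.pi μ = ∏ i, ∫⁻ t, f i t ∂μ i := by
  classical
  have hF : Measurable fun x : ∀ i, E i => ∏ i, f i (x i) :=
    Finset.measurable_prod _ fun i _ => (hf i).comp (measurable_pi_apply i)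
  have key : ∀ s : Finset κ, ∀ x, (∫⋯∫⁻_s, (fun x => ∏ i, f i (x i)) ∂μ) x =
      (∏ i ∈ s, ∫⁻ t, f i t ∂μ i) * ∏ i ∈ sᶜ, f i (x i) := by
    intro s
    induction s using Finset.induction with
    | empty => simp
    | insert i s hi ih =>
      intro x
      rw [lmarginal_insert _ hF hi]
      simp_rw [ih]
      have h1 : ∀ t, ∏ j ∈ sᶜ, f j (Function.update x i t j) =
          f i t * ∏ j ∈ (insert i s)ᶜ, f j (x j) := by
        intro t
        rw [← Finset.insert_compl_insert hi, Finset.prod_insert (by simp)]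
        congr 1
        · simp
        · refine Finset.prod_congr rfl fun j hj => ?_
          have : j ≠ i := by rintro rfl; simp at hj
          rw [Function.update_of_ne this]
      simp_rw [h1, ← mul_assoc]
      rw [lintegral_mul_const _ ((hf i).const_mul _), lintegral_const_mul _ (hf i),
        Finset.prod_insert hi]
      ring
  rcases isEmpty_or_nonempty (∀ i, E i) with h | ⟨⟨x⟩⟩
  · obtain ⟨i, hi⟩ : ∃ i, IsEmpty (E i) := isEmpty_pi.1 h
    rw [Finset.prod_eq_zero (Finset.mem_univ i) (by simp)]
    simp
  · rw [lintegral_eq_lmarginal_univ x, key]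
    simp

theorem map_log_abs_volume : Measure.map (fun s : ℝ => Real.log |s|) volume =
    (volume : Measure ℝ).withDensity fun a => 2 * ENNReal.ofReal (Real.exp a) := by
  have hm : Measurable fun s : ℝ => Real.log |s| := by fun_prop
  ext T hT
  rw [Measure.map_apply hm hT, withDensity_apply _ hT, lintegral_const_mul _ (by fun_prop)]
  have h1 : volume (Real.exp '' T) = ∫⁻ a in T, ENNReal.ofReal (Real.exp a) := by
    have := lintegral_image_eq_lintegral_abs_deriv_mul hT
      (fun x _ => (Real.hasDerivAt_exp x).hasDerivWithinAt) Real.exp_injective.injOn (fun _ => 1)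
    simpa [abs_of_pos (Real.exp_pos _)] using this
  have hmE : MeasurableSet (Real.exp '' T) :=
    (Real.continuous_exp.measurableEmbedding Real.exp_injective).measurableSet_image.2 hT
  -- Equality holds only off `0`: by the convention `log 0 = 0` the point `0` belongs to the
  -- preimage when `0 ∈ T`.
  have h2 : (fun s : ℝ => Real.log |s|) ⁻¹' T =ᵐ[volume]
      (Real.exp '' T ∪ Neg.neg ⁻¹' (Real.exp '' T) : Set ℝ) := by
    have h0 : ∀ᵐ s : ℝ, s ≠ 0 := by simp [ae_iff, measure_singleton]
    filter_upwards [h0] with s hs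
    refine propext ⟨fun h => ?_, ?_⟩
    · rcases hs.lt_or_gt with hs | hs
      · exact Or.inr ⟨_, h, by rw [Real.exp_log (abs_pos.2 hs.ne), abs_of_neg hs]⟩
      · exact Or.inl ⟨_, h, by rw [Real.exp_log (abs_pos.2 hs.ne'), abs_of_pos hs]⟩
    · rintro (⟨t, ht, rfl⟩ | ⟨t, ht, h⟩)
      · change Real.log |Real.exp t| ∈ T
        simpa using ht
      · change Real.log |s| ∈ T
        rw [← abs_neg, ← h]
        simpa using ht
  rw [measure_congr h2, measure_union _ (hmE.preimage measurable_neg), Measure.measure_preimage_neg,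
    h1, two_mul]
  rw [Set.disjoint_left]
  rintro s ⟨t, -, rfl⟩ ⟨t', -, h⟩
  linarith [Real.exp_pos t, Real.exp_pos t']

/-- Each coordinate has two signs and Jacobian `exp`. This is the origin of the factor `2^t`. -/
theorem lintegral_log_abs {κ : Type*} [Fintype κ] {F : (κ → ℝ) → ENNReal} (hF : Measurable F) :
    ∫⁻ s : κ → ℝ, F (fun i => Real.log |s i|) =
      2 ^ Fintype.card κ * ∫⁻ α, ENNReal.ofReal (Real.exp (∑ i, α i)) * F α := by
  have hm : Measurable fun s : ℝ => Real.log |s| := by fun_prop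
  have hg : Measurable fun a : ℝ => 2 * ENNReal.ofReal (Real.exp a) := by fun_prop
  have hsf : SigmaFinite ((volume : Measure ℝ).withDensity fun a =>
      2 * ENNReal.ofReal (Real.exp a)) :=
    SigmaFinite.withDensity_of_ne_top' fun a => by finiteness
  have h1 : Measure.map (fun (s : κ → ℝ) i => Real.log |s i|) volume =
      (volume : Measure (κ → ℝ)).withDensity fun α => ∏ i, 2 * ENNReal.ofReal (Real.exp (α i)) := by
    rw [volume_pi]
    have hsf' : SigmaFinite (Measure.map (fun s : ℝ => Real.log |s|) volume) := by
      rw [map_log_abs_volume]; exact hsf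
    rw [Measure.pi_map_pi (f := fun _ (s : ℝ) => Real.log |s|) fun _ => hm.aemeasurable]
    refine Measure.pi_eq fun s hs => ?_
    rw [withDensity_apply _ (MeasurableSet.univ_pi hs), Measure.restrict_pi_pi,
      lintegral_pi_prod _ _ fun _ => hg]
    refine Finset.prod_congr rfl fun i _ => ?_
    rw [map_log_abs_volume, withDensity_apply _ (hs i)]
  rw [← lintegral_map hF (by fun_prop), h1,
    lintegral_withDensity_eq_lintegral_mul _ (by fun_prop) hF,
    ← lintegral_const_mul _ (by fun_prop)]
  refine lintegral_congr fun α => ?_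
  rw [Pi.mul_apply, Finset.prod_mul_distrib, Real.exp_sum,
    ENNReal.ofReal_prod_of_nonneg fun _ _ => (Real.exp_pos _).le]
  simp [mul_assoc]

theorem lintegral_pi_scale {κ : Type*} [Fintype κ] {c : κ → ℝ} (hc : ∀ i, c i ≠ 0)
    {F : (κ → ℝ) → ENNReal} (hF : Measurable F) :
    ∫⁻ z, F z = ENNReal.ofReal |∏ i, c i| * ∫⁻ x : κ → ℝ, F (fun i => c i * x i) := by
  classical
  have hd : (Matrix.diagonal c).det ≠ 0 := by
    rw [Matrix.det_diagonal]; exact Finset.prod_ne_zero_iff.2 fun i _ => hc i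
  have h := Real.smul_map_diagonal_volume_pi hd
  conv_lhs => rw [← h]
  rw [lintegral_smul_measure, Matrix.det_diagonal, smul_eq_mul, lintegral_map hF
    (LinearMap.continuous_on_pi _).measurable]
  refine congrArg _ (lintegral_congr fun x => ?_)
  congr 1
  funext i
  simp [Matrix.mulVec_diagonal]

/-! ### The Tamagawa measure at infinity as a volume on the torsor -/

namespace SmoothProjectiveFan

variable {n : ℕ} {ι : Type*} [Fintype ι] [DecidableEq ι] (X : SmoothProjectiveFan n ι)

theorem measurableSet_torsor : MeasurableSet (X.torsor ℝ) := by
  have : X.torsor ℝ = ⋃ σ ∈ X.cones, ⋂ ρ ∈ σᶜ, {y | y ρ ≠ 0} := by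
    ext y
    simp only [mem_torsor_field_iff, mem_iUnion, mem_iInter, Finset.mem_compl, mem_ofPred_eq,
      exists_prop]
    refine ⟨fun h => ⟨_, h, by simp⟩, fun ⟨σ, hσ, h⟩ => X.face_mem σ hσ _ fun ρ hρ => ?_⟩
    by_contra hρσ
    exact h ρ hρσ (by simpa using hρ)
  rw [this]
  refine MeasurableSet.biUnion (Set.to_countable _) fun σ _ =>
    MeasurableSet.biInter (Set.to_countable _) fun ρ _ => ?_
  exact (measurableSet_singleton (0 : ℝ)).compl.preimage (measurable_pi_apply ρ)

/-- The points of the torsor over a set of real points. -/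
def torsorOver (A : Set X.RealPoints) : Set (ι → ℝ) :=
  Subtype.val '' (Quotient.mk X.nsSetoid ⁻¹' A)

variable {X}

theorem mem_torsorOver_iff {A : Set X.RealPoints} {y : ι → ℝ} (hy : y ∈ X.torsor ℝ) :
    y ∈ X.torsorOver A ↔ Quotient.mk X.nsSetoid ⟨y, hy⟩ ∈ A := by
  simp [torsorOver, hy]

theorem measurable_quotient_mk_nsSetoid : Measurable (Quotient.mk X.nsSetoid) :=
  letI := X.nsSetoid
  measurable_quotient_mk'

theorem measurableSet_torsorOver {A : Set X.RealPoints} (hA : MeasurableSet A) :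
    MeasurableSet (X.torsorOver A) :=
  X.measurableSet_torsor.subtype_image (measurable_quotient_mk_nsSetoid hA)

theorem torsorOver_univ : X.torsorOver univ = X.torsor ℝ := by
  simp [torsorOver]

theorem mul_mem_torsor_iff {s y : ι → ℝ} (hs : ∀ ρ, s ρ ≠ 0) :
    (fun ρ => s ρ * y ρ) ∈ X.torsor ℝ ↔ y ∈ X.torsor ℝ := by
  simp [mem_torsor_field_iff, hs]

theorem mul_mem_torsorOver_iff {A : Set X.RealPoints} {s y : ι → ℝ} (hs : ∀ ρ, s ρ ≠ 0)
    (hs1 : ∀ D ∈ X.principal, ∏ ρ, s ρ ^ D ρ = 1) :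
    (fun ρ => s ρ * y ρ) ∈ X.torsorOver A ↔ y ∈ X.torsorOver A := by
  by_cases hy : y ∈ X.torsor ℝ
  · have hy' := (mul_mem_torsor_iff hs).2 hy
    rw [mem_torsorOver_iff hy, mem_torsorOver_iff hy']
    suffices Quotient.mk X.nsSetoid ⟨y, hy⟩ = Quotient.mk X.nsSetoid ⟨_, hy'⟩ by rw [this]
    refine Quotient.sound ⟨fun ρ => Units.mk0 (s ρ) (hs ρ), fun D hD => ?_, fun ρ => rfl⟩
    rw [Units.ext_iff, Units.coe_prod]
    simpa using hs1 D hD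
  · have hsub : ∀ z ∈ X.torsorOver A, z ∈ X.torsor ℝ := by
      rintro _ ⟨z, -, rfl⟩
      exact z.2
    exact ⟨fun h => (hy ((mul_mem_torsor_iff hs).1 (hsub _ h))).elim, fun h => (hy (hsub _ h)).elim⟩

omit [Fintype ι] in
theorem measurable_chartLift (σ : Finset ι) : Measurable (chartLift σ) := by
  refine measurable_pi_iff.2 fun ρ => ?_
  by_cases h : ρ ∈ σ
  · simp only [chartLift, dif_pos h]; exact measurable_pi_apply _
  · simp only [chartLift, dif_neg h]; exact measurable_const

theorem measurable_chart {σ : Finset ι} (hσ : σ ∈ X.cones) : Measurable (X.chart hσ) :=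
  measurable_quotient_mk_nsSetoid.comp ((measurable_chartLift σ).subtype_mk)

theorem mulExt_mul_mem_region_iff {σ : Finset ι} {a : σ → {ρ // ρ ∉ σ} → ℤ} (ha : X.IsChartMatrix σ a)
    (D : Set X.picDual) {s : {ρ // ρ ∉ σ} → ℝ} (hs : ∀ ρ, s ρ ≠ 0) {y : ι → ℝ}
    (hy : y ∈ X.torsor ℝ) :
    (fun ρ => mulExt a s ρ * y ρ) ∈ X.region D ↔
      picEquiv ha (fun ρ => Real.log |s ρ|) + X.torsorHeight y ∈ D := by
  have H : X.Adapted (fun ρ => mulExt a s ρ * y ρ)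
      ((picEquiv ha (fun ρ => Real.log |s ρ|) + X.torsorHeight y : X.picDual) : ι → ℝ) :=
    (adapted_torsorHeight hy).mul (abs_mulExt hs)
  rw [mem_region_iff, H.torsorHeight_eq, and_iff_right H.mem_torsor]

theorem ae_forall_ne_zero (κ : Type*) [Fintype κ] : ∀ᵐ s : κ → ℝ, ∀ i, s i ≠ 0 := by
  rw [ae_all_iff]
  intro i
  have h0 : ∀ᵐ t : ℝ, t ≠ 0 := by simp [ae_iff, measure_singleton]
  exact (Measure.quasiMeasurePreserving_eval (fun _ : κ => (volume : Measure ℝ)) i).ae h0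

theorem exists_maximal : ∃ σ, Maximal (· ∈ X.cones) σ := by
  obtain ⟨σ, hσ, -⟩ := X.exists_maximal_cone X.empty_mem
  exact ⟨σ, hσ⟩

instance isAddHaarMeasure_picHaar : X.picHaar.IsAddHaarMeasure := by
  obtain ⟨σ, hσ⟩ := X.exists_maximal
  obtain ⟨a, ha⟩ := X.exists_isChartMatrix hσ
  rw [picHaar_eq ha]
  exact (picEquiv ha).isAddHaarMeasure_map volume

variable (X) in
theorem continuous_exp_pair : Continuous fun h : X.picDual => Real.exp (X.pair antiK h) := by
  simp only [pair_antiK]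
  exact Real.continuous_exp.comp (continuous_finsetSum _ fun ρ _ => X.continuous_picDual_apply ρ)

variable (X) in
theorem ofReal_nu {D : Set X.picDual} (hD : IsCompact D) :
    ENNReal.ofReal (X.nu D) = ∫⁻ h in D, ENNReal.ofReal (Real.exp (X.pair antiK h)) ∂X.picHaar :=
  ofReal_integral_eq_lintegral_ofReal
    (X.continuous_exp_pair.continuousOn.integrableOn_compact hD)
    (Filter.Eventually.of_forall fun _ => (Real.exp_pos _).le)

/-- The volume of the set of real points of the torsor with multi-height in `D` over `A`. -/
theorem volume_region_inter {σ : Finset ι} (hσ : Maximal (· ∈ X.cones) σ) {D : Set X.picDual}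
    (hD : IsCompact D) {A : Set X.RealPoints} (hA : MeasurableSet A) :
    volume (X.region D ∩ X.torsorOver A) =
      2 ^ X.picRank * (∫⁻ h in D, ENNReal.ofReal (Real.exp (X.pair antiK h)) ∂X.picHaar) *
        X.chartMeasure hσ.prop A := by
  obtain ⟨a, ha⟩ := X.exists_isChartMatrix hσ
  set G : Set (ι → ℝ) := X.region D ∩ X.torsorOver A with hG
  have hGm : MeasurableSet G :=
    (X.isCompact_region hD).isClosed.measurableSet.inter (measurableSet_torsorOver hA)
  let g : (ι → ℝ) → ENNReal := G.indicator 1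
  have hg : Measurable g := measurable_one.indicator hGm
  let glue : (σ → ℝ) × ({ρ // ρ ∉ σ} → ℝ) → ι → ℝ := fun q ρ =>
    if h : ρ ∈ σ then q.1 ⟨ρ, h⟩ else q.2 ⟨ρ, h⟩
  have hglue : MeasurePreserving glue volume volume := by
    have h := (volume_preserving_piEquivPiSubtypeProd (fun _ : ι => ℝ) (· ∈ σ)).symm
    have h' : glue = (MeasurableEquiv.piEquivPiSubtypeProd (fun _ : ι => ℝ) (· ∈ σ)).symm := rfl
    rw [h']
    convert h <;> rfl
  have hext : ∀ (x : σ → ℝ) (s : {ρ // ρ ∉ σ} → ℝ),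
      glue (fun ρ => mulExt a s ρ * x ρ, s) = fun ρ => mulExt a s ρ * chartLift σ x ρ := by
    intro x s
    funext ρ
    by_cases h : ρ ∈ σ <;> simp [glue, chartLift, h, mulExt]
  let F : (σ → ℝ) → ({ρ // ρ ∉ σ} → ℝ) → ENNReal := fun x s =>
    ENNReal.ofReal |∏ ρ : σ, mulExt a s ρ| * g (fun ρ => mulExt a s ρ * chartLift σ x ρ)
  have hmul : ∀ ρ, Measurable fun q : (σ → ℝ) × ({ρ // ρ ∉ σ} → ℝ) => mulExt a q.2 ρ := fun ρ =>
    (measurable_pi_apply ρ).comp (measurable_mulExt.comp measurable_snd)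
  have hF : Measurable (Function.uncurry F) := by
    refine Measurable.mul ?_ (hg.comp (measurable_pi_iff.2 fun ρ => (hmul ρ).mul
      ((measurable_pi_apply ρ).comp ((measurable_chartLift σ).comp measurable_fst))))
    exact ENNReal.measurable_ofReal.comp (continuous_abs.measurable.comp
      (Finset.measurable_prod (Finset.univ : Finset σ) fun ρ _ => hmul ρ))
  -- For fixed coordinates `s` outside `σ`, those in `σ` are rescaled by the torus element extending
  -- `s`, so that the point becomes the translate by it of the lift of `x`. The product in `F` is
  -- the Jacobian.
  have h1 : volume G = ∫⁻ s, ∫⁻ x, F x s := by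
    rw [← lintegral_indicator_one hGm, ← hglue.lintegral_comp hg, Measure.volume_eq_prod,
      lintegral_prod_symm' (fun q => g (glue q)) (hg.comp hglue.measurable)]
    refine lintegral_congr_ae ?_
    filter_upwards [ae_forall_ne_zero {ρ // ρ ∉ σ}] with s hs
    have hm : Measurable fun z : σ → ℝ => g (glue (z, s)) :=
      hg.comp (hglue.measurable.comp measurable_prodMk_right)
    rw [lintegral_pi_scale (c := fun ρ : σ => mulExt a s ρ) (fun ρ => mulExt_ne_zero hs ρ) hm]
    rw [← lintegral_const_mul _ (by
      exact hg.comp (hglue.measurable.comp (Measurable.prodMk (by fun_prop) measurable_const)))]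
    refine lintegral_congr fun x => ?_
    simp only [F, hext]
  let N := ∫⁻ h in D, ENNReal.ofReal (Real.exp (X.pair antiK h)) ∂X.picHaar
  have hDm : MeasurableSet D := hD.isClosed.measurableSet
  have hpairm : Measurable fun h : X.picDual => ENNReal.ofReal (Real.exp (X.pair antiK h)) :=
    ENNReal.measurable_ofReal.comp X.continuous_exp_pair.measurable
  have hpe := (picEquiv ha).continuous.measurable
  have hN : N ≠ ⊤ := (X.ofReal_nu hD).symm.trans_ne ENNReal.ofReal_ne_top
  -- the integral over the fibre of the torsor
  have h2 : ∀ x : σ → ℝ, ∫⁻ s, F x s = 2 ^ X.picRank * N *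
      ((X.chart hσ.prop ⁻¹' A).indicator (fun x =>
        ENNReal.ofReal (Real.exp (- X.pair antiK (X.torsorHeight (chartLift σ x))))) x) := by
    intro x
    have hy := X.chartLift_mem hσ.prop x
    by_cases hx : x ∈ X.chart hσ.prop ⁻¹' A
    · rw [indicator_of_mem hx]
      set h₀ := X.torsorHeight (chartLift σ x)
      let K : X.picDual → ENNReal := D.indicator fun h => ENNReal.ofReal (Real.exp (X.pair antiK h))
      have hK : Measurable K := hpairm.indicator hDm
      -- The Jacobian is the exponential of the sum over `σ` of the coordinates of the extension of
      -- `α = log |s|`. Completing it to the sum over all rays gives `⟨ω_X^{-1}, ·⟩` at the total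
      -- height, up to the factor `exp (-∑ α)`, which `ds` will cancel, and the chart density at
      -- `h₀`.
      have h3 : ∀ᵐ s : {ρ // ρ ∉ σ} → ℝ, F x s =
          (fun α => ENNReal.ofReal (Real.exp (-∑ ρ, α ρ)) *
            (ENNReal.ofReal (Real.exp (- X.pair antiK h₀)) * K (picEquiv ha α + h₀)))
            fun ρ => Real.log |s ρ| := by
        filter_upwards [ae_forall_ne_zero {ρ // ρ ∉ σ}] with s hs
        have hmem : (fun ρ => mulExt a s ρ * chartLift σ x ρ) ∈ G ↔
            picEquiv ha (fun ρ => Real.log |s ρ|) + h₀ ∈ D := by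
          rw [hG, mem_inter_iff, mulExt_mul_mem_region_iff ha D hs hy,
            mul_mem_torsorOver_iff (mulExt_ne_zero hs) fun _ => ha.prod_mulExt hs,
            mem_torsorOver_iff hy]
          exact and_iff_left hx
        simp only [F, g, K]
        by_cases hd : picEquiv ha (fun ρ => Real.log |s ρ|) + h₀ ∈ D
        · rw [indicator_of_mem (hmem.2 hd), indicator_of_mem hd,
            ← ENNReal.ofReal_mul (Real.exp_pos _).le, ← ENNReal.ofReal_mul (Real.exp_pos _).le,
            ← Real.exp_add, ← Real.exp_add, Pi.one_apply, mul_one]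
          congr 1
          rw [Finset.abs_prod]
          simp only [abs_mulExt hs]
          rw [← Real.exp_sum]
          congr 1
          simp only [pair_antiK, Submodule.coe_add, Pi.add_apply, coe_picEquiv,
            Finset.sum_add_distrib]
          rw [sum_eq_sum_add_sum σ (addExt a _)]
          simp only [addExt_notMem]
          ring
        · rw [indicator_of_notMem (fun h => hd (hmem.1 h)), indicator_of_notMem hd]
          simp
      rw [lintegral_congr_ae h3, lintegral_log_abs (F := fun α : {ρ // ρ ∉ σ} → ℝ =>
          ENNReal.ofReal (Real.exp (-∑ ρ, α ρ)) * (ENNReal.ofReal (Real.exp (- X.pair antiK h₀)) *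
            K (picEquiv ha α + h₀))) (by fun_prop), ha.picRank_eq, mul_assoc]
      congr 1
      have h4 : ∀ α : {ρ // ρ ∉ σ} → ℝ, ENNReal.ofReal (Real.exp (∑ ρ, α ρ)) *
          (ENNReal.ofReal (Real.exp (-∑ ρ, α ρ)) *
            (ENNReal.ofReal (Real.exp (- X.pair antiK h₀)) * K (picEquiv ha α + h₀))) =
          ENNReal.ofReal (Real.exp (- X.pair antiK h₀)) * K (picEquiv ha α + h₀) := by
        intro α
        rw [← mul_assoc, ← ENNReal.ofReal_mul (Real.exp_pos _).le, ← Real.exp_add, add_neg_cancel,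
          Real.exp_zero, ENNReal.ofReal_one, one_mul]
      simp_rw [h4]
      rw [lintegral_const_mul _ (by fun_prop), mul_comm]
      congr 1
      -- Translation invariance removes `h₀`, so the integral over a fibre depends on `x` only
      -- through the density of the chart measure.
      rw [← lintegral_map (f := fun h => K (h + h₀)) (by fun_prop) hpe, ← picHaar_eq ha,
        lintegral_add_right_eq_self]
      exact lintegral_indicator hDm _
    · rw [indicator_of_notMem hx, mul_zero, lintegral_eq_zero_iff (hF.of_uncurry_left)]
      filter_upwards [ae_forall_ne_zero {ρ // ρ ∉ σ}] with s hs
      have : (fun ρ => mulExt a s ρ * chartLift σ x ρ) ∉ G := by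
        rintro ⟨-, h⟩
        rw [mul_mem_torsorOver_iff (mulExt_ne_zero hs) fun _ => ha.prod_mulExt hs,
          mem_torsorOver_iff hy] at h
        exact hx h
      simp [F, g, this]
  rw [h1, lintegral_lintegral_swap (by exact (hF.comp measurable_swap).aemeasurable)]
  simp_rw [h2]
  have hAm := measurable_chart hσ.prop hA
  rw [lintegral_const_mul' _ _ (ENNReal.mul_ne_top (by finiteness) hN), lintegral_indicator hAm, chartMeasure,
    Measure.map_apply (measurable_chart hσ.prop) hA, withDensity_apply _ hAm]

/-- The unit ball is an auxiliary set of heights: its positive finite `ν` allows chart measures to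
be recovered from volumes on the torsor. -/
theorem nu_closedBall_pos : 0 < X.nu (Metric.closedBall 0 1) := by
  have h : 0 < X.picHaar (Metric.closedBall 0 1) :=
    (Metric.measure_ball_pos _ _ one_pos).trans_le (measure_mono Metric.ball_subset_closedBall)
  refine (setIntegral_pos_iff_support_of_nonneg_ae
    (Filter.Eventually.of_forall fun _ => (Real.exp_pos _).le)
    (X.continuous_exp_pair.continuousOn.integrableOn_compact (isCompact_closedBall _ _))).2 ?_
  have hs : Function.support (fun h : X.picDual => Real.exp (X.pair antiK h)) = univ :=
    eq_univ_of_forall fun _ => (Real.exp_pos _).ne'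
  rwa [hs, univ_inter]

theorem two_pow_mul_nu_closedBall_pos :
    0 < 2 ^ X.picRank * ENNReal.ofReal (X.nu (Metric.closedBall 0 1)) :=
  ENNReal.mul_pos (by simp) (ENNReal.ofReal_pos.2 nu_closedBall_pos).ne'

/-- The volume of the part of the torsor over `A` with height in a ball does not involve a chart.
Computed in two charts, it gives the same positive finite multiple of either chart measure, so no
change of charts is needed. -/
theorem chartMeasure_eq {σ τ : Finset ι} (hσ : Maximal (· ∈ X.cones) σ)
    (hτ : Maximal (· ∈ X.cones) τ) : X.chartMeasure hσ.prop = X.chartMeasure hτ.prop := by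
  ext A hA
  have hD : IsCompact (Metric.closedBall (0 : X.picDual) 1) := isCompact_closedBall _ _
  have h1 := volume_region_inter hσ hD hA
  rw [volume_region_inter hτ hD hA, ← X.ofReal_nu hD] at h1
  exact ((ENNReal.mul_right_inj two_pow_mul_nu_closedBall_pos.ne'
    (ENNReal.mul_ne_top (by finiteness) (by finiteness))).1 h1).symm

theorem muInfty_eq {σ : Finset ι} (hσ : Maximal (· ∈ X.cones) σ) :
    X.muInfty = X.chartMeasure hσ.prop :=
  le_antisymm (iSup₂_le fun _ hτ => (chartMeasure_eq hτ hσ).le)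
    (le_iSup₂ (f := fun τ (hτ : Maximal (· ∈ X.cones) τ) => X.chartMeasure hτ.prop) σ hσ)

theorem volume_region_eq {D : Set X.picDual} (hD : IsCompact D) :
    volume (X.region D) = 2 ^ X.picRank * ENNReal.ofReal (X.nu D) * X.muInfty univ := by
  obtain ⟨σ, hσ⟩ := X.exists_maximal
  rw [muInfty_eq hσ, X.ofReal_nu hD, ← volume_region_inter hσ hD MeasurableSet.univ,
    torsorOver_univ, inter_eq_left.2 fun y hy => (mem_region_iff.1 hy).1]

/-- The region over the unit ball is compact, so its volume is finite, and it is a positive multiple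
of the total mass. -/
theorem muInfty_univ_lt_top : X.muInfty univ < ⊤ := by
  have hD : IsCompact (Metric.closedBall (0 : X.picDual) 1) := isCompact_closedBall _ _
  have h1 := (X.isCompact_region hD).measure_lt_top (μ := volume)
  rw [volume_region_eq hD] at h1
  by_contra h
  rw [not_lt_top_iff.1 h, ENNReal.mul_top two_pow_mul_nu_closedBall_pos.ne'] at h1
  exact lt_irrefl _ h1

theorem volume_region {D : Set X.picDual} (hD : IsCompact D) :
    volume.real (X.region D) = 2 ^ X.picRank * X.nu D * X.muInfty.real univ := by
  have h0 : 0 ≤ X.nu D := setIntegral_nonneg hD.isClosed.measurableSet fun _ _ => (Real.exp_pos _).le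
  rw [measureReal_def, volume_region_eq hD, ENNReal.toReal_mul, ENNReal.toReal_mul,
    ENNReal.toReal_ofReal h0, ENNReal.toReal_pow, measureReal_def, ENNReal.toReal_ofNat]

end SmoothProjectiveFan

/-- The Möbius inverse of a function on finite sets. -/
def finsetMoebius {ι : Type*} [DecidableEq ι] (g : Finset ι → ℤ) (e : Finset ι) : ℤ :=
  g e - ∑ S ∈ e.ssubsets.attach, finsetMoebius g S
termination_by e.card
decreasing_by exact Finset.card_lt_card (Finset.mem_ssubsets.1 S.2)

theorem sum_finsetMoebius {ι : Type*} [DecidableEq ι] (g : Finset ι → ℤ) (e : Finset ι) :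
    ∑ S ∈ e.powerset, finsetMoebius g S = g e := by
  rw [← Finset.add_sum_erase _ _ (Finset.mem_powerset_self e), finsetMoebius,
    Finset.sum_attach e.ssubsets (finsetMoebius g)]
  simp [Finset.ssubsets]

/-! ### The Möbius function of the fan and the local densities -/

namespace SmoothProjectiveFan

variable {n : ℕ} {ι : Type*} [Fintype ι] [DecidableEq ι] (X : SmoothProjectiveFan n ι)

open Classical in
/-- The Möbius function of the fan. -/
def moebius : Finset ι → ℤ := finsetMoebius fun e => if e ∈ X.cones then 1 else 0

open Classical in
theorem sum_moebius (e : Finset ι) :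
    ∑ S ∈ e.powerset, X.moebius S = if e ∈ X.cones then 1 else 0 :=
  sum_finsetMoebius _ e

open Classical in
theorem sum_moebius_filter (e : Finset ι) :
    ∑ S, (if S ⊆ e then X.moebius S else 0) = if e ∈ X.cones then 1 else 0 := by
  rw [← sum_moebius, ← Finset.sum_filter]
  refine Finset.sum_congr ?_ fun _ _ => rfl
  ext S
  simp

theorem moebius_empty : X.moebius ∅ = 1 := by
  have := X.sum_moebius ∅
  simpa [X.empty_mem] using this

/-- All subsets of a cone are cones, so by induction the Möbius sum over them reduces to `μ(∅) +
μ(e) = 1`. -/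
theorem moebius_eq_zero {e : Finset ι} (he : e ∈ X.cones) (hne : e ≠ ∅) : X.moebius e = 0 := by
  induction e using Finset.strongInduction with
  | H e ih =>
    have h := X.sum_moebius e
    rw [if_pos he, ← Finset.add_sum_erase _ _ (Finset.mem_powerset_self e),
      Finset.sum_eq_single ∅, moebius_empty] at h
    · linarith
    · intro S hS hS0
      rw [Finset.mem_erase, Finset.mem_powerset] at hS
      exact ih S (hS.2.ssubset_of_ne hS.1) (X.face_mem e he S hS.2) hS0
    · intro h
      simp [hne.symm] at h

section Padic

variable (p : ℕ) [Fact p.Prime]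

/-- The points of `ℤ_p^ι` whose coordinates in `e` are divisible by `p`. -/
def padicBox (e : Finset ι) : Set (ι → ℚ_[p]) :=
  {y | ∀ ρ, ‖y ρ‖ ≤ 1 ∧ (ρ ∈ e → ‖y ρ‖ < 1)}

omit [Fintype ι] [DecidableEq ι] in
theorem exists_nat_norm_sub_lt_one (x : ℚ_[p]) (hx : ‖x‖ ≤ 1) :
    ∃ k < p, ‖x - (k : ℚ_[p])‖ < 1 := by
  obtain ⟨z, rfl⟩ : ∃ z : ℤ_[p], (z : ℚ_[p]) = x := ⟨⟨x, hx⟩, rfl⟩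
  obtain ⟨k, hk, h⟩ := PadicInt.exists_mem_range z
  refine ⟨k, hk, ?_⟩
  rw [PadicInt.maximalIdeal_eq_span_p, Ideal.mem_span_singleton, ← PadicInt.norm_lt_one_iff_dvd] at h
  rw [PadicInt.norm_def, PadicInt.coe_sub, PadicInt.coe_natCast] at h
  exact h

omit [Fintype ι] [DecidableEq ι] in
theorem measurableSet_padicBox [Finite ι] [MeasurableSpace (ι → ℚ_[p])] [BorelSpace (ι → ℚ_[p])]
    (e : Finset ι) : MeasurableSet (padicBox p e) := by
  have : padicBox p e = (⋂ ρ, {y : ι → ℚ_[p] | ‖y ρ‖ ≤ 1}) ∩ ⋂ ρ ∈ e, {y | ‖y ρ‖ < 1} := by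
    ext y
    simp [padicBox, forall_and]
  rw [this]
  refine (IsClosed.measurableSet (isClosed_iInter fun ρ => isClosed_le (by fun_prop)
    (by fun_prop))).inter (IsOpen.measurableSet (e.finite_toSet.isOpen_biInter fun ρ _ =>
      isOpen_lt (by fun_prop) (by fun_prop)))

omit [DecidableEq ι] in
theorem mem_padicUnitBox_iff (y : ι → ℚ_[p]) : y ∈ padicUnitBox ι p ↔ ∀ ρ, ‖y ρ‖ ≤ 1 := by
  change y ∈ Metric.closedBall 0 1 ↔ _
  rw [mem_closedBall_zero_iff, pi_norm_le_iff_of_nonneg zero_le_one]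

/-- According to the residue class of `y ρ` modulo `p`, the box for `e` is a disjoint union of `p`
translates of the box for `insert ρ e`; each new ray therefore divides the measure by `p`. -/
theorem measure_padicBox [MeasurableSpace (ι → ℚ_[p])] [BorelSpace (ι → ℚ_[p])] (e : Finset ι) :
    (Measure.addHaarMeasure (padicUnitBox ι p)).real (padicBox p e) = ((p : ℝ)⁻¹) ^ e.card := by
  set m := Measure.addHaarMeasure (padicUnitBox ι p)
  have hp : (p : ℝ) ≠ 0 := by exact_mod_cast (Fact.out : p.Prime).ne_zero
  induction e using Finset.induction with
  | empty =>
    have : padicBox p (∅ : Finset ι) = padicUnitBox ι p := by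
      ext y
      rw [SetLike.mem_coe, mem_padicUnitBox_iff]
      simp [padicBox]
    rw [this, measureReal_def, Measure.addHaarMeasure_self]
    simp
  | insert ρ e hρ ih =>
    let T : ℕ → Set (ι → ℚ_[p]) := fun k =>
      (fun y => -Pi.single ρ (k : ℚ_[p]) + y) ⁻¹' padicBox p (insert ρ e)
    have hT : ∀ k, MeasurableSet (T k) := fun k =>
      (measurableSet_padicBox p _).preimage (by fun_prop : Continuous _).measurable
    have hk1 : ∀ k : ℕ, ‖(k : ℚ_[p])‖ ≤ 1 := fun k => by
      simpa using Padic.norm_int_le_one (p := p) k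
    have hU : padicBox p e = ⋃ k ∈ Finset.range p, T k := by
      ext y
      simp only [mem_iUnion, Finset.mem_range, exists_prop, T, mem_preimage]
      constructor
      · intro hy
        obtain ⟨k, hk, h⟩ := exists_nat_norm_sub_lt_one p (y ρ) (hy ρ).1
        refine ⟨k, hk, fun ρ' => ?_⟩
        by_cases hρ' : ρ' = ρ
        · subst hρ'
          simp only [Pi.add_apply, Pi.neg_apply, Pi.single_eq_same, neg_add_eq_sub]
          exact ⟨h.le, fun _ => h⟩
        · simp only [Pi.add_apply, Pi.neg_apply, Pi.single_eq_of_ne hρ', neg_zero, zero_add,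
            Finset.mem_insert, hρ', false_or]
          exact hy ρ'
      · rintro ⟨k, hk, hy⟩ ρ'
        have h1 := hy ρ'
        by_cases hρ' : ρ' = ρ
        · subst hρ'
          simp only [Pi.add_apply, Pi.neg_apply, Pi.single_eq_same, neg_add_eq_sub] at h1
          refine ⟨?_, fun h => (hρ h).elim⟩
          rw [← sub_add_cancel (y ρ') (k : ℚ_[p])]
          exact (Padic.nonarchimedean _ _).trans (max_le h1.1 (hk1 k))
        · simpa only [Pi.add_apply, Pi.neg_apply, Pi.single_eq_of_ne hρ', neg_zero, zero_add,
            Finset.mem_insert, hρ', false_or] using h1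
    have hd : PairwiseDisjoint (Finset.range p : Set ℕ) T := by
      intro k hk l hl hkl
      refine Set.disjoint_left.2 fun y hyk hyl => hkl ?_
      have h1 := (hyk ρ).2 (Finset.mem_insert_self _ _)
      have h2 := (hyl ρ).2 (Finset.mem_insert_self _ _)
      simp only [Pi.add_apply, Pi.neg_apply, Pi.single_eq_same, neg_add_eq_sub] at h1 h2
      have h3 : ‖(((k : ℤ) - l : ℤ) : ℚ_[p])‖ < 1 := by
        have : (((k : ℤ) - l : ℤ) : ℚ_[p]) = (y ρ - l) + -(y ρ - k) := by push_cast; ring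
        rw [this]
        exact (Padic.nonarchimedean _ _).trans_lt (max_lt h2 (by rwa [norm_neg]))
      rw [Padic.norm_intCast_lt_one_iff] at h3
      have hk' : (k : ℤ) < p := by exact_mod_cast Finset.mem_range.1 hk
      have hl' : (l : ℤ) < p := by exact_mod_cast Finset.mem_range.1 hl
      have := Int.eq_zero_of_abs_lt_dvd h3 (abs_lt.2 ⟨by omega, by omega⟩)
      omega
    have hle : ∀ k, m (T k) = m (padicBox p (insert ρ e)) := fun k => measure_preimage_add _ _ _
    have hsum : m.real (padicBox p e) = p * m.real (padicBox p (insert ρ e)) := by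
      rw [measureReal_def, hU, measure_biUnion_finset hd fun k _ => hT k]
      simp [hle, measureReal_def]
    rw [Finset.card_insert_of_notMem hρ, pow_succ, ← ih, hsum]
    field_simp

/-- Reduction modulo `p` decides membership in the torsor, since `ℤ_p` is local. Möbius inversion
writes the indicator as a combination of indicators of boxes, which is then integrated. -/
theorem padicDensity_eq :
    X.padicDensity p = ∑ e, (X.moebius e : ℝ) * ((p : ℝ)⁻¹) ^ e.card := by
  classical
  let _ : MeasurableSpace (ι → ℚ_[p]) := borel _
  have : BorelSpace (ι → ℚ_[p]) := ⟨rfl⟩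
  set m := Measure.addHaarMeasure (padicUnitBox ι p) with hm
  have hfin : ∀ e : Finset ι, m (padicBox p e) ≠ ⊤ := fun e => by
    refine ne_top_of_le_ne_top (b := m (padicUnitBox ι p)) ?_ (measure_mono fun y hy => ?_)
    · rw [Measure.addHaarMeasure_self]; exact ENNReal.one_ne_top
    · exact (mem_padicUnitBox_iff p y).2 fun ρ => (hy ρ).1
  set T := (fun (y : ι → ℤ_[p]) ρ => (y ρ : ℚ_[p])) '' X.torsor ℤ_[p] with hT
  have hTmem : ∀ y : ι → ℚ_[p], y ∈ T ↔ (∀ ρ, ‖y ρ‖ ≤ 1) ∧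
      (Finset.univ.filter fun ρ => ‖y ρ‖ < 1) ∈ X.cones := by
    have htor : ∀ z : ι → ℤ_[p], z ∈ X.torsor ℤ_[p] ↔
        (Finset.univ.filter fun ρ => ‖(z ρ : ℚ_[p])‖ < 1) ∈ X.cones := by
      intro z
      have h1 : ∀ ρ, z ρ ∈ IsLocalRing.maximalIdeal ℤ_[p] ↔ ‖(z ρ : ℚ_[p])‖ < 1 := fun ρ => by
        rw [PadicInt.maximalIdeal_eq_span_p, Ideal.mem_span_singleton,
          ← PadicInt.norm_lt_one_iff_dvd, PadicInt.norm_def]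
      simp_rw [← h1]
      rw [mem_torsor_iff]
      refine ⟨fun h => ?_, fun h M hM => ?_⟩
      · convert h _ (IsLocalRing.maximalIdeal.isMaximal ℤ_[p])
      · obtain rfl := IsLocalRing.eq_maximalIdeal hM
        convert h
    intro y
    constructor
    · rintro ⟨z, hz, rfl⟩
      exact ⟨fun ρ => (z ρ).2, (htor z).1 hz⟩
    · rintro ⟨h1, h2⟩
      exact ⟨fun ρ => ⟨y ρ, h1 ρ⟩, (htor _).2 h2, rfl⟩
  have hind : T.indicator (fun _ => (1 : ℝ)) =
      fun y => ∑ e, (X.moebius e : ℝ) * (padicBox p e).indicator (fun _ => (1 : ℝ)) y := by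
    funext y
    by_cases hy : ∀ ρ, ‖y ρ‖ ≤ 1
    · have h1 : ∀ e : Finset ι, y ∈ padicBox p e ↔ e ⊆ Finset.univ.filter fun ρ => ‖y ρ‖ < 1 := by
        intro e
        simp only [padicBox, mem_ofPred_eq, hy, true_and, Finset.subset_iff, Finset.mem_filter,
          Finset.mem_univ]
      have h2 := X.sum_moebius_filter (Finset.univ.filter fun ρ => ‖y ρ‖ < 1)
      simp only [indicator_apply, h1, hTmem, mul_ite, mul_one, mul_zero, hy, implies_true, true_and]
      exact_mod_cast h2.symm
    · have h1 : ∀ e : Finset ι, y ∉ padicBox p e := fun e h => hy fun ρ => (h ρ).1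
      simp [h1, hTmem, hy]
  have hTm : MeasurableSet T := by
    have hm1 : Measurable fun y => ∑ e, (X.moebius e : ℝ) *
        (padicBox p e).indicator (fun _ => (1 : ℝ)) y :=
      Finset.measurable_sum _ fun e _ =>
        (measurable_const.indicator (measurableSet_padicBox p e)).const_mul _
    rw [← hind, measurable_indicator_const_iff] at hm1
    exact hm1
  change m.real T = _
  rw [← integral_indicator_one hTm]
  change ∫ y, T.indicator (fun _ => (1 : ℝ)) y ∂m = _
  rw [hind, integral_finsetSum _ fun e _ => ((integrable_indicator_iff
    (measurableSet_padicBox p e)).2 (integrableOn_const (hfin e))).const_mul _]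
  refine Finset.sum_congr rfl fun e _ => ?_
  rw [integral_const_mul]
  congr 1
  rw [← measure_padicBox p e]
  exact integral_indicator_one (measurableSet_padicBox p e)

end Padic

end SmoothProjectiveFan

/-! ### Integers in finite unions of intervals -/

/-- The counting measure of the integers, as a measure on the line. -/
def intMeasure : Measure ℝ := Measure.map (fun k : ℤ => (k : ℝ)) Measure.count

theorem intMeasure_apply (A : Set ℝ) : intMeasure A = Measure.count ((fun k : ℤ => (k : ℝ)) ⁻¹' A) :=
  Int.isClosedEmbedding_coe_real.measurableEmbedding.map_apply _ _

instance sigmaFinite_intMeasure : SigmaFinite intMeasure :=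
  Int.isClosedEmbedding_coe_real.measurableEmbedding.sigmaFinite_map

theorem intMeasure_Icc (a b : ℝ) : intMeasure (Icc a b) = ((⌊b⌋ + 1 - ⌈a⌉).toNat : ENNReal) := by
  rw [intMeasure_apply]
  change Measure.count (Int.cast ⁻¹' _) = _
  rw [Int.preimage_Icc, ← Finset.coe_Icc, Measure.count_apply_finset, Int.card_Icc]

theorem intMeasure_Ioo (a b : ℝ) : intMeasure (Ioo a b) = ((⌈b⌉ - ⌊a⌋ - 1).toNat : ENNReal) := by
  rw [intMeasure_apply]
  change Measure.count (Int.cast ⁻¹' _) = _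
  rw [Int.preimage_Ioo, ← Finset.coe_Ioo, Measure.count_apply_finset, Int.card_Ioo]

/-- A bounded interval lies between the open and the closed interval with endpoints its infimum and
supremum, and both contain as many integers as their length up to one. -/
theorem abs_intMeasure_sub_volume_le {I : Set ℝ} (hI : I.OrdConnected) {b : ℝ}
    (hb : I ⊆ Icc (-b) b) : |intMeasure.real I - volume.real I| ≤ 1 := by
  rcases I.eq_empty_or_nonempty with rfl | hne
  · simp
  have hbb : BddBelow I := bddBelow_Icc.mono hb
  have hba : BddAbove I := bddAbove_Icc.mono hb
  have hle : sInf I ≤ sSup I := csInf_le_csSup hne hbb hba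
  have h1 : Ioo (sInf I) (sSup I) ⊆ I :=
    IsConnected.Ioo_csInf_csSup_subset ⟨hne, hI.isPreconnected⟩ hbb hba
  have h2 : I ⊆ Icc (sInf I) (sSup I) := subset_Icc_csInf_csSup hbb hba
  have hfin : intMeasure (Icc (sInf I) (sSup I)) ≠ ⊤ := by rw [intMeasure_Icc]; finiteness
  have hv : volume.real I = sSup I - sInf I := by
    refine le_antisymm ?_ ?_
    · simpa [hle] using measureReal_mono (μ := volume) h2 (by simp)
    · have := measureReal_mono (μ := volume) h1
        (ne_top_of_le_ne_top (b := volume (Icc (sInf I) (sSup I))) (by simp) (measure_mono h2))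
      simpa [hle] using this
  have h3 : intMeasure.real I ≤ sSup I - sInf I + 1 := by
    refine (measureReal_mono h2 hfin).trans ?_
    rw [measureReal_def, intMeasure_Icc, ENNReal.toReal_natCast]
    have h : (((⌊sSup I⌋ + 1 - ⌈sInf I⌉).toNat : ℤ) : ℝ) = max (⌊sSup I⌋ + 1 - ⌈sInf I⌉ : ℝ) 0 := by
      rw [Int.toNat_eq_max]; push_cast; rfl
    rw [← Int.cast_natCast, h]
    exact max_le (by linarith [Int.floor_le (sSup I), Int.le_ceil (sInf I)]) (by linarith)
  have h4 : sSup I - sInf I - 1 ≤ intMeasure.real I := by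
    refine le_trans ?_ (measureReal_mono h1 (ne_top_of_le_ne_top hfin (measure_mono h2)))
    rw [measureReal_def, intMeasure_Ioo, ENNReal.toReal_natCast]
    have h : (((⌈sSup I⌉ - ⌊sInf I⌋ - 1).toNat : ℤ) : ℝ) = max (⌈sSup I⌉ - ⌊sInf I⌋ - 1 : ℝ) 0 := by
      rw [Int.toNat_eq_max]; push_cast; rfl
    rw [← Int.cast_natCast, h]
    exact (by linarith [Int.floor_le (sInf I), Int.le_ceil (sSup I)] : _ ≤ _).trans (le_max_left _ _)
  rw [hv, abs_le]
  constructor <;> linarith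

/-- Measures of unions of intervals differ by a bounded amount if those of intervals do. -/
theorem abs_measure_biUnion_sub_le {α β : Measure ℝ} {b : ℝ} (hα : α (Icc (-b) b) ≠ ⊤)
    (hβ : β (Icc (-b) b) ≠ ⊤)
    (h : ∀ I : Set ℝ, I.OrdConnected → I ⊆ Icc (-b) b → |α.real I - β.real I| ≤ 1)
    {τ : Type*} (t : Finset τ) (I : τ → Set ℝ) (hI : ∀ k, (I k).OrdConnected)
    (hIb : ∀ k ∈ t, I k ⊆ Icc (-b) b) :
    |α.real (⋃ k ∈ t, I k) - β.real (⋃ k ∈ t, I k)| ≤ 2 ^ t.card - 1 := by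
  classical
  induction t using Finset.induction generalizing I with
  | empty => simp
  | insert j t hj ih =>
    have hjb := hIb j (Finset.mem_insert_self _ _)
    have htb := fun k hk => hIb k (Finset.mem_insert_of_mem hk)
    have hUb : (⋃ k ∈ t, I k) ⊆ Icc (-b) b := iUnion₂_subset htb
    have h1 := ih I hI htb
    have h2 := ih (fun k => I k ∩ I j) (fun k => (hI k).inter (hI j))
      fun k hk => inter_subset_left.trans (htb k hk)
    have h3 := h (I j) (hI j) hjb
    simp_rw [← iUnion₂_inter] at h2
    -- The intersections with `I j` are again intervals, so the induction hypothesis also applies to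
    -- them. The error thus obeys `2 (2^k - 1) + 1 = 2^(k+1) - 1`.
    have key : ∀ γ : Measure ℝ, γ (Icc (-b) b) ≠ ⊤ → γ.real (⋃ k ∈ insert j t, I k) =
        γ.real (⋃ k ∈ t, I k) + γ.real (I j) - γ.real ((⋃ k ∈ t, I k) ∩ I j) := by
      intro γ hγ
      rw [Finset.set_biUnion_insert, union_comm, eq_sub_iff_add_eq]
      exact measureReal_union_add_inter (hI j).measurableSet
        (ne_top_of_le_ne_top hγ (measure_mono hUb)) (ne_top_of_le_ne_top hγ (measure_mono hjb))
    rw [key α hα, key β hβ, Finset.card_insert_of_notMem hj, pow_succ]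
    rw [abs_le] at *
    constructor <;> linarith

theorem measure_biUnion_le_add {α β : Measure ℝ} {b : ℝ} (hα : α (Icc (-b) b) ≠ ⊤)
    (hβ : β (Icc (-b) b) ≠ ⊤)
    (h : ∀ I : Set ℝ, I.OrdConnected → I ⊆ Icc (-b) b → |α.real I - β.real I| ≤ 1)
    {τ : Type*} [Fintype τ] (I : τ → Set ℝ) (hI : ∀ k, (I k).OrdConnected)
    (hIb : (⋃ k, I k) ⊆ Icc (-b) b) :
    α (⋃ k, I k) ≤ β (⋃ k, I k) + 2 ^ Fintype.card τ := by
  have h1 := abs_measure_biUnion_sub_le hα hβ h Finset.univ I hI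
    fun k _ => (subset_iUnion I k).trans hIb
  simp only [Finset.mem_univ, iUnion_true, Finset.card_univ] at h1
  have hα' := ne_top_of_le_ne_top hα (measure_mono hIb)
  have hβ' := ne_top_of_le_ne_top hβ (measure_mono hIb)
  rw [← ENNReal.toReal_le_toReal hα' (by finiteness), ENNReal.toReal_add hβ' (by finiteness)]
  simp only [measureReal_def] at h1
  have h2 := (abs_le.1 h1).2
  simp only [ENNReal.toReal_pow, ENNReal.toReal_ofNat]
  linarith

/-! ### Comparison of product measures and lattice points with interval sections -/

section Pi

variable {κ : Type*} [Fintype κ] [DecidableEq κ]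

/-- Integrate the variable `i` first: each section changes by at most `c`, and it is empty unless
the other coordinates lie in the box, whose measure is at most the product of the `M j`. -/
theorem pi_update_le_add {γ : κ → Measure ℝ} [∀ j, SigmaFinite (γ j)] (i : κ) {α : Measure ℝ}
    [SigmaFinite α] {E : Set (κ → ℝ)} (hE : MeasurableSet E) {b : κ → ℝ}
    (hEb : ∀ x ∈ E, ∀ j, x j ∈ Icc (-b j) (b j)) {c : ENNReal} {M : κ → ENNReal}
    (hM : ∀ j, γ j (Icc (-b j) (b j)) ≤ M j)
    (h : ∀ y, α {t | Function.update y i t ∈ E} ≤ γ i {t | Function.update y i t ∈ E} + c) :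
    Measure.pi (Function.update γ i α) E ≤
      Measure.pi γ E + c * ∏ j ∈ Finset.univ.erase i, M j := by
  have hsf : ∀ j, SigmaFinite (Function.update γ i α j) := fun j => by
    by_cases hj : j = i
    · subst hj; simpa
    · rw [Function.update_of_ne hj]; infer_instance
  let s := Finset.univ.erase i
  have hf : Measurable (E.indicator (1 : (κ → ℝ) → ENNReal)) := measurable_one.indicator hE
  have hsec : ∀ (δ : Measure ℝ) (y : κ → ℝ), ∫⁻ t, E.indicator 1 (Function.update y i t) ∂δ =
      δ {t | Function.update y i t ∈ E} := by
    intro δ y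
    exact lintegral_indicator_one (hE.preimage (measurable_update y))
  have key : ∀ (δ : κ → Measure ℝ) [∀ j, SigmaFinite (δ j)], Measure.pi δ E =
      ∫⁻ z : (∀ _ : s, ℝ), δ i {t | Function.update (Function.updateFinset (0 : κ → ℝ) s z) i t ∈ E}
        ∂Measure.pi fun j : s => δ j := by
    intro δ _
    rw [← lintegral_indicator_one hE, lintegral_eq_lmarginal_univ (0 : κ → ℝ),
      lmarginal_erase' _ hf (Finset.mem_univ i)]
    simp only [lmarginal, hsec]
    rfl
  have hγ : (fun j : s => Function.update γ i α j) = fun j : s => γ j := by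
    funext j
    rw [Function.update_of_ne (Finset.ne_of_mem_erase j.2)]
  rw [key, key γ, hγ, Function.update_self]
  let box : Set (∀ _ : s, ℝ) := univ.pi fun j => Icc (-b j) (b j)
  have hbox : MeasurableSet box := MeasurableSet.univ_pi fun _ => measurableSet_Icc
  calc _ ≤ ∫⁻ z : (∀ _ : s, ℝ), (γ i {t | Function.update (Function.updateFinset (0 : κ → ℝ) s z) i t ∈ E} +
        box.indicator (fun _ => c) z) ∂Measure.pi fun j : s => γ j := by
        refine lintegral_mono fun z => ?_
        by_cases hz : z ∈ box
        · rw [indicator_of_mem hz]; exact h _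
        · have : {t | Function.update (Function.updateFinset (0 : κ → ℝ) s z) i t ∈ E} = ∅ := by
            refine eq_empty_of_forall_notMem fun t ht => hz fun j _ => ?_
            have := hEb _ ht j
            rwa [Function.update_of_ne (Finset.ne_of_mem_erase j.2), Function.updateFinset,
              dif_pos j.2] at this
          rw [this]
          simp
    _ ≤ _ := by
        rw [lintegral_add_right _ (measurable_const.indicator hbox)]
        gcongr
        rw [lintegral_indicator_const hbox, Measure.pi_pi]
        gcongr
        exact (Finset.prod_le_prod' (s := Finset.univ) fun (j : s) _ => hM j).trans_eq
          (Finset.prod_coe_sort s M)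

/-- The factors `β j` are replaced by `α j` one at a time. -/
theorem pi_le_pi_add {α β : κ → Measure ℝ} [∀ j, SigmaFinite (α j)] [∀ j, SigmaFinite (β j)]
    {E : Set (κ → ℝ)} (hE : MeasurableSet E) {b : κ → ℝ}
    (hEb : ∀ x ∈ E, ∀ j, x j ∈ Icc (-b j) (b j)) {c : ENNReal} {M : κ → ENNReal}
    (hα : ∀ j, α j (Icc (-b j) (b j)) ≤ M j) (hβ : ∀ j, β j (Icc (-b j) (b j)) ≤ M j)
    (h : ∀ i y, α i {t | Function.update y i t ∈ E} ≤ β i {t | Function.update y i t ∈ E} + c) :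
    Measure.pi α E ≤ Measure.pi β E + c * ∑ i, ∏ j ∈ Finset.univ.erase i, M j := by
  have key : ∀ s : Finset κ, Measure.pi (s.piecewise α β) E ≤
      Measure.pi β E + c * ∑ i ∈ s, ∏ j ∈ Finset.univ.erase i, M j := by
    intro s
    induction s using Finset.induction with
    | empty => simp
    | insert i s hi ih =>
      have hsf : ∀ j, SigmaFinite (s.piecewise α β j) := fun j => by
        by_cases hj : j ∈ s <;> simp only [hj, Finset.piecewise_eq_of_mem,
          Finset.piecewise_eq_of_notMem, not_false_eq_true] <;> infer_instance
      rw [Finset.piecewise_insert, Finset.sum_insert hi, mul_add, add_comm (c * _), ← add_assoc]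
      refine (pi_update_le_add (γ := s.piecewise α β) i hE hEb (c := c) (M := M) (fun j => ?_)
        fun y => ?_).trans (by gcongr)
      · by_cases hj : j ∈ s
        · rw [Finset.piecewise_eq_of_mem _ _ _ hj]; exact hα j
        · rw [Finset.piecewise_eq_of_notMem _ _ _ hj]; exact hβ j
      · rw [Finset.piecewise_eq_of_notMem _ _ _ hi]; exact h i y
  simpa using key Finset.univ

omit [DecidableEq κ] in
theorem pi_intMeasure (E : Set (κ → ℝ)) (hE : MeasurableSet E) :
    Measure.pi (fun _ : κ => intMeasure) E = ({y : κ → ℤ | (fun i => (y i : ℝ)) ∈ E}).encard := by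
  have h1 : Measure.pi (fun _ : κ => (Measure.count : Measure ℤ)) = Measure.count :=
    Measure.ext_iff_singleton.2 fun y => by simp [Measure.pi_singleton]
  have hm : Measurable fun (y : κ → ℤ) i => (y i : ℝ) := by fun_prop
  have h2 : SigmaFinite (Measure.map (fun k : ℤ => (k : ℝ)) Measure.count) := sigmaFinite_intMeasure
  simp only [intMeasure]
  rw [← Measure.pi_map_pi (f := fun _ (k : ℤ) => (k : ℝ)) fun _ => by fun_prop, h1,
    Measure.map_apply hm hE, Measure.count_apply (hE.preimage hm)]
  rfl

/-- Counting lattice points in a bounded set whose sections parallel to the coordinate axes are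
unions of a bounded number of intervals. -/
theorem abs_ncard_sub_volume_le {τ : Type*} [Fintype τ] {E : Set (κ → ℝ)} (hE : MeasurableSet E)
    {b : κ → ℝ} (hb : ∀ j, 0 ≤ b j) (hEb : ∀ x ∈ E, ∀ j, |x j| ≤ b j)
    (hsec : ∀ i y, ∃ I : τ → Set ℝ, (∀ k, (I k).OrdConnected) ∧
      {t | Function.update y i t ∈ E} = ⋃ k, I k) :
    {y : κ → ℤ | (fun i => (y i : ℝ)) ∈ E}.Finite ∧
    |({y : κ → ℤ | (fun i => (y i : ℝ)) ∈ E}.ncard : ℝ) - volume.real E| ≤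
      2 ^ Fintype.card τ * ∑ i, ∏ j ∈ Finset.univ.erase i, (2 * b j + 1) := by
  have hEb' : ∀ x ∈ E, ∀ j, x j ∈ Icc (-b j) (b j) := fun x hx j => abs_le.1 (hEb x hx j)
  let M : κ → ENNReal := fun j => ENNReal.ofReal (2 * b j + 1)
  have hI : ∀ j, intMeasure (Icc (-b j) (b j)) ≤ M j := fun j => by
    rw [intMeasure_Icc, ← ENNReal.ofReal_natCast]
    refine ENNReal.ofReal_le_ofReal ?_
    have h : (((⌊b j⌋ + 1 - ⌈-b j⌉).toNat : ℤ) : ℝ) = max (⌊b j⌋ + 1 - ⌈-b j⌉ : ℝ) 0 := by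
      rw [Int.toNat_eq_max]; push_cast; rfl
    rw [← Int.cast_natCast, h]
    exact max_le (by linarith [Int.floor_le (b j), Int.le_ceil (-b j)]) (by linarith [hb j])
  have hV : ∀ j, volume (Icc (-b j) (b j)) ≤ M j := fun j => by
    rw [Real.volume_Icc]
    exact ENNReal.ofReal_le_ofReal (by linarith)
  have hI' : ∀ j, intMeasure (Icc (-b j) (b j)) ≠ ⊤ := fun j =>
    ne_top_of_le_ne_top ENNReal.ofReal_ne_top (hI j)
  have hV' : ∀ j, (volume : Measure ℝ) (Icc (-b j) (b j)) ≠ ⊤ := fun j =>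
    ne_top_of_le_ne_top ENNReal.ofReal_ne_top (hV j)
  have hsb : ∀ i y, {t | Function.update y i t ∈ E} ⊆ Icc (-b i) (b i) := fun i y t ht => by
    have := hEb' _ ht i
    rwa [Function.update_self] at this
  have h1 := pi_le_pi_add (α := fun _ => intMeasure) (β := fun _ => volume) hE hEb'
    (c := 2 ^ Fintype.card τ) hI hV fun i y => by
      obtain ⟨I, hIo, hIe⟩ := hsec i y
      have hs := hsb i y
      rw [hIe] at hs ⊢
      exact measure_biUnion_le_add (hI' i) (hV' i)
        (fun _ h h' => abs_intMeasure_sub_volume_le h h') I hIo hs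
  have h2 := pi_le_pi_add (α := fun _ => volume) (β := fun _ => intMeasure) hE hEb'
    (c := 2 ^ Fintype.card τ) hV hI fun i y => by
      obtain ⟨I, hIo, hIe⟩ := hsec i y
      have hs := hsb i y
      rw [hIe] at hs ⊢
      exact measure_biUnion_le_add (hV' i) (hI' i)
        (fun _ h h' => abs_sub_comm _ _ |>.trans_le (abs_intMeasure_sub_volume_le h h')) I hIo hs
  rw [pi_intMeasure E hE, ← volume_pi] at h1 h2
  have hc : (2 : ENNReal) ^ Fintype.card τ * ∑ i, ∏ j ∈ Finset.univ.erase i, M j =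
      ENNReal.ofReal (2 ^ Fintype.card τ * ∑ i, ∏ j ∈ Finset.univ.erase i, (2 * b j + 1)) := by
    have h0 : ∀ j, 0 ≤ 2 * b j + 1 := fun j => by linarith [hb j]
    rw [ENNReal.ofReal_mul (by positivity), ENNReal.ofReal_sum_of_nonneg fun i _ =>
      Finset.prod_nonneg fun j _ => h0 j]
    simp only [ENNReal.ofReal_prod_of_nonneg fun j _ => h0 j, M]
    norm_num
  have hR0 : 0 ≤ 2 ^ Fintype.card τ * ∑ i, ∏ j ∈ Finset.univ.erase i, (2 * b j + 1) :=
    mul_nonneg (by positivity) (Finset.sum_nonneg fun i _ => Finset.prod_nonneg fun j _ => by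
      linarith [hb j])
  rw [hc] at h1 h2
  have hEfin : volume E ≠ ⊤ := by
    refine ne_top_of_le_ne_top (b := volume (univ.pi fun j => Icc (-b j) (b j))) ?_
      (measure_mono fun x hx j _ => hEb' x hx j)
    rw [volume_pi_pi]
    exact ENNReal.prod_ne_top fun j _ => hV' j
  have hfin : {y : κ → ℤ | (fun i => (y i : ℝ)) ∈ E}.Finite := by
    rw [← Set.encard_ne_top_iff]
    intro h
    rw [h] at h1
    simp only [ENat.toENNReal_top, top_le_iff] at h1
    exact (ENNReal.add_ne_top.2 ⟨hEfin, ENNReal.ofReal_ne_top⟩) h1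
  refine ⟨hfin, ?_⟩
  rw [← hfin.cast_ncard_eq, ENat.toENNReal_coe, ← ENNReal.ofReal_natCast,
    ← ofReal_measureReal hEfin, ← ENNReal.ofReal_add (by positivity) hR0,
    ENNReal.ofReal_le_ofReal_iff (by positivity)] at h1 h2
  rw [abs_le]
  constructor <;> linarith

omit [Fintype κ] in
theorem ordConnected_update_mem {C : Set (κ → ℝ)} (hC : Convex ℝ C) (l : κ → ℝ) (i : κ) :
    {t | Function.update l i t ∈ C}.OrdConnected := by
  refine Convex.ordConnected fun t ht s hs a b ha hb hab => ?_
  have := hC ht hs ha hb hab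
  rw [mem_ofPred_eq]
  convert this using 1
  funext j
  by_cases hj : j = i
  · subst hj; simp
  · simp [hj, ← add_mul, hab]

/-- The points off the coordinate hyperplanes with logarithm in `C`. -/
def logSet (C : Set (κ → ℝ)) : Set (κ → ℝ) :=
  {x | (∀ i, x i ≠ 0) ∧ (fun i => Real.log |x i|) ∈ C}

omit [Fintype κ] in
-- In logarithmic coordinates a line parallel to an axis meets a convex set in an interval. On each
-- half-line `t < 0` and `t > 0` the function `log |t|` is monotone, whence one interval for each
-- piece and sign.
theorem exists_section_logSet {τ : Type*} {C : τ → Set (κ → ℝ)} (hC : ∀ k, Convex ℝ (C k))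
    (i : κ) (y : κ → ℝ) : ∃ I : τ × Bool → Set ℝ, (∀ k, (I k).OrdConnected) ∧
      {t | Function.update y i t ∈ logSet (⋃ k, C k)} = ⋃ k, I k := by
  let l : κ → ℝ := fun i => Real.log |y i|
  have hl : ∀ t, (fun j => Real.log |Function.update y i t j|) =
      Function.update l i (Real.log |t|) := by
    intro t
    funext j
    by_cases hj : j = i
    · subst hj; simp
    · simp [hj, l]
  refine ⟨fun k => {t | (if k.2 then 0 < t else t < 0) ∧ (∀ j, j ≠ i → y j ≠ 0) ∧
    Function.update l i (Real.log |t|) ∈ C k.1}, fun ⟨k, e⟩ => ⟨fun t ht s hs r hr => ?_⟩, ?_⟩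
  · obtain ⟨h1, h2, h3⟩ := ht
    obtain ⟨h4, -, h5⟩ := hs
    cases e
    · simp only [Bool.false_eq_true, if_false] at h1 h4
      have hr0 : r < 0 := hr.2.trans_lt h4
      refine ⟨by simpa using hr0, h2, (ordConnected_update_mem (hC k) l i).out h5 h3 ⟨?_, ?_⟩⟩
      · exact Real.log_le_log (abs_pos.2 h4.ne) (by
          rw [abs_of_neg h4, abs_of_neg hr0]; linarith [hr.2])
      · exact Real.log_le_log (abs_pos.2 hr0.ne) (by
          rw [abs_of_neg h1, abs_of_neg hr0]; linarith [hr.1])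
    · simp only [if_true] at h1 h4
      have hr0 : 0 < r := h1.trans_le hr.1
      refine ⟨by simpa using hr0, h2, (ordConnected_update_mem (hC k) l i).out h3 h5 ⟨?_, ?_⟩⟩
      · exact Real.log_le_log (abs_pos.2 h1.ne') (by
          rw [abs_of_pos h1, abs_of_pos hr0]; exact hr.1)
      · exact Real.log_le_log (abs_pos.2 hr0.ne') (by
          rw [abs_of_pos h4, abs_of_pos hr0]; exact hr.2)
  · ext t
    simp only [logSet, mem_ofPred_eq, hl, mem_iUnion, Prod.exists, Bool.exists_bool]
    have hne : (∀ j, Function.update y i t j ≠ 0) ↔ t ≠ 0 ∧ ∀ j, j ≠ i → y j ≠ 0 := by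
      constructor
      · intro h
        exact ⟨by simpa using h i, fun j hj => by simpa [hj] using h j⟩
      · rintro ⟨h1, h2⟩ j
        by_cases hj : j = i
        · subst hj; simpa
        · simpa [hj] using h2 j hj
    rw [hne]
    constructor
    · rintro ⟨⟨h1, h2⟩, k, h3⟩
      rcases h1.lt_or_gt with h | h
      · exact ⟨k, Or.inl ⟨by simpa using h, h2, h3⟩⟩
      · exact ⟨k, Or.inr ⟨by simpa using h, h2, h3⟩⟩
    · rintro ⟨k, ⟨h1, h2, h3⟩ | ⟨h1, h2, h3⟩⟩
      · exact ⟨⟨by simp at h1; exact h1.ne, h2⟩, k, h3⟩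
      · exact ⟨⟨by simp at h1; exact h1.ne', h2⟩, k, h3⟩

end Pi

/-! ### Lattice points in anisotropic dilations -/

section Pi

variable {κ : Type*} [Fintype κ] [DecidableEq κ]

/-- Counting lattice points in an anisotropic dilation of a set which is a finite union of convex
sets in logarithmic coordinates. -/
theorem exists_abs_ncard_scaled_sub_le {τ : Type*} [Fintype τ] {C : τ → Set (κ → ℝ)}
    (hC : ∀ k, Convex ℝ (C k)) (hm : MeasurableSet (logSet (⋃ k, C k))) {R : ℝ} (hR : 1 ≤ R)
    (hb : ∀ x ∈ logSet (⋃ k, C k), ∀ j, |x j| ≤ R) {θ : ℝ} (hθ0 : 0 ≤ θ) (hθ1 : θ ≤ 1) :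
    ∃ K : ℝ, 0 ≤ K ∧ ∀ l : κ → ℝ, (∀ j, 0 < l j) →
      {y : κ → ℤ | (fun j => (y j : ℝ) / l j) ∈ logSet (⋃ k, C k)}.Finite ∧
      |({y : κ → ℤ | (fun j => (y j : ℝ) / l j) ∈ logSet (⋃ k, C k)}.ncard : ℝ) -
        (∏ j, l j) * volume.real (logSet (⋃ k, C k))| ≤ K * (∏ j, l j) * ∑ j, l j ^ (-θ) := by
  set E := logSet (⋃ k, C k) with hE
  set V := volume.real E
  have hV : 0 ≤ V := measureReal_nonneg
  -- The first term bounds the counting error when every `R * l j ≥ 1`. The term `V` covers the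
  -- remaining case, in which there are no points and the whole main term is error.
  refine ⟨2 ^ Fintype.card (τ × Bool) * (3 * R) ^ Fintype.card κ + V, by positivity,
    fun l hl => ?_⟩
  let S : (κ → ℝ) → κ → ℝ := fun x j => x j / l j
  have hS : Measurable S := measurable_pi_iff.2 fun j => (measurable_pi_apply j).div_const _
  have hEl : S ⁻¹' E = logSet (⋃ k, (fun x => (fun j => -Real.log (l j)) + x) ⁻¹' C k) := by
    ext x
    have h1 : (∀ i, x i / l i ≠ 0) ↔ ∀ i, x i ≠ 0 :=
      forall_congr' fun i => by simp [(hl i).ne']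
    simp only [S, hE, logSet, mem_preimage, mem_ofPred_eq, h1, mem_iUnion]
    refine and_congr_right fun h => exists_congr fun k => ?_
    have : (fun i => Real.log |x i / l i|) = (fun j => -Real.log (l j)) + fun i => Real.log |x i| := by
      funext i
      rw [abs_div, abs_of_pos (hl i), Real.log_div (abs_pos.2 (h i)).ne' (hl i).ne']
      simp [sub_eq_neg_add]
    rw [this]
  have hml : MeasurableSet (S ⁻¹' E) := hm.preimage hS
  have hbl : ∀ x ∈ S ⁻¹' E, ∀ j, |x j| ≤ R * l j := by
    intro x hx j
    have := hb _ hx j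
    rwa [abs_div, abs_of_pos (hl j), div_le_iff₀ (hl j)] at this
  have hvol : volume.real (S ⁻¹' E) = (∏ j, l j) * V := by
    have h1 := lintegral_pi_scale (c := l) (fun j => (hl j).ne')
      (F := (S ⁻¹' E).indicator 1) (measurable_one.indicator hml)
    have h2 : (fun x : κ → ℝ => (S ⁻¹' E).indicator (1 : (κ → ℝ) → ENNReal) fun i => l i * x i) =
        E.indicator 1 := by
      funext x
      have : S (fun i => l i * x i) = x := by
        funext j
        simp [S, (hl j).ne']
      by_cases hx : x ∈ E <;> simp [indicator, this, hx]
    rw [h2, lintegral_indicator_one hml, lintegral_indicator_one hm] at h1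
    rw [measureReal_def, h1, ENNReal.toReal_mul, ENNReal.toReal_ofReal (abs_nonneg _),
      abs_of_pos (Finset.prod_pos fun j _ => hl j)]
    rfl
  obtain ⟨hfin, hcount⟩ := abs_ncard_sub_volume_le (τ := τ × Bool) hml
    (fun j => (mul_pos (one_pos.trans_le hR) (hl j)).le) hbl fun i y => by
      rw [hEl]
      exact exists_section_logSet (fun k => (hC k).translate_preimage_right _) i y
  have hset : {y : κ → ℤ | (fun i => (y i : ℝ)) ∈ S ⁻¹' E} =
      {y : κ → ℤ | (fun j => (y j : ℝ) / l j) ∈ E} := rfl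
  rw [hset] at hfin hcount
  rw [hvol] at hcount
  refine ⟨hfin, ?_⟩
  have hpl : 0 < ∏ j, l j := Finset.prod_pos fun j _ => hl j
  have hpow : ∀ j, 0 ≤ l j ^ (-θ) := fun j => (Real.rpow_pos_of_pos (hl j) _).le
  by_cases hcase : ∀ j, 1 ≤ R * l j
  · refine hcount.trans ?_
    have h1 : ∀ i, ∏ j ∈ Finset.univ.erase i, (2 * (R * l j) + 1) ≤
        (3 * R) ^ Fintype.card κ * (∏ j, l j) * l i ^ (-θ) := by
      intro i
      have hi : (3 * R * l i) * ∏ j ∈ Finset.univ.erase i, (2 * (R * l j) + 1) ≤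
          (3 * R) ^ Fintype.card κ * ∏ j, l j := by
        have h2 : (3 * R) ^ Fintype.card κ * ∏ j, l j = ∏ j, (3 * R * l j) := by
          rw [Finset.prod_mul_distrib]; simp
        rw [h2, ← Finset.mul_prod_erase _ _ (Finset.mem_univ i)]
        have h3 := hcase i
        refine mul_le_mul_of_nonneg_left (Finset.prod_le_prod (fun j _ => ?_) fun j _ => ?_)
          (by linarith)
        · linarith [hcase j]
        · linarith [hcase j]
      -- The missing side length is traded for the weaker saving `l i ^ θ`; `θ ≤ 1` serves when `l i
      -- ≥ 1`, and `R * l i ≥ 1` otherwise.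
      have h4 : l i ^ θ ≤ 3 * R * l i := by
        rcases le_total 1 (l i) with h | h
        · have := Real.rpow_le_rpow_of_exponent_le h hθ1
          rw [Real.rpow_one] at this
          nlinarith
        · have := Real.rpow_le_one (hl i).le h hθ0
          linarith [hcase i]
      have h5 : (l i ^ θ) * ∏ j ∈ Finset.univ.erase i, (2 * (R * l j) + 1) ≤
          (3 * R) ^ Fintype.card κ * ∏ j, l j :=
        (mul_le_mul_of_nonneg_right h4 (Finset.prod_nonneg fun j _ => by linarith [hcase j])).trans hi
      rw [Real.rpow_neg (hl i).le, ← div_eq_mul_inv, le_div_iff₀ (Real.rpow_pos_of_pos (hl i) _),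
        mul_comm]
      exact h5
    calc _ ≤ 2 ^ Fintype.card (τ × Bool) *
          ∑ i, (3 * R) ^ Fintype.card κ * (∏ j, l j) * l i ^ (-θ) := by
            gcongr with i; exact h1 i
      _ = 2 ^ Fintype.card (τ × Bool) * (3 * R) ^ Fintype.card κ *
          (∏ j, l j) * ∑ i, l i ^ (-θ) := by
            rw [← Finset.mul_sum]; ring
      _ ≤ _ := by
            have : 0 ≤ ∑ i, l i ^ (-θ) := Finset.sum_nonneg fun i _ => hpow i
            gcongr
            linarith
  -- If `R * l i < 1`, an integral point would have its coordinate `i` equal to zero, which `logSet`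
  -- excludes. The main term is absorbed since `l i ^ (-θ) ≥ 1`.
  · obtain ⟨i, hi⟩ := not_forall.1 hcase
    rw [not_le] at hi
    have hempty : {y : κ → ℤ | (fun j => (y j : ℝ) / l j) ∈ E} = ∅ := by
      refine eq_empty_of_forall_notMem fun y hy => ?_
      have h1 : |(y i : ℝ)| < 1 := (hbl (fun j => (y j : ℝ)) hy i).trans_lt hi
      have h2 : y i = 0 := by
        rw [← Int.abs_lt_one_iff]
        exact_mod_cast h1
      exact hy.1 i (by simp [h2])
    rw [hempty]
    have hli : l i ≤ 1 := by nlinarith [hl i]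
    have h1 : 1 ≤ l i ^ (-θ) := Real.one_le_rpow_of_pos_of_le_one_of_nonpos (hl i) hli (by linarith)
    have h2 : 1 ≤ ∑ j, l j ^ (-θ) :=
      h1.trans (Finset.single_le_sum (f := fun j => l j ^ (-θ)) (fun j _ => hpow j)
        (Finset.mem_univ i))
    simp only [ncard_empty, Nat.cast_zero, zero_sub, abs_neg, abs_mul, abs_of_pos hpl,
      abs_of_nonneg hV]
    calc (∏ j, l j) * V = V * (∏ j, l j) * 1 := by ring
      _ ≤ _ := by
        have h3 : 0 ≤ 2 ^ Fintype.card (τ × Bool) * (3 * R) ^ Fintype.card κ := by positivity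
        gcongr
        linarith

end Pi

/-! ### Möbius inversion over finite sets of primes and Euler products -/

section PrimeProd

variable {ι : Type*} [Fintype ι] [DecidableEq ι] {P : Finset Nat.Primes}

/-- The product of the primes `p` with `ρ ∈ e p`. -/
def primeProd (e : P → Finset ι) (ρ : ι) : ℕ := ∏ p : P, if ρ ∈ e p then (p : ℕ) else 1

omit [Fintype ι] in
theorem primeProd_pos (e : P → Finset ι) (ρ : ι) : 0 < primeProd e ρ :=
  Finset.prod_pos fun p _ => by
    split_ifs
    · exact p.1.2.pos
    · exact one_pos

theorem prod_primeProd (e : P → Finset ι) :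
    ∏ ρ, primeProd e ρ = ∏ p : P, ((p : ℕ)) ^ (e p).card := by
  simp only [primeProd]
  rw [Finset.prod_comm]
  refine Finset.prod_congr rfl fun p _ => ?_
  rw [Finset.prod_ite_mem, Finset.univ_inter, Finset.prod_const]

omit [Fintype ι] in
theorem primeProd_dvd_iff (e : P → Finset ι) (ρ : ι) (z : ℤ) :
    (primeProd e ρ : ℤ) ∣ z ↔ ∀ p : P, ρ ∈ e p → ((p : ℕ) : ℤ) ∣ z := by
  constructor
  · intro h p hp
    refine dvd_trans ?_ h
    have := Finset.dvd_prod_of_mem (fun p : P => if ρ ∈ e p then (p : ℕ) else 1) (Finset.mem_univ p)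
    simp only [if_pos hp] at this
    exact_mod_cast this
  · intro h
    rw [primeProd, Nat.cast_prod]
    refine Finset.prod_dvd_of_coprime (fun p _ q _ hpq => ?_) fun p _ => ?_
    · simp only [Function.onFun]
      rw [Nat.isCoprime_iff_coprime]
      split_ifs
      · exact (Nat.coprime_primes p.1.2 q.1.2).2 fun h => hpq (Subtype.ext (Subtype.ext h))
      all_goals simp
    · split_ifs with hp
      · exact h p hp
      · simp

end PrimeProd

namespace SmoothProjectiveFan

variable {n : ℕ} {ι : Type*} [Fintype ι] [DecidableEq ι] (X : SmoothProjectiveFan n ι)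

/-- A nonempty set with nonzero Möbius value is not a cone, so it has at least `f` elements, and
`(1/f + ε) f > 1`. This is where the exponent `1 - 1/f - ε` comes from. -/
theorem one_lt_mul_card {ε : ℝ} (hε : 0 < ε) {e : Finset ι} (he : e ≠ ∅) (hμ : X.moebius e ≠ 0) :
    1 < (1 / (X.primitiveIndex : ℝ) + ε) * e.card := by
  have hec : e ∉ X.cones := fun h => hμ (X.moebius_eq_zero h he)
  have hmem : e.card ∈ {k | ∃ S : Finset ι, S.card = k ∧ ¬ ∃ σ ∈ X.cones, S ⊆ σ} :=
    ⟨e, rfl, fun ⟨σ, hσ, h⟩ => hec (X.face_mem σ hσ e h)⟩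
  have hle : X.primitiveIndex ≤ e.card := Nat.sInf_le hmem
  -- The set defining `f` is nonempty, so `f = 0` would be attained by the empty set of rays, which
  -- is a cone.
  have hpos : 0 < X.primitiveIndex := by
    rw [Nat.pos_iff_ne_zero]
    intro h0
    obtain ⟨S, hS, hSn⟩ := Nat.sInf_mem ⟨_, hmem⟩
    rw [show sInf _ = X.primitiveIndex from rfl, h0, Finset.card_eq_zero] at hS
    exact hSn ⟨∅, X.empty_mem, hS.le⟩
  have hf : (0 : ℝ) < X.primitiveIndex := by exact_mod_cast hpos
  calc (1 : ℝ) < 1 + ε * X.primitiveIndex := by linarith [mul_pos hε hf]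
    _ = (1 / (X.primitiveIndex : ℝ) + ε) * X.primitiveIndex := by field_simp
    _ ≤ _ := by gcongr

/-- The terms of the local Euler factor, apart from the first one. -/
def eulerTail (s : ℝ) (p : ℕ) : ℝ :=
  ∑ e ∈ Finset.univ.erase (∅ : Finset ι), |(X.moebius e : ℝ)| * ((p : ℝ) ^ e.card) ^ (-s)

theorem eulerTail_nonneg (s : ℝ) (p : ℕ) : 0 ≤ X.eulerTail s p :=
  Finset.sum_nonneg fun e _ => by positivity

theorem sum_eq_one_add_eulerTail (s : ℝ) (p : ℕ) :
    ∑ e, |(X.moebius e : ℝ)| * ((p : ℝ) ^ e.card) ^ (-s) = 1 + X.eulerTail s p := by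
  rw [← Finset.add_sum_erase _ _ (Finset.mem_univ ∅), moebius_empty, eulerTail]
  simp

theorem summable_eulerTail {s : ℝ} (hs : ∀ e ≠ ∅, X.moebius e ≠ 0 → 1 < s * e.card) :
    Summable fun p : Nat.Primes => X.eulerTail s p := by
  refine summable_sum fun e he => ?_
  by_cases hμ : X.moebius e = 0
  · simp [hμ, summable_zero]
  · refine Summable.mul_left _ ?_
    have h1 := hs e (Finset.ne_of_mem_erase he) hμ
    refine (Nat.Primes.summable_rpow.2 (by linarith : -(s * e.card) < -1)).congr fun p => ?_
    rw [← Real.rpow_natCast, ← Real.rpow_mul (Nat.cast_nonneg _)]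
    congr 1
    ring

/-- From `1 + x ≤ exp x`; the bound is uniform in the finite set of primes. -/
theorem prod_eulerFactor_le {s : ℝ} (hs : ∀ e ≠ ∅, X.moebius e ≠ 0 → 1 < s * e.card)
    (P : Finset Nat.Primes) :
    ∏ p ∈ P, ∑ e, |(X.moebius e : ℝ)| * (((p : ℕ) : ℝ) ^ e.card) ^ (-s) ≤
      Real.exp (∑' p : Nat.Primes, X.eulerTail s p) := by
  simp_rw [sum_eq_one_add_eulerTail]
  refine le_trans ?_ (Real.exp_le_exp.2 ((X.summable_eulerTail hs).sum_le_tsum P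
    fun p _ => X.eulerTail_nonneg s p))
  rw [Real.exp_sum]
  exact Finset.prod_le_prod (fun p _ => by linarith [X.eulerTail_nonneg s p]) fun p _ => by
    linarith [Real.add_one_le_exp (X.eulerTail s p)]

/-- As `s ≤ 1`, each `p ^ (-|e|)` is at most `p ^ (-s |e|)`, and the deviation of the density from
one is dominated by a summable tail. -/
theorem multipliable_padicDensity {s : ℝ} (hs : ∀ e ≠ ∅, X.moebius e ≠ 0 → 1 < s * e.card)
    (hs1 : s ≤ 1) :
    Multipliable fun p : Nat.Primes => haveI := Fact.mk p.2; X.padicDensity p := by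
  have h1 : ∀ p : Nat.Primes, haveI := Fact.mk p.2
      X.padicDensity p = 1 + (X.padicDensity p - 1) := fun p => by ring
  refine Multipliable.congr ?_ fun p => (h1 p).symm
  refine multipliable_one_add_of_summable ((X.summable_eulerTail hs).of_nonneg_of_le
    (fun _ => norm_nonneg _) fun p => ?_)
  have := Fact.mk p.2
  rw [padicDensity_eq, ← Finset.add_sum_erase _ _ (Finset.mem_univ ∅), moebius_empty]
  simp only [Int.cast_one, Finset.card_empty, pow_zero, mul_one, add_sub_cancel_left]
  refine (norm_sum_le _ _).trans (Finset.sum_le_sum fun e _ => ?_)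
  rw [norm_mul, Real.norm_eq_abs]
  refine mul_le_mul_of_nonneg_left ?_ (abs_nonneg _)
  have hp : (1 : ℝ) ≤ (p : ℕ) := by exact_mod_cast p.2.one_le
  rw [Real.norm_of_nonneg (by positivity), inv_pow, ← Real.rpow_neg_one]
  exact Real.rpow_le_rpow_of_exponent_le (one_le_pow₀ hp) (by linarith)

open Classical in
/-- Möbius inversion for the integral points of the torsor. -/
theorem indicator_torsor_int {P : Finset Nat.Primes} {y : ι → ℤ}
    (hP : ∀ p : Nat.Primes, ∀ ρ, ((p : ℕ) : ℤ) ∣ y ρ → p ∈ P) :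
    (if y ∈ X.torsor ℤ then 1 else 0 : ℝ) = ∑ e : P → Finset ι, (∏ p, (X.moebius (e p) : ℝ)) *
      if ∀ ρ, (primeProd e ρ : ℤ) ∣ y ρ then 1 else 0 := by
  have h1 : (if y ∈ X.torsor ℤ then 1 else 0 : ℝ) = ∏ p : P,
      if (Finset.univ.filter fun ρ => ((p : ℕ) : ℤ) ∣ y ρ) ∈ X.cones then (1 : ℝ) else 0 := by
    rw [Finset.prod_boole]
    congr 1
    rw [mem_torsor_int_iff, eq_iff_iff]
    refine ⟨fun h p _ => by convert h p p.1.2, fun h p hp => ?_⟩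
    by_cases hpP : (⟨p, hp⟩ : Nat.Primes) ∈ P
    · convert h ⟨⟨p, hp⟩, hpP⟩ (Finset.mem_univ _)
    -- A prime outside `P` divides no coordinate, so its condition is that the empty set is a cone.
    · convert X.empty_mem
      refine Finset.filter_eq_empty_iff.2 fun ρ _ h => hpP (hP ⟨p, hp⟩ ρ h)
  have h2 : ∀ p : P, (if (Finset.univ.filter fun ρ => ((p : ℕ) : ℤ) ∣ y ρ) ∈ X.cones then (1 : ℝ)
      else 0) = ∑ e, if e ⊆ (Finset.univ.filter fun ρ => ((p : ℕ) : ℤ) ∣ y ρ) then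
        (X.moebius e : ℝ) else 0 := by
    intro p
    have := X.sum_moebius_filter (Finset.univ.filter fun ρ => ((p : ℕ) : ℤ) ∣ y ρ)
    exact_mod_cast this.symm
  rw [h1]
  simp_rw [h2]
  rw [Finset.prod_univ_sum, Fintype.piFinset_univ]
  refine Finset.sum_congr rfl fun e _ => ?_
  have h3 : (∀ ρ, (primeProd e ρ : ℤ) ∣ y ρ) ↔
      ∀ p ∈ (Finset.univ : Finset P), e p ⊆ Finset.univ.filter fun ρ => ((p : ℕ) : ℤ) ∣ y ρ := by
    simp only [primeProd_dvd_iff, Finset.subset_iff, Finset.mem_filter, Finset.mem_univ, true_and,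
      forall_const]
    exact forall_comm
  rw [if_congr h3 rfl rfl]
  by_cases h : ∀ p ∈ (Finset.univ : Finset P),
      e p ⊆ Finset.univ.filter fun ρ => ((p : ℕ) : ℤ) ∣ y ρ
  · rw [if_pos h, mul_one]
    exact Finset.prod_congr rfl fun p hp => if_pos (h p hp)
  · rw [if_neg h, mul_zero]
    push Not at h
    obtain ⟨p, hp, hn⟩ := h
    exact Finset.prod_eq_zero hp (if_neg hn)

omit [Fintype ι] [DecidableEq ι] in
-- Dividing each coordinate by `d ρ` turns divisibility into a smaller scale `b ρ / d ρ`.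
theorem ncard_divisible (E : Set (ι → ℝ)) (b : ι → ℝ) {d : ι → ℕ} (hd : ∀ ρ, 0 < d ρ) :
    {y : ι → ℤ | (fun ρ => (y ρ : ℝ) / b ρ) ∈ E ∧ ∀ ρ, (d ρ : ℤ) ∣ y ρ}.ncard =
      {y : ι → ℤ | (fun ρ => (y ρ : ℝ) / (b ρ / d ρ)) ∈ E}.ncard := by
  have hinj : Function.Injective fun (y : ι → ℤ) ρ => (d ρ : ℤ) * y ρ := fun y z h => by
    funext ρ
    have := congrFun h ρ
    have h0 : (d ρ : ℤ) ≠ 0 := by exact_mod_cast (hd ρ).ne'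
    exact mul_left_cancel₀ h0 this
  rw [← Set.ncard_image_of_injective {y : ι → ℤ | (fun ρ => (y ρ : ℝ) / (b ρ / d ρ)) ∈ E} hinj]
  congr 1
  ext y
  have h1 : ∀ z : ι → ℤ, (fun ρ => (((d ρ : ℤ) * z ρ : ℤ) : ℝ) / b ρ) =
      fun ρ => (z ρ : ℝ) / (b ρ / d ρ) := fun z => by
    funext ρ
    have : (d ρ : ℝ) ≠ 0 := by exact_mod_cast (hd ρ).ne'
    push_cast
    rw [div_div_eq_mul_div, mul_comm]
  simp only [mem_ofPred_eq, mem_image]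
  constructor
  · rintro ⟨hy, hdvd⟩
    choose z hz using hdvd
    obtain rfl : y = fun ρ => (d ρ : ℤ) * z ρ := funext hz
    exact ⟨z, by rwa [← h1], rfl⟩
  · rintro ⟨z, hz, rfl⟩
    exact ⟨by rwa [h1], fun ρ => dvd_mul_right _ _⟩

/-- Counting the integral points of the torsor in an anisotropic dilation of a set. -/
theorem abs_ncard_torsor_sub_le {E : Set (ι → ℝ)} (hE0 : ∀ x ∈ E, ∀ ρ, x ρ ≠ 0) {V K θ : ℝ}
    (hθ : 0 ≤ θ) (hK : 0 ≤ K)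
    (hcount : ∀ l : ι → ℝ, (∀ ρ, 0 < l ρ) →
      {y : ι → ℤ | (fun ρ => (y ρ : ℝ) / l ρ) ∈ E}.Finite ∧
      |({y : ι → ℤ | (fun ρ => (y ρ : ℝ) / l ρ) ∈ E}.ncard : ℝ) - (∏ ρ, l ρ) * V| ≤
        K * (∏ ρ, l ρ) * ∑ ρ, l ρ ^ (-θ))
    (hs : ∀ e ≠ ∅, X.moebius e ≠ 0 → 1 < (1 - θ) * e.card) {b : ι → ℝ} (hb : ∀ ρ, 0 < b ρ) :
    |({y : ι → ℤ | y ∈ X.torsor ℤ ∧ (fun ρ => (y ρ : ℝ) / b ρ) ∈ E}.ncard : ℝ) -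
      (∏ ρ, b ρ) * V * ∏' p : Nat.Primes, haveI := Fact.mk p.2; X.padicDensity p| ≤
      K * Real.exp (∑' p : Nat.Primes, X.eulerTail (1 - θ) p) * (∏ ρ, b ρ) * ∑ ρ, b ρ ^ (-θ) := by
  classical
  obtain ⟨hfin, -⟩ := hcount b hb
  have hB : 0 < ∏ ρ, b ρ := Finset.prod_pos fun ρ _ => hb ρ
  -- the primes dividing the coordinates of the points
  have hprimes : {p : Nat.Primes | ∃ y ∈ hfin.toFinset, ∃ ρ, ((p : ℕ) : ℤ) ∣ y ρ}.Finite := by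
    have : {p : Nat.Primes | ∃ y ∈ hfin.toFinset, ∃ ρ, ((p : ℕ) : ℤ) ∣ y ρ} =
        ⋃ y ∈ hfin.toFinset, ⋃ ρ, {p : Nat.Primes | ((p : ℕ) : ℤ) ∣ y ρ} := by
      ext p; simp
    rw [this]
    refine hfin.toFinset.finite_toSet.biUnion fun y hy => Set.finite_iUnion fun ρ => ?_
    have hy0 : y ρ ≠ 0 := fun h0 => hE0 _ (hfin.mem_toFinset.1 hy) ρ (by simp [h0])
    refine Set.Finite.of_finite_image (f := fun p : Nat.Primes => (p : ℕ)) ?_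
      Subtype.val_injective.injOn
    refine ((y ρ).natAbs.divisors.finite_toSet).subset ?_
    rintro _ ⟨p, hp, rfl⟩
    simpa [hy0] using Int.natCast_dvd.1 hp
  -- The estimate is proved for the partial products over all large finite sets `P` of primes, with
  -- a bound independent of `P`, and passes to the limit.
  refine le_of_tendsto ((((X.multipliable_padicDensity hs (by linarith)).hasProd.const_mul
    ((∏ ρ, b ρ) * V)).const_sub _).abs) ?_
  filter_upwards [Filter.eventually_ge_atTop hprimes.toFinset] with P hP
  have hsum : ({y : ι → ℤ | y ∈ X.torsor ℤ ∧ (fun ρ => (y ρ : ℝ) / b ρ) ∈ E}.ncard : ℝ) =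
      ∑ e : P → Finset ι, (∏ p, (X.moebius (e p) : ℝ)) *
        ({y : ι → ℤ | (fun ρ => (y ρ : ℝ) / (b ρ / primeProd e ρ)) ∈ E}.ncard : ℝ) := by
    have h1 : {y : ι → ℤ | y ∈ X.torsor ℤ ∧ (fun ρ => (y ρ : ℝ) / b ρ) ∈ E} =
        ((hfin.toFinset.filter fun y => y ∈ X.torsor ℤ : Finset (ι → ℤ)) : Set (ι → ℤ)) := by
      ext y; simp [and_comm]
    have h2 : ∀ e : P → Finset ι,
        ({y : ι → ℤ | (fun ρ => (y ρ : ℝ) / (b ρ / primeProd e ρ)) ∈ E}.ncard : ℝ) =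
        ∑ y ∈ hfin.toFinset, if ∀ ρ, (primeProd e ρ : ℤ) ∣ y ρ then 1 else 0 := by
      intro e
      rw [← ncard_divisible E b (primeProd_pos e)]
      have : {y : ι → ℤ | (fun ρ => (y ρ : ℝ) / b ρ) ∈ E ∧ ∀ ρ, (primeProd e ρ : ℤ) ∣ y ρ} =
          ((hfin.toFinset.filter fun y => ∀ ρ, (primeProd e ρ : ℤ) ∣ y ρ : Finset (ι → ℤ)) :
            Set (ι → ℤ)) := by
        ext y; simp
      rw [this, Set.ncard_coe_finset, Finset.card_filter]
      push_cast
      rfl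
    rw [h1, Set.ncard_coe_finset, Finset.card_filter]
    simp_rw [h2, Finset.mul_sum]
    rw [Finset.sum_comm]
    push_cast
    refine Finset.sum_congr rfl fun y hy => X.indicator_torsor_int fun p ρ h => hP ?_
    exact hprimes.mem_toFinset.2 ⟨y, hy, ρ, h⟩
  have hprod : ∏ p ∈ P, (haveI := Fact.mk p.2; X.padicDensity p) =
      ∑ e : P → Finset ι, (∏ p, (X.moebius (e p) : ℝ)) * (∏ ρ, (primeProd e ρ : ℝ))⁻¹ := by
    rw [← Finset.prod_coe_sort]
    have h1 : ∀ p : P, (haveI := Fact.mk p.1.2; X.padicDensity p) =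
        ∑ e, (X.moebius e : ℝ) * (((p : ℕ) : ℝ)⁻¹) ^ e.card := fun p => by
      have := Fact.mk p.1.2
      exact X.padicDensity_eq p
    simp_rw [h1]
    rw [Finset.prod_univ_sum, Fintype.piFinset_univ]
    refine Finset.sum_congr rfl fun e _ => ?_
    rw [Finset.prod_mul_distrib, ← Nat.cast_prod, prod_primeProd]
    simp
  have hterm : ∀ e : P → Finset ι,
      |({y : ι → ℤ | (fun ρ => (y ρ : ℝ) / (b ρ / primeProd e ρ)) ∈ E}.ncard : ℝ) -
        (∏ ρ, b ρ) * V * (∏ ρ, (primeProd e ρ : ℝ))⁻¹| ≤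
      K * (∏ ρ, b ρ) * (∑ ρ, b ρ ^ (-θ)) * ∏ p : P, (((p : ℕ) : ℝ) ^ (e p).card) ^ (-(1 - θ)) := by
    intro e
    have hd : ∀ ρ, (0 : ℝ) < primeProd e ρ := fun ρ => by exact_mod_cast primeProd_pos e ρ
    have hd1 : ∀ ρ, (1 : ℝ) ≤ primeProd e ρ := fun ρ => by exact_mod_cast primeProd_pos e ρ
    have h1 := (hcount (fun ρ => b ρ / primeProd e ρ) fun ρ => div_pos (hb ρ) (hd ρ)).2
    rw [Finset.prod_div_distrib] at h1
    have hDpos : (0 : ℝ) < ∏ ρ, (primeProd e ρ : ℝ) := Finset.prod_pos fun ρ _ => hd ρ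
    rw [show (∏ ρ, b ρ) * V * (∏ ρ, (primeProd e ρ : ℝ))⁻¹ =
      (∏ ρ, b ρ) / (∏ ρ, (primeProd e ρ : ℝ)) * V by ring]
    refine h1.trans ?_
    -- Each `d_ρ ^ θ` is bounded by the `θ`-th power of the product `∏ d_ρ`. Together with the
    -- factor `(∏ d_ρ)⁻¹` of the volume this leaves the exponent `-(1 - θ)`, which is multiplicative
    -- over the primes.
    have h2 : ∑ ρ, (b ρ / primeProd e ρ) ^ (-θ) ≤
        (∑ ρ, b ρ ^ (-θ)) * (∏ ρ, (primeProd e ρ : ℝ)) ^ θ := by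
      rw [Finset.sum_mul]
      refine Finset.sum_le_sum fun ρ _ => ?_
      rw [Real.div_rpow (hb ρ).le (hd ρ).le, Real.rpow_neg (hd ρ).le, div_inv_eq_mul]
      refine mul_le_mul_of_nonneg_left (Real.rpow_le_rpow (hd ρ).le ?_ hθ)
        (Real.rpow_pos_of_pos (hb ρ) _).le
      rw [← Finset.mul_prod_erase _ _ (Finset.mem_univ ρ)]
      exact le_mul_of_one_le_right (hd ρ).le (by
        simpa using Finset.prod_le_prod (s := Finset.univ.erase ρ) (f := fun _ => (1 : ℝ))
          (fun _ _ => zero_le_one) fun ρ' _ => hd1 ρ')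
    have h3 : (∏ p : P, (((p : ℕ) : ℝ) ^ (e p).card) ^ (-(1 - θ))) =
        (∏ ρ, (primeProd e ρ : ℝ))⁻¹ * (∏ ρ, (primeProd e ρ : ℝ)) ^ θ := by
      rw [Real.finsetProd_rpow _ _ fun p _ => by positivity]
      have : (∏ p : P, ((p : ℕ) : ℝ) ^ (e p).card) = ∏ ρ, (primeProd e ρ : ℝ) := by
        exact_mod_cast (prod_primeProd e).symm
      rw [this, ← Real.rpow_neg_one, ← Real.rpow_add hDpos]
      congr 1
      ring
    rw [h3]
    calc _ ≤ K * ((∏ ρ, b ρ) / (∏ ρ, (primeProd e ρ : ℝ))) *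
          ((∑ ρ, b ρ ^ (-θ)) * (∏ ρ, (primeProd e ρ : ℝ)) ^ θ) := by gcongr
      _ = _ := by ring
  rw [hsum, hprod, Finset.mul_sum, ← Finset.sum_sub_distrib]
  calc _ ≤ ∑ e : P → Finset ι, |∏ p, (X.moebius (e p) : ℝ)| *
        (K * (∏ ρ, b ρ) * (∑ ρ, b ρ ^ (-θ)) *
          ∏ p : P, (((p : ℕ) : ℝ) ^ (e p).card) ^ (-(1 - θ))) := by
        refine (Finset.abs_sum_le_sum_abs _ _).trans (Finset.sum_le_sum fun e _ => ?_)
        rw [mul_left_comm, ← mul_sub, abs_mul]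
        exact mul_le_mul_of_nonneg_left (hterm e) (abs_nonneg _)
    _ = K * (∏ ρ, b ρ) * (∑ ρ, b ρ ^ (-θ)) *
        ∏ p ∈ P, ∑ e, |(X.moebius e : ℝ)| * (((p : ℕ) : ℝ) ^ e.card) ^ (-(1 - θ)) := by
        generalize ∑ ρ, b ρ ^ (-θ) = S
        rw [← Finset.prod_coe_sort P, Finset.prod_univ_sum, Fintype.piFinset_univ, Finset.mul_sum]
        refine Finset.sum_congr rfl fun e _ => ?_
        rw [Finset.prod_mul_distrib, Finset.abs_prod]
        ring
    _ ≤ K * (∏ ρ, b ρ) * (∑ ρ, b ρ ^ (-θ)) *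
        Real.exp (∑' p : Nat.Primes, X.eulerTail (1 - θ) p) := by
        have h0 : 0 ≤ ∑ ρ, b ρ ^ (-θ) :=
          Finset.sum_nonneg fun ρ _ => (Real.rpow_pos_of_pos (hb ρ) _).le
        gcongr
        exact X.prod_eulerFactor_le hs P
    _ = _ := by ring

end SmoothProjectiveFan

theorem IsPolyhedron.convex {V : Type*} [AddCommGroup V] [Module ℝ V] {P : Set V}
    (hP : IsPolyhedron P) : Convex ℝ P := by
  obtain ⟨k, l, c, rfl⟩ := hP
  have : {a | ∀ i, l i a ≤ c i} = ⋂ i, {a | l i a ≤ c i} := by ext; simp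
  rw [this]
  exact convex_iInter fun i => convex_halfSpace_le (l i).isLinear (c i)

/-- A trivial bound for the number of lattice points of a box on the coordinate hyperplanes. -/
theorem ncard_exists_eq_zero_le {κ : Type*} [Fintype κ] [DecidableEq κ] {b : κ → ℝ}
    (hb : ∀ j, 0 ≤ b j) :
    {y : κ → ℤ | (∃ i, y i = 0) ∧ ∀ j, |(y j : ℝ)| ≤ b j}.Finite ∧
    ({y : κ → ℤ | (∃ i, y i = 0) ∧ ∀ j, |(y j : ℝ)| ≤ b j}.ncard : ℝ) ≤
      ∑ i, ∏ j ∈ Finset.univ.erase i, (2 * b j + 1) := by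
  let T : κ → Finset (κ → ℤ) := fun i => Fintype.piFinset fun j =>
    if j = i then {0} else Finset.Icc (-⌊b j⌋) ⌊b j⌋
  have hsub : {y : κ → ℤ | (∃ i, y i = 0) ∧ ∀ j, |(y j : ℝ)| ≤ b j} ⊆
      (Finset.univ.biUnion T : Finset (κ → ℤ)) := by
    rintro y ⟨⟨i, hi⟩, hy⟩
    simp only [Finset.coe_biUnion, Finset.coe_univ, mem_univ, iUnion_true, mem_iUnion,
      Finset.mem_coe, T, Fintype.mem_piFinset]
    refine ⟨i, fun j => ?_⟩
    split_ifs with h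
    · subst h; simpa using hi
    · have := abs_le.1 (hy j)
      rw [Finset.mem_Icc]
      constructor
      · rw [neg_le, Int.le_floor]; push_cast; linarith
      · rw [Int.le_floor]; exact this.2
  refine ⟨(Finset.finite_toSet _).subset hsub, ?_⟩
  have h1 := (Set.ncard_le_ncard hsub (Finset.finite_toSet _)).trans
    ((Set.ncard_coe_finset _).trans_le Finset.card_biUnion_le)
  refine (Nat.cast_le.2 h1).trans ?_
  push_cast
  refine Finset.sum_le_sum fun i _ => ?_
  rw [Fintype.card_piFinset, ← Finset.mul_prod_erase _ _ (Finset.mem_univ i), if_pos rfl]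
  simp only [Finset.card_singleton, one_mul, Nat.cast_prod]
  refine Finset.prod_le_prod (fun _ _ => Nat.cast_nonneg _) fun j hj => ?_
  rw [if_neg (Finset.ne_of_mem_erase hj), Int.card_Icc]
  have h : (((⌊b j⌋ + 1 - -⌊b j⌋).toNat : ℤ) : ℝ) = 2 * ⌊b j⌋ + 1 := by
    rw [Int.toNat_of_nonneg (by have := Int.floor_nonneg.2 (hb j); omega)]
    push_cast
    ring
  rw [← Int.cast_natCast, h]
  linarith [Int.floor_le (b j)]

/-! ### Convex pieces of the region and the effect of the translation by `log(B) u` -/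

namespace SmoothProjectiveFan

variable {n : ℕ} {ι : Type*} [Fintype ι] [DecidableEq ι] (X : SmoothProjectiveFan n ι)

/-- The logarithms of the points of the torsor with height in `P` and coordinates of maximal
absolute value outside `σ`. -/
def logPiece (σ : Finset ι) (P : Set X.picDual) : Set (ι → ℝ) :=
  {l | ∃ h ∈ P, (∀ ρ, l ρ ≤ (h : ι → ℝ) ρ) ∧ ∀ ρ, ρ ∉ σ → l ρ = (h : ι → ℝ) ρ}

/-- The defining conditions on `(l, h)` are linear equalities and inequalities together with `h ∈
P`, and the piece is a projection of their solution set. -/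
theorem convex_logPiece (σ : Finset ι) {P : Set X.picDual} (hP : Convex ℝ P) :
    Convex ℝ (X.logPiece σ P) := by
  rintro l ⟨h, hh, h1, h2⟩ l' ⟨h', hh', h1', h2'⟩ a b ha hb hab
  refine ⟨a • h + b • h', hP hh hh' ha hb hab, fun ρ => ?_, fun ρ hρ => ?_⟩ <;>
    simp only [Pi.add_apply, Pi.smul_apply, Submodule.coe_add, Submodule.coe_smul, smul_eq_mul]
  · exact add_le_add (mul_le_mul_of_nonneg_left (h1 ρ) ha) (mul_le_mul_of_nonneg_left (h1' ρ) hb)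
  · rw [h2 ρ hρ, h2' ρ hρ]

variable {X} in
theorem logSet_logPiece {r : ℕ} (P : Fin r → Set X.picDual) :
    logSet (⋃ k : Fin r × X.cones, X.logPiece k.2 (P k.1)) =
      {y | ∀ ρ, y ρ ≠ 0} ∩ X.region (⋃ j, P j) := by
  ext y
  refine and_congr_right fun hy => ?_
  have h0 : ∀ ρ, 0 < |y ρ| := fun ρ => abs_pos.2 (hy ρ)
  have hle : ∀ (h : X.picDual) ρ, Real.log |y ρ| ≤ (h : ι → ℝ) ρ ↔
      |y ρ| ≤ Real.exp ((h : ι → ℝ) ρ) := fun h ρ => Real.log_le_iff_le_exp (h0 ρ)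
  have heq : ∀ (h : X.picDual) ρ, Real.log |y ρ| = (h : ι → ℝ) ρ ↔
      |y ρ| = Real.exp ((h : ι → ℝ) ρ) := fun h ρ =>
    ⟨fun e => by rw [← e, Real.exp_log (h0 ρ)], fun e => by rw [e, Real.log_exp]⟩
  constructor
  · intro H
    obtain ⟨⟨j, σ, hσ⟩, h, hh, h1, h2⟩ := mem_iUnion.1 H
    exact ⟨h, mem_iUnion.2 ⟨j, hh⟩, (X.adapted_iff_exists _ _).2 ⟨σ, hσ,
      fun ρ => (hle h ρ).1 (h1 ρ), fun ρ hρ => (heq h ρ).1 (h2 ρ hρ)⟩⟩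
  · rintro ⟨h, hh, H⟩
    obtain ⟨j, hj⟩ := mem_iUnion.1 hh
    obtain ⟨σ, hσ, h1, h2⟩ := (X.adapted_iff_exists _ _).1 H
    exact mem_iUnion.2 ⟨⟨j, σ, hσ⟩, h, hj, fun ρ => (hle h ρ).2 (h1 ρ),
      fun ρ hρ => (heq h ρ).2 (h2 ρ hρ)⟩

variable {X} in
-- By equivariance, translating heights by `log(B) u` stretches the coordinate `ρ` by `B ^ u_ρ`.
theorem mem_region_translate_iff {D : Set X.picDual} {u : X.picDual} {B : ℝ} (hB : 0 < B)
    {y : ι → ℝ} : y ∈ X.region (X.translate D u B) ↔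
      (fun ρ => y ρ / B ^ (u : ι → ℝ) ρ) ∈ X.region D := by
  have hpow : ∀ ρ, B ^ (u : ι → ℝ) ρ = Real.exp (Real.log B * (u : ι → ℝ) ρ) := fun ρ =>
    Real.rpow_def_of_pos hB _
  constructor
  · rintro ⟨_, ⟨h, hh, rfl⟩, H⟩
    refine ⟨h, hh, ?_⟩
    have := H.mul (s := fun ρ => (B ^ (u : ι → ℝ) ρ)⁻¹) (a := fun ρ => -(Real.log B * (u : ι → ℝ) ρ))
      fun ρ => by rw [hpow, ← Real.exp_neg, Real.abs_exp]
    convert this using 1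
    · funext ρ
      rw [div_eq_inv_mul]
    · funext ρ
      simp
  · rintro ⟨h, hh, H⟩
    refine ⟨_, ⟨h, hh, rfl⟩, ?_⟩
    have := H.mul (s := fun ρ => B ^ (u : ι → ℝ) ρ) (a := fun ρ => Real.log B * (u : ι → ℝ) ρ)
      fun ρ => by rw [hpow, Real.abs_exp]
    convert this using 1
    · funext ρ
      rw [mul_div_cancel₀ _ (Real.rpow_pos_of_pos hB _).ne']
    · funext ρ
      simp [add_comm]

variable {X} in
theorem cast_mem_torsor {y : ι → ℤ} (hy : y ∈ X.torsor ℤ) : (fun ρ => (y ρ : ℝ)) ∈ X.torsor ℝ := by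
  rw [mem_torsor_field_iff]
  -- Zero coordinates are divisible by `2`, so they form a face of the cone attached to this prime.
  refine X.face_mem _ ((X.mem_torsor_int_iff y).1 hy 2 Nat.prime_two) _ fun ρ hρ => ?_
  simp only [Finset.mem_filter, Finset.mem_univ, true_and, Int.cast_eq_zero] at hρ ⊢
  rw [hρ]
  exact dvd_zero _

variable {X} in
theorem mem_integralPoints_translate_iff {D : Set X.picDual} {u : X.picDual} {B : ℝ} (hB : 0 < B)
    {y : ι → ℤ} : y ∈ X.integralPoints (X.translate D u B) ↔
      y ∈ X.torsor ℤ ∧ (fun ρ => (y ρ : ℝ) / B ^ (u : ι → ℝ) ρ) ∈ X.region D := by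
  rw [← mem_region_translate_iff (y := fun ρ => (y ρ : ℝ)) hB, mem_region_iff]
  exact ⟨fun h => ⟨h.1, cast_mem_torsor h.1, h.2⟩, fun h => ⟨h.1, h.2.2⟩⟩

end SmoothProjectiveFan

end

/-! ### The asymptotic formula -/

open SmoothProjectiveFan in
theorem mainTheorem2 {n : ℕ} (hn : 0 < n) {ι : Type*} [Fintype ι] [DecidableEq ι]
    (X : SmoothProjectiveFan n ι)
    {r : ℕ} (P : Fin r → Set X.picDual)
    (hP : ∀ j, IsPolyhedron (P j)) (hPc : ∀ j, IsCompact (P j))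
    (D₁ : Set X.picDual) (hD₁ : D₁ = ⋃ j, P j)
    (u : X.picDual) (hu : u ∈ interior X.effDual)
    (ε : ℝ) (hε : 0 < ε) (hε' : ε < 1 - 1 / (X.primitiveIndex : ℝ)) :
    (Multipliable fun p : Nat.Primes => haveI := Fact.mk p.2; X.padicDensity p) ∧
    X.muInfty univ < ⊤ ∧
    ∃ C : ℝ, 0 < C ∧ ∀ B : ℝ, 1 ≤ B →
      (X.integralPoints (X.translate D₁ u B)).Finite ∧
      |((X.integralPoints (X.translate D₁ u B)).ncard : ℝ) -
          2 ^ X.picRank * (∏' p : Nat.Primes, haveI := Fact.mk p.2; X.padicDensity p) *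
            X.muInfty.real univ * X.nu D₁ * B ^ X.pair SmoothProjectiveFan.antiK u| ≤
        C * B ^ (X.pair SmoothProjectiveFan.antiK u -
          (1 - 1 / (X.primitiveIndex : ℝ) - ε) *
            ⨅ ρ : ι, X.pair (SmoothProjectiveFan.rayDiv ρ) u) := by
  classical
  set θ : ℝ := 1 - 1 / (X.primitiveIndex : ℝ) - ε with hθ
  have hf0 : 0 ≤ 1 / (X.primitiveIndex : ℝ) := by positivity
  have hθ0 : 0 ≤ θ := by linarith
  have hθ1 : θ ≤ 1 := by linarith
  have hs : ∀ e ≠ ∅, X.moebius e ≠ 0 → 1 < (1 - θ) * (e.card : ℝ) := fun e he hμ => by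
    rw [show 1 - θ = 1 / (X.primitiveIndex : ℝ) + ε by rw [hθ]; ring]
    exact X.one_lt_mul_card hε he hμ
  refine ⟨X.multipliable_padicDensity hs (by linarith), X.muInfty_univ_lt_top, ?_⟩
  have hDc : IsCompact D₁ := hD₁ ▸ isCompact_iUnion hPc
  obtain ⟨R, hR1, hR⟩ : ∃ R : ℝ, 1 ≤ R ∧ ∀ y ∈ X.region D₁, ∀ ρ, |y ρ| ≤ R := by
    obtain ⟨R, hR⟩ := (X.isCompact_region hDc).isBounded.exists_norm_le
    exact ⟨max R 1, le_max_right _ _, fun y hy ρ =>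
      ((norm_le_pi_norm y ρ).trans (hR y hy)).trans (le_max_left _ _)⟩
  have : Fintype X.cones := Fintype.ofFinite _
  set E : Set (ι → ℝ) := logSet (⋃ k : Fin r × X.cones, X.logPiece k.2 (P k.1)) with hEdef
  have hE : E = {y | ∀ ρ, y ρ ≠ 0} ∩ X.region D₁ := by rw [hEdef, logSet_logPiece, hD₁]
  -- Removing the coordinate hyperplanes does not change the volume; the integral points lost are
  -- counted by `Z` below.
  have hEae : E =ᵐ[volume] X.region D₁ := by
    filter_upwards [ae_forall_ne_zero ι] with y hy
    rw [hE]
    exact propext (and_iff_right hy)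
  have hEm : MeasurableSet E := by
    have : {y : ι → ℝ | ∀ ρ, y ρ ≠ 0} = ⋂ ρ, {y | y ρ ≠ 0} := by ext; simp
    rw [hE, this]
    exact (MeasurableSet.iInter fun ρ => (measurableSet_singleton (0 : ℝ)).compl.preimage
      (measurable_pi_apply ρ)).inter (X.isCompact_region hDc).isClosed.measurableSet
  have hV : volume.real E = 2 ^ X.picRank * X.nu D₁ * X.muInfty.real univ := by
    rw [measureReal_congr hEae, volume_region hDc]
  obtain ⟨K, hK, hcount⟩ := exists_abs_ncard_scaled_sub_le
    (fun k : Fin r × X.cones => X.convex_logPiece k.2 (hP k.1).convex) hEm hR1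
    (fun x hx => hR x (hE.subset hx).2) hθ0 hθ1
  set m : ℝ := ⨅ ρ : ι, X.pair (SmoothProjectiveFan.rayDiv ρ) u
  have hu0 : ∀ ρ, 0 < (u : ι → ℝ) ρ := X.pos_of_mem_interior_effDual hu
  have hm0 : 0 ≤ m := Real.iInf_nonneg fun ρ => by rw [pair_rayDiv]; exact (hu0 ρ).le
  have hmle : ∀ ρ, m ≤ (u : ι → ℝ) ρ := fun ρ =>
    (ciInf_le (Set.finite_range _).bddBelow ρ).trans_eq (pair_rayDiv ρ u)
  let G := Real.exp (∑' p : Nat.Primes, X.eulerTail (1 - θ) p)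
  let N : ℝ := Fintype.card ι
  -- The three terms bound the error of the Möbius inversion, the points with a zero coordinate, and
  -- ensure positivity.
  refine ⟨K * G * N + N * (3 * R) ^ Fintype.card ι + 1, by positivity, fun B hB => ?_⟩
  have hB0 : 0 < B := one_pos.trans_le hB
  let b : ι → ℝ := fun ρ => B ^ (u : ι → ℝ) ρ
  have hb : ∀ ρ, 0 < b ρ := fun ρ => Real.rpow_pos_of_pos hB0 _
  have hb1 : ∀ ρ, 1 ≤ b ρ := fun ρ => Real.one_le_rpow hB (hu0 ρ).le
  set k := X.pair SmoothProjectiveFan.antiK u with hk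
  have hprod : ∏ ρ, b ρ = B ^ k := by
    rw [hk, pair_antiK, Real.rpow_sum_of_pos hB0]
  set S := X.integralPoints (X.translate D₁ u B)
  have hS : S = {y | y ∈ X.torsor ℤ ∧ (fun ρ => (y ρ : ℝ) / b ρ) ∈ X.region D₁} := by
    ext y
    exact mem_integralPoints_translate_iff hB0
  set W := {y : ι → ℤ | y ∈ X.torsor ℤ ∧ (fun ρ => (y ρ : ℝ) / b ρ) ∈ E}
  set Z := {y : ι → ℤ | (∃ i, y i = 0) ∧ ∀ j, |(y j : ℝ)| ≤ R * b j}
  obtain ⟨hZfin, hZ⟩ := ncard_exists_eq_zero_le (b := fun j => R * b j)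
    fun j => mul_nonneg (by linarith) (hb j).le
  have hWfin : W.Finite := (hcount b hb).1.subset fun y hy => hy.2
  have hWS : W ⊆ S := by
    rw [hS]
    rintro y ⟨h1, h2⟩
    rw [hE] at h2
    exact ⟨h1, h2.2⟩
  have hSWZ : S ⊆ W ∪ Z := by
    rw [hS]
    rintro y ⟨h1, h2⟩
    by_cases h0 : ∃ i, y i = 0
    · refine Or.inr ⟨h0, fun j => ?_⟩
      have := hR _ h2 j
      rwa [abs_div, abs_of_pos (hb j), div_le_iff₀ (hb j)] at this
    · refine Or.inl ⟨h1, ?_⟩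
      rw [hE]
      exact ⟨fun ρ => div_ne_zero (by exact_mod_cast fun h => h0 ⟨ρ, h⟩) (hb ρ).ne', h2⟩
  have hSfin : S.Finite := (hWfin.union hZfin).subset hSWZ
  refine ⟨hSfin, ?_⟩
  have h1 : (W.ncard : ℝ) ≤ S.ncard := by exact_mod_cast Set.ncard_le_ncard hWS hSfin
  have h2 : (S.ncard : ℝ) ≤ W.ncard + Z.ncard := by
    exact_mod_cast (Set.ncard_le_ncard hSWZ (hWfin.union hZfin)).trans (Set.ncard_union_le _ _)
  have hpowle : ∀ ρ, θ * m ≤ (u : ι → ℝ) ρ := fun ρ =>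
    (mul_le_of_le_one_left hm0 hθ1).trans (hmle ρ)
  have h3 : (Z.ncard : ℝ) ≤ N * (3 * R) ^ Fintype.card ι * B ^ (k - θ * m) := by
    -- With one coordinate equal to zero, the other sides contribute `B ^ (k - u_i)` up to a
    -- constant, and `u_i ≥ m ≥ θ m`.
    refine hZ.trans ?_
    have : ∀ i, ∏ j ∈ Finset.univ.erase i, (2 * (R * b j) + 1) ≤
        (3 * R) ^ Fintype.card ι * B ^ (k - θ * m) := by
      intro i
      have hRb : ∀ j, 1 ≤ R * b j := fun j => one_le_mul_of_one_le_of_one_le hR1 (hb1 j)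
      have h4 : ∏ j ∈ Finset.univ.erase i, b j = B ^ (k - (u : ι → ℝ) i) := by
        rw [Real.rpow_sub hB0, ← hprod, eq_div_iff (hb i).ne',
          Finset.prod_erase_mul _ _ (Finset.mem_univ i)]
      calc _ ≤ ∏ j ∈ Finset.univ.erase i, (3 * R * b j) :=
            Finset.prod_le_prod (fun j _ => by linarith [hRb j]) fun j _ => by linarith [hRb j]
        _ = (3 * R) ^ (Finset.univ.erase i).card * B ^ (k - (u : ι → ℝ) i) := by
            rw [Finset.prod_mul_distrib, Finset.prod_const, h4]
        _ ≤ _ := by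
            gcongr
            · linarith
            · exact (Finset.card_erase_le).trans_eq Finset.card_univ
            · exact hpowle i
    refine (Finset.sum_le_sum fun i _ => this i).trans_eq ?_
    rw [Finset.sum_const, Finset.card_univ, nsmul_eq_mul, mul_assoc]
  have h5 := X.abs_ncard_torsor_sub_le (E := E) (fun x hx => hx.1) hθ0 hK hcount hs hb
  have h6 : K * G * (∏ ρ, b ρ) * ∑ ρ, b ρ ^ (-θ) ≤ K * G * N * B ^ (k - θ * m) := by
    have h7 : ∑ ρ, b ρ ^ (-θ) ≤ N * B ^ (-(θ * m)) := by
      have : ∀ ρ, b ρ ^ (-θ) ≤ B ^ (-(θ * m)) := fun ρ => by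
        rw [← Real.rpow_mul hB0.le]
        exact Real.rpow_le_rpow_of_exponent_le hB (by nlinarith [hmle ρ])
      refine (Finset.sum_le_sum fun ρ _ => this ρ).trans_eq ?_
      rw [Finset.sum_const, Finset.card_univ, nsmul_eq_mul]
    rw [sub_eq_add_neg, Real.rpow_add hB0, hprod]
    have hG : 0 ≤ G := (Real.exp_pos _).le
    calc _ ≤ K * G * B ^ k * (N * B ^ (-(θ * m))) := by gcongr
      _ = _ := by ring
  have h8 := h5.trans h6
  rw [hV, hprod] at h8
  have h9 : 0 < B ^ (k - θ * m) := Real.rpow_pos_of_pos hB0 _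
  have hmain : 2 ^ X.picRank * (∏' p : Nat.Primes, haveI := Fact.mk p.2; X.padicDensity p) *
      X.muInfty.real univ * X.nu D₁ * B ^ k =
      B ^ k * (2 ^ X.picRank * X.nu D₁ * X.muInfty.real univ) *
        ∏' p : Nat.Primes, haveI := Fact.mk p.2; X.padicDensity p := by ring
  rw [hmain]
  rw [abs_le] at h8 ⊢
  have h10 : (K * G * N + N * (3 * R) ^ Fintype.card ι + 1) * B ^ (k - θ * m) =
      K * G * N * B ^ (k - θ * m) + N * (3 * R) ^ Fintype.card ι * B ^ (k - θ * m) +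
        B ^ (k - θ * m) := by ring
  have h11 : 0 ≤ N * (3 * R) ^ Fintype.card ι * B ^ (k - θ * m) := by positivity
  rw [h10]
  constructor <;> linarith [h8.1, h8.2]
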